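/- **Setting.** Let $K$ be a commutative ring and let $\Gamma$ be a loop-free quiver, possibly infinite, with vertex set $I$ and arrow set $A$; an arrow $a\in A$ has origin $o(a)$ and target $t(a)\neq o(a)$, and the number $|i\to j|$ of arrows from $i$ to $j$ is finite for all $i,j\in I$. Put $i\cdot j:=|i\to j|+|j\to i|$, and define $Q_{ij}(u,v)\in K[u,v]$ by $Q_{ij}(u,v):=(-1)^{|i\to j|}(u-v)^{i\cdot j}$ if $i\ne j$ and $Q_{ii}(u,v):=0$. Let $\theta$ be an involution of $\Gamma$: an involution on $I$ and an involution on $A$ with $\theta(o(a))=t(\theta(a))$ for all $a\in A$. Let $\lambda\in\mathbb N^I$ and $\gamma\in K^I$ and put $d(i):=\lambda_i+\lambda_{\theta(i)}$ if $\gamma_i=0$, and $d(i):=-2$ otherwise. Assume that for all $i\in I$ $$\theta(i)\ne i\implies\gamma_i=0,\qquad\qquad \gamma_i=0\implies\bigl[\theta(i)\neq i\ \text{ or }\ d(i)=0\bigr].$$ Let $n\ge 0$ and let $B_n$ be the group of permutations $\pi$ of $\{\pm1,\dots,\pm n\}$ with $\pi(-k)=-\pi(k)$, generated by $r_0=(-1,1)$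 and $r_a=(a,a+1)(-a,-a-1)$ for $1\le a\le n-1$. It acts on $I^n$: $r_0$ replaces $i_1$ by $\theta(i_1)$, and $r_a$ ($a\geq 1$) exchanges $i_a$ and $i_{a+1}$. Let $\beta\subseteq I^n$ be a $B_n$-orbit. The algebra $V_\beta(\Gamma,\lambda,\gamma)$ is the unitary associative $K$-algebra generated by $y_1,\dots,y_n$, $\psi_0,\dots,\psi_{n-1}$ and $e(\boldsymbol i)$ for $\boldsymbol i\in\beta$, with the following relations, for all $\boldsymbol i,\boldsymbol j\in\beta$ and all indices for which the generators involved exist: * $\sum_{\boldsymbol i\in\beta}e(\boldsymbol i)=1$, $\ e(\boldsymbol i)e(\boldsymbol j)=\delta_{\boldsymbol i\boldsymbol j}e(\boldsymbol i)$, $\ y_ay_b=y_by_a$, $\ y_ae(\boldsymbol i)=e(\boldsymbol i)y_a$; * $\psi_be(\boldsymbol i)=e(r_b\cdot\boldsymbol i)\psi_b$ for $0\le b\le n-1$; * for $1\le a\le n-1$ and $1\leq b\leq n$: $(\psi_ay_b-y_{r_a(b)}\psi_a)e(\boldsymbol i)$ equals $-e(\boldsymbol i)$ if $b=a$ and $i_a=i_{a+1}$,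 equals $e(\boldsymbol i)$ if $b=a+1$ and $i_a=i_{a+1}$, and is $0$ otherwise; * $\psi_a\psi_b=\psi_b\psi_a$ if $|a-b|>1$, for $0\le a,b\le n-1$; * $\psi_a^2e(\boldsymbol i)=Q_{i_ai_{a+1}}(y_a,y_{a+1})e(\boldsymbol i)$ for $1\le a\le n-1$; * for $1\le b\le n-2$: $(\psi_{b+1}\psi_b\psi_{b+1}-\psi_b\psi_{b+1}\psi_b)e(\boldsymbol i)$ equals $\dfrac{Q_{i_bi_{b+1}}(y_b,y_{b+1})-Q_{i_bi_{b+1}}(y_{b+2},y_{b+1})}{y_b-y_{b+2}}\,e(\boldsymbol i)$ if $i_b=i_{b+2}$, and is $0$ otherwise; * $(\psi_0y_1+y_1\psi_0)e(\boldsymbol i)=2\gamma_{i_1}e(\boldsymbol i)$, and $\psi_0y_a=y_a\psi_0$ for $2\le a\le n$; * $\psi_0^2e(\boldsymbol i)$ equals $(-1)^{\lambda_{\theta(i_1)}}y_1^{d(i_1)}e(\boldsymbol i)$ if $\gamma_{i_1}=0$, and is $0$ otherwise; * if $n\geq 2$: $\bigl((\psi_0\psi_1)^2-(\psi_1\psi_0)^2\bigr)e(\boldsymbol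 i)$ equals $(-1)^{\lambda_{\theta(i_1)}}\dfrac{(-y_1)^{d(i_1)}-y_2^{d(i_1)}}{y_1+y_2}\,\psi_1e(\boldsymbol i)$ if $\gamma_{i_1}=0$ and $\theta(i_1)=i_2$, and equals $\gamma_{i_2}\dfrac{Q_{i_2i_1}(y_1,-y_2)-Q_{i_2i_1}(y_1,y_2)}{y_1y_2}\,(y_1\psi_0-\gamma_{i_1})e(\boldsymbol i)$ otherwise. (All fractions are polynomials; in the last one, the factor $y_1$ is cancelled first when $\gamma_{i_1}=0$, and the whole expression is $0$ when $\gamma_{i_2}=0$.) For each $w\in B_n$ fix a reduced expression $w=r_{a_1}\cdots r_{a_k}$ (that is, one with $k$ minimal) and put $\psi_w:=\psi_{a_1}\cdots\psi_{a_k}$. **Theorem.** For every such choice of reduced expressions, the algebra $V_\beta(\Gamma,\lambda,\gamma)$ is a free $K$-module, and the family $$y_1^{a_1}\cdots y_n^{a_n}\,\psi_w\,e(\boldsymbol i),\qquad (a_1,\dots,a_n)\in\mathbb N^n,\ w\in B_n,\ \boldsymbol i\in\beta,$$ is a $K$-basis of it. -/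

import Mathlib

namespace InterpolatingKLR

noncomputable section

/-! ### Quivers with involution -/

/-- A loop-free quiver, possibly infinite, with vertex set `I`, arrow set `A`, origin map `o` and
target map `t`, having finitely many arrows between any two given vertices. -/
structure LoopFreeQuiver (I : Type*) (A : Type*) where
  o : A → I
  t : A → I
  loop_free : ∀ a, o a ≠ t a
  finite_arrows : ∀ i j, {a | o a = i ∧ t a = j}.Finite

/-- The number `|i → j|` of arrows from `i` to `j`. -/
def LoopFreeQuiver.arrows {I A : Type*} (Γ : LoopFreeQuiver I A) (i j : I) : ℕ :=
  {a | Γ.o a = i ∧ Γ.t a = j}.ncard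

/-- The number `i · j = |i → j| + |i ← j|`. -/
def LoopFreeQuiver.dot {I A : Type*} (Γ : LoopFreeQuiver I A) (i j : I) : ℕ :=
  Γ.arrows i j + Γ.arrows j i

/-- An involution `θ` of a quiver: an involution on vertices and an involution on arrows with
`θ(o(a)) = t(θ(a))` for every arrow `a`. -/
structure LoopFreeQuiver.Involution {I A : Type*} (Γ : LoopFreeQuiver I A) where
  vert : I → I
  arr : A → A
  vert_involutive : Function.Involutive vert
  arr_involutive : Function.Involutive arr
  vert_o : ∀ a, vert (Γ.o a) = Γ.t (arr a)

open MvPolynomial in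
open scoped Classical in
/-- The polynomial `Q_{ij}(u,v) ∈ K[u,v]` (`u = X 0`, `v = X 1`): it is
`(-1)^{|i → j|} (u - v)^{i · j}` if `i ≠ j`, and `0` if `i = j`. -/
def Qpoly {I A : Type*} (K : Type*) [CommRing K] (Γ : LoopFreeQuiver I A) (i j : I) :
    MvPolynomial (Fin 2) K :=
  if i = j then 0 else (-1) ^ Γ.arrows i j * (X 0 - X 1) ^ Γ.dot i j

/-- The value `Q_{ij}(p,q)` for `p`, `q` in `K[x_1, …, x_n]`. -/
def Qval {I A K : Type*} [CommRing K] (Γ : LoopFreeQuiver I A) (i j : I) {n : ℕ}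
    (p q : MvPolynomial (Fin n) K) : MvPolynomial (Fin n) K :=
  MvPolynomial.aeval ![p, q] (Qpoly K Γ i j)

/-! ### Signed permutations

The set `{±1, …, ±n}` is modelled by `Fin n × ℤˣ`, the pair `(a, ε)` standing for `ε(a+1)`. -/

/-- Negation on `{±1, …, ±n}`. -/
def negPt {n : ℕ} (x : Fin n × ℤˣ) : Fin n × ℤˣ := (x.1, -x.2)

/-- The group `B_n` of permutations `π` of `{±1, …, ±n}` with `π(-x) = -π(x)`. -/
def SignedPerm (n : ℕ) : Subgroup (Equiv.Perm (Fin n × ℤˣ)) where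
  carrier := {π | ∀ x, π (negPt x) = negPt (π x)}
  mul_mem' := by
    intro a b ha hb x
    simp only [Set.mem_ofPred_eq] at ha hb
    simp [Equiv.Perm.mul_apply, ha, hb]
  one_mem' := by intro x; rfl
  inv_mem' := by
    intro a ha x
    simp only [Set.mem_ofPred_eq] at ha
    rw [Equiv.Perm.inv_eq_iff_eq, ha]
    simp

theorem negPt_swap {n : ℕ} (u v x : Fin n × ℤˣ) :
    negPt (Equiv.swap u v x) = Equiv.swap (negPt u) (negPt v) (negPt x) :=
  Function.Injective.map_swap (fun p q h => by
    simpa [negPt, Prod.ext_iff] using h) u v x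

/-- The generators of `B_n`: `r_0 = (-1, 1)` and, for `1 ≤ a ≤ n - 1`,
`r_a = (a, a+1)(-a, -a-1)`. -/
def r {n : ℕ} : Fin n → SignedPerm n
  | ⟨0, h⟩ => ⟨Equiv.swap (⟨0, h⟩, 1) (⟨0, h⟩, -1), fun x => by
      rw [negPt_swap]
      simp [negPt, Equiv.swap_comm]⟩
  | ⟨a + 1, h⟩ =>
      ⟨Equiv.swap (⟨a, Nat.lt_of_succ_lt h⟩, 1) (⟨a + 1, h⟩, 1) *
        Equiv.swap (⟨a, Nat.lt_of_succ_lt h⟩, -1) (⟨a + 1, h⟩, -1), fun x => by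
      have hc := (Equiv.Perm.disjoint_swap_swap
        (x := ((⟨a, Nat.lt_of_succ_lt h⟩ : Fin n), (1 : ℤˣ))) (y := (⟨a + 1, h⟩, 1))
        (z := (⟨a, Nat.lt_of_succ_lt h⟩, -1)) (t := (⟨a + 1, h⟩, -1)) (by simp)).commute.eq
      conv_lhs => rw [hc]
      simp only [Equiv.Perm.mul_apply, negPt_swap]
      simp [negPt]⟩

/-- The extension of `i ∈ I^n` to a family indexed by `{±1, …, ±n}`, by `i_{-a} = θ(i_a)`. -/
def extend {I : Type*} (θ : I → I) {n : ℕ} (i : Fin n → I) (x : Fin n × ℤˣ) : I :=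
  if x.2 = 1 then i x.1 else θ (i x.1)

/-- The left action of `B_n` on `I^n`: `(w · i)_a = i_{w⁻¹(a)}`, where `i_{-a} = θ(i_a)`. On the
generators it is given by `act_r_zero` and `act_r_succ` below. -/
def act {I : Type*} (θ : I → I) {n : ℕ} (w : SignedPerm n) (i : Fin n → I) : Fin n → I :=
  fun a => extend θ i ((w⁻¹ : SignedPerm n).1 (a, 1))

theorem act_one {I : Type*} (θ : I → I) {n : ℕ} (i : Fin n → I) : act θ 1 i = i := by
  funext a; simp [act, extend]

theorem extend_act {I : Type*} {θ : I → I} (hθ : Function.Involutive θ) {n : ℕ}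
    (v : SignedPerm n) (i : Fin n → I) (x : Fin n × ℤˣ) :
    extend θ (act θ v i) x = extend θ i ((v⁻¹ : SignedPerm n).1 x) := by
  obtain ⟨a, s⟩ := x
  rcases Int.units_eq_one_or s with rfl | rfl
  · simp [extend, act]
  · have h : (v⁻¹ : SignedPerm n).1 (a, -1) = negPt ((v⁻¹ : SignedPerm n).1 (a, 1)) :=
      (v⁻¹ : SignedPerm n).2 (a, 1)
    have h' : extend θ (act θ v i) (a, -1) = θ (extend θ i ((v⁻¹ : SignedPerm n).1 (a, 1))) := by
      simp only [extend, act]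
      simp
    rw [h, h']
    rcases (v⁻¹ : SignedPerm n).1 (a, 1) with ⟨c, t⟩
    rcases Int.units_eq_one_or t with rfl | rfl <;> simp [extend, negPt, hθ _]

theorem act_mul {I : Type*} {θ : I → I} (hθ : Function.Involutive θ) {n : ℕ}
    (w v : SignedPerm n) (i : Fin n → I) : act θ (w * v) i = act θ w (act θ v i) := by
  funext a
  rw [act, act, extend_act hθ, mul_inv_rev]
  rfl

/-- `r_0 · (i_1, …, i_n) = (θ(i_1), i_2, …, i_n)`. -/
theorem act_r_zero {I : Type*} (θ : I → I) {n : ℕ} (h : 0 < n) (i : Fin n → I) :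
    act θ (r ⟨0, h⟩) i = Function.update i ⟨0, h⟩ (θ (i ⟨0, h⟩)) := by
  funext a
  by_cases ha : a = ⟨0, h⟩
  · subst ha
    simp [act, extend, r]
  · simp [act, extend, r, Equiv.swap_apply_def, ha]

/-- For `a ≥ 1`, `r_a` exchanges the entries `i_a` and `i_{a+1}` of `i`. -/
theorem act_r_succ {I : Type*} (θ : I → I) {n a : ℕ} (h : a + 1 < n) (i : Fin n → I) :
    act θ (r ⟨a + 1, h⟩) i = i ∘ Equiv.swap ⟨a, by omega⟩ ⟨a + 1, h⟩ := by
  funext c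
  simp only [act, extend, r, InvMemClass.coe_inv, mul_inv_rev, Equiv.swap_inv,
    Equiv.Perm.mul_apply, Equiv.swap_apply_def, Function.comp]
  split_ifs <;> simp_all

/-- `β` is a `B_n`-orbit in `I^n`. -/
def IsOrbit {I : Type*} (θ : I → I) {n : ℕ} (β : Finset (Fin n → I)) : Prop :=
  ∃ i : Fin n → I, (β : Set (Fin n → I)) = Set.range fun w : SignedPerm n => act θ w i

/-- The word `a_1, …, a_k` in `{0, …, n-1}` is a reduced expression of `w ∈ B_n`:
`w = r_{a_1} ⋯ r_{a_k}`, and `w` is not a product of fewer generators. -/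
def IsReducedExpression {n : ℕ} (w : SignedPerm n) (l : List (Fin n)) : Prop :=
  (l.map r).prod = w ∧ ∀ l' : List (Fin n), (l'.map r).prod = w → l.length ≤ l'.length

/-! ### The algebra `V_β(Γ, λ, γ)` -/

/-- The generators. With indices shifted to start at zero, `y a` stands for `y_{a+1}`, while
`psi b` stands for `ψ_b` with `0 ≤ b ≤ n - 1`; `e i` stands for `e(i)`, `i ∈ β`. -/
inductive Gen {I : Type*} {n : ℕ} (β : Finset (Fin n → I))
  | y : Fin n → Gen β
  | psi : Fin n → Gen β
  | e : β → Gen β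

section Free

variable {I : Type*} (K : Type*) [CommRing K] {n : ℕ} (β : Finset (Fin n → I))

/-- `y_{a+1}` in the free algebra. -/
def fy (a : Fin n) : FreeAlgebra K (Gen β) := FreeAlgebra.ι K (Gen.y a)

/-- `ψ_b` in the free algebra. -/
def fpsi (b : Fin n) : FreeAlgebra K (Gen β) := FreeAlgebra.ι K (Gen.psi b)

/-- `e(i)` in the free algebra. -/
def fe (i : β) : FreeAlgebra K (Gen β) := FreeAlgebra.ι K (Gen.e i)

/-- The element `p(y_1, …, y_n)` of the free algebra, for `p ∈ K[x_1, …, x_n]`: the linear map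
sending the monomial `x_1^{m_1} ⋯ x_n^{m_n}` to the ordered product `y_1^{m_1} ⋯ y_n^{m_n}`. (The
order is immaterial in `V_β(Γ, λ, γ)`, where the `y_a` commute.) -/
def fpoly : MvPolynomial (Fin n) K →ₗ[K] FreeAlgebra K (Gen β) :=
  (MvPolynomial.basisMonomials (Fin n) K).constr K
    fun m => (List.ofFn fun a => fy K β a ^ m a).prod

end Free

open MvPolynomial in
/-- The defining relations of `V_β(Γ, λ, γ)`. A relation containing a fraction `f / g` of
polynomials is stated with the polynomial `p` such that `g * p = f` (which is unique since the
denominators are not zero divisors, and exists by the lemmas following this definition).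

The exponent `d(i)` only enters when `γ_i = 0`, where it is `λ_i + λ_{θ(i)}`.

Positions are shifted to start at zero: `i.1 ⟨b, _⟩` is `i_{b+1}` and `X ⟨b, _⟩` is evaluated at
`y_{b+1}`, so that `ψ_{b+1}` involves the positions `b` and `b + 1`. -/
inductive Rel {I A K : Type*} [CommRing K] (Γ : LoopFreeQuiver I A) (θ : I → I)
    (lam : I → ℕ) (gam : I → K) {n : ℕ} (β : Finset (Fin n → I)) :
    FreeAlgebra K (Gen β) → FreeAlgebra K (Gen β) → Prop
  /-- `∑ e(i) = 1` -/
  | sum_e : Rel Γ θ lam gam β (∑ i : β, fe K β i) 1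
  /-- `e(i) e(i) = e(i)` -/
  | e_mul_self (i : β) : Rel Γ θ lam gam β (fe K β i * fe K β i) (fe K β i)
  /-- `e(i) e(j) = 0` for `i ≠ j` -/
  | e_mul_of_ne (i j : β) (hij : i ≠ j) : Rel Γ θ lam gam β (fe K β i * fe K β j) 0
  /-- `y_a y_b = y_b y_a` -/
  | y_comm (a b : Fin n) : Rel Γ θ lam gam β (fy K β a * fy K β b) (fy K β b * fy K β a)
  /-- `y_a e(i) = e(i) y_a` -/
  | y_e (a : Fin n) (i : β) : Rel Γ θ lam gam β (fy K β a * fe K β i) (fe K β i * fy K β a)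
  /-- `ψ_b e(i) = e(r_b · i) ψ_b`, for `0 ≤ b ≤ n - 1` -/
  | psi_e (b : Fin n) (i j : β) (hj : j.1 = act θ (r b) i.1) :
      Rel Γ θ lam gam β (fpsi K β b * fe K β i) (fe K β j * fpsi K β b)
  /-- `(ψ_a y_b - y_{r_a(b)} ψ_a) e(i) = -e(i)` if `b = a` and `i_a = i_{a+1}` -/
  | psi_y_left (a : ℕ) (ha : a + 1 < n) (i : β) (hi : i.1 ⟨a, by omega⟩ = i.1 ⟨a + 1, ha⟩) :
      Rel Γ θ lam gam β
        ((fpsi K β ⟨a + 1, ha⟩ * fy K β ⟨a, by omega⟩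
          - fy K β ⟨a + 1, ha⟩ * fpsi K β ⟨a + 1, ha⟩) * fe K β i)
        (- fe K β i)
  /-- `(ψ_a y_b - y_{r_a(b)} ψ_a) e(i) = e(i)` if `b = a + 1` and `i_a = i_{a+1}` -/
  | psi_y_right (a : ℕ) (ha : a + 1 < n) (i : β) (hi : i.1 ⟨a, by omega⟩ = i.1 ⟨a + 1, ha⟩) :
      Rel Γ θ lam gam β
        ((fpsi K β ⟨a + 1, ha⟩ * fy K β ⟨a + 1, ha⟩
          - fy K β ⟨a, by omega⟩ * fpsi K β ⟨a + 1, ha⟩) * fe K β i)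
        (fe K β i)
  /-- `(ψ_a y_b - y_{r_a(b)} ψ_a) e(i) = 0` otherwise -/
  | psi_y_other (a : ℕ) (ha : a + 1 < n) (b : Fin n) (i : β)
      (hb : ¬ ((b = ⟨a, by omega⟩ ∨ b = ⟨a + 1, ha⟩) ∧
        i.1 ⟨a, by omega⟩ = i.1 ⟨a + 1, ha⟩)) :
      Rel Γ θ lam gam β
        ((fpsi K β ⟨a + 1, ha⟩ * fy K β b
          - fy K β (Equiv.swap ⟨a, by omega⟩ ⟨a + 1, ha⟩ b) * fpsi K β ⟨a + 1, ha⟩) * fe K β i)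
        0
  /-- `ψ_a ψ_b = ψ_b ψ_a` if `|a - b| > 1`, for `0 ≤ a, b ≤ n - 1` -/
  | psi_comm (a b : Fin n) (hab : a.1 + 1 < b.1) :
      Rel Γ θ lam gam β (fpsi K β a * fpsi K β b) (fpsi K β b * fpsi K β a)
  /-- `ψ_a² e(i) = Q_{i_a i_{a+1}}(y_a, y_{a+1}) e(i)`, for `1 ≤ a ≤ n - 1` -/
  | psi_sq (a : ℕ) (ha : a + 1 < n) (i : β) :
      Rel Γ θ lam gam β
        (fpsi K β ⟨a + 1, ha⟩ ^ 2 * fe K β i)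
        (fpoly K β (Qval Γ (i.1 ⟨a, by omega⟩) (i.1 ⟨a + 1, ha⟩) (X ⟨a, by omega⟩)
          (X ⟨a + 1, ha⟩)) * fe K β i)
  /-- `(ψ_{b+1} ψ_b ψ_{b+1} - ψ_b ψ_{b+1} ψ_b) e(i)
    = ((Q_{i_b i_{b+1}}(y_b, y_{b+1}) - Q_{i_b i_{b+1}}(y_{b+2}, y_{b+1})) / (y_b - y_{b+2})) e(i)`
  if `i_b = i_{b+2}` -/
  | braid3_eq (b : ℕ) (hb : b + 2 < n) (i : β)
      (hi : i.1 ⟨b, by omega⟩ = i.1 ⟨b + 2, hb⟩)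
      (p : MvPolynomial (Fin n) K)
      (hp : (X ⟨b, by omega⟩ - X ⟨b + 2, hb⟩) * p =
        Qval Γ (i.1 ⟨b, by omega⟩) (i.1 ⟨b + 1, by omega⟩) (X ⟨b, by omega⟩)
            (X ⟨b + 1, by omega⟩)
          - Qval Γ (i.1 ⟨b, by omega⟩) (i.1 ⟨b + 1, by omega⟩) (X ⟨b + 2, hb⟩)
            (X ⟨b + 1, by omega⟩)) :
      Rel Γ θ lam gam β
        ((fpsi K β ⟨b + 2, hb⟩ * fpsi K β ⟨b + 1, by omega⟩ * fpsi K β ⟨b + 2, hb⟩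
          - fpsi K β ⟨b + 1, by omega⟩ * fpsi K β ⟨b + 2, hb⟩ * fpsi K β ⟨b + 1, by omega⟩)
          * fe K β i)
        (fpoly K β p * fe K β i)
  /-- `(ψ_{b+1} ψ_b ψ_{b+1} - ψ_b ψ_{b+1} ψ_b) e(i) = 0` if `i_b ≠ i_{b+2}` -/
  | braid3_ne (b : ℕ) (hb : b + 2 < n) (i : β)
      (hi : i.1 ⟨b, by omega⟩ ≠ i.1 ⟨b + 2, hb⟩) :
      Rel Γ θ lam gam β
        ((fpsi K β ⟨b + 2, hb⟩ * fpsi K β ⟨b + 1, by omega⟩ * fpsi K β ⟨b + 2, hb⟩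
          - fpsi K β ⟨b + 1, by omega⟩ * fpsi K β ⟨b + 2, hb⟩ * fpsi K β ⟨b + 1, by omega⟩)
          * fe K β i)
        0
  /-- `(ψ_0 y_1 + y_1 ψ_0) e(i) = 2 γ_{i_1} e(i)` -/
  | psi0_y1 (h : 0 < n) (i : β) :
      Rel Γ θ lam gam β
        ((fpsi K β ⟨0, h⟩ * fy K β ⟨0, h⟩ + fy K β ⟨0, h⟩ * fpsi K β ⟨0, h⟩) * fe K β i)
        ((2 * gam (i.1 ⟨0, h⟩)) • fe K β i)
  /-- `ψ_0 y_a = y_a ψ_0` for `2 ≤ a ≤ n` -/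
  | psi0_y (h : 0 < n) (a : Fin n) (ha : 0 < a.1) :
      Rel Γ θ lam gam β (fpsi K β ⟨0, h⟩ * fy K β a) (fy K β a * fpsi K β ⟨0, h⟩)
  /-- `ψ_0² e(i) = (-1)^{λ_{θ(i_1)}} y_1^{d(i_1)} e(i)` if `γ_{i_1} = 0` -/
  | psi0_sq_zero (h : 0 < n) (i : β) (hi : gam (i.1 ⟨0, h⟩) = 0) :
      Rel Γ θ lam gam β
        (fpsi K β ⟨0, h⟩ ^ 2 * fe K β i)
        ((-1) ^ lam (θ (i.1 ⟨0, h⟩)) *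
          fy K β ⟨0, h⟩ ^ (lam (i.1 ⟨0, h⟩) + lam (θ (i.1 ⟨0, h⟩))) * fe K β i)
  /-- `ψ_0² e(i) = 0` if `γ_{i_1} ≠ 0` -/
  | psi0_sq_ne (h : 0 < n) (i : β) (hi : gam (i.1 ⟨0, h⟩) ≠ 0) :
      Rel Γ θ lam gam β (fpsi K β ⟨0, h⟩ ^ 2 * fe K β i) 0
  /-- `((ψ_0 ψ_1)² - (ψ_1 ψ_0)²) e(i)
    = (-1)^{λ_{θ(i_1)}} (((-y_1)^{d(i_1)} - y_2^{d(i_1)}) / (y_1 + y_2)) ψ_1 e(i)`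
  if `γ_{i_1} = 0` and `θ(i_1) = i_2` -/
  | braid4_theta (h : 1 < n) (i : β) (hi : gam (i.1 ⟨0, by omega⟩) = 0)
      (hi' : θ (i.1 ⟨0, by omega⟩) = i.1 ⟨1, h⟩)
      (p : MvPolynomial (Fin n) K)
      (hp : (X ⟨0, by omega⟩ + X ⟨1, h⟩) * p =
        (-X ⟨0, by omega⟩) ^ (lam (i.1 ⟨0, by omega⟩) + lam (θ (i.1 ⟨0, by omega⟩)))
          - X ⟨1, h⟩ ^ (lam (i.1 ⟨0, by omega⟩) + lam (θ (i.1 ⟨0, by omega⟩)))) :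
      Rel Γ θ lam gam β
        (((fpsi K β ⟨0, by omega⟩ * fpsi K β ⟨1, h⟩) ^ 2
          - (fpsi K β ⟨1, h⟩ * fpsi K β ⟨0, by omega⟩) ^ 2) * fe K β i)
        ((-1) ^ lam (θ (i.1 ⟨0, by omega⟩)) * fpoly K β p * fpsi K β ⟨1, h⟩ * fe K β i)
  /-- `((ψ_0 ψ_1)² - (ψ_1 ψ_0)²) e(i)
    = γ_{i_2} ((Q_{i_2 i_1}(y_1, -y_2) - Q_{i_2 i_1}(y_1, y_2)) / (y_1 y_2)) (y_1 ψ_0 - γ_{i_1}) e(i)`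
  in the remaining cases. Here `γ_{i_1} = 0`, so that `y_1` cancels and the right hand side is
  `γ_{i_2} ((Q_{i_2 i_1}(y_1, -y_2) - Q_{i_2 i_1}(y_1, y_2)) / y_2) ψ_0 e(i)`. -/
  | braid4_zero (h : 1 < n) (i : β) (hi : gam (i.1 ⟨0, by omega⟩) = 0)
      (hi' : θ (i.1 ⟨0, by omega⟩) ≠ i.1 ⟨1, h⟩)
      (p : MvPolynomial (Fin n) K)
      (hp : X ⟨1, h⟩ * p = C (gam (i.1 ⟨1, h⟩)) *
        (Qval Γ (i.1 ⟨1, h⟩) (i.1 ⟨0, by omega⟩) (X ⟨0, by omega⟩) (-X ⟨1, h⟩)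
          - Qval Γ (i.1 ⟨1, h⟩) (i.1 ⟨0, by omega⟩) (X ⟨0, by omega⟩) (X ⟨1, h⟩))) :
      Rel Γ θ lam gam β
        (((fpsi K β ⟨0, by omega⟩ * fpsi K β ⟨1, h⟩) ^ 2
          - (fpsi K β ⟨1, h⟩ * fpsi K β ⟨0, by omega⟩) ^ 2) * fe K β i)
        (fpoly K β p * fpsi K β ⟨0, by omega⟩ * fe K β i)
  /-- The same relation when `γ_{i_1} ≠ 0`; here
  `γ_{i_2} (Q_{i_2 i_1}(y_1, -y_2) - Q_{i_2 i_1}(y_1, y_2)) / (y_1 y_2)` is a polynomial. -/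
  | braid4_ne (h : 1 < n) (i : β) (hi : gam (i.1 ⟨0, by omega⟩) ≠ 0)
      (p : MvPolynomial (Fin n) K)
      (hp : X ⟨0, by omega⟩ * X ⟨1, h⟩ * p = C (gam (i.1 ⟨1, h⟩)) *
        (Qval Γ (i.1 ⟨1, h⟩) (i.1 ⟨0, by omega⟩) (X ⟨0, by omega⟩) (-X ⟨1, h⟩)
          - Qval Γ (i.1 ⟨1, h⟩) (i.1 ⟨0, by omega⟩) (X ⟨0, by omega⟩) (X ⟨1, h⟩))) :
      Rel Γ θ lam gam β
        (((fpsi K β ⟨0, by omega⟩ * fpsi K β ⟨1, h⟩) ^ 2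
          - (fpsi K β ⟨1, h⟩ * fpsi K β ⟨0, by omega⟩) ^ 2) * fe K β i)
        (fpoly K β p *
          (fy K β ⟨0, by omega⟩ * fpsi K β ⟨0, by omega⟩
            - algebraMap K _ (gam (i.1 ⟨0, by omega⟩))) * fe K β i)

/-! The fractions in the relations are polynomials. -/

theorem Qval_eq {I A K : Type*} [CommRing K] (Γ : LoopFreeQuiver I A) {i j : I} (hij : i ≠ j)
    {n : ℕ} (p q : MvPolynomial (Fin n) K) :
    Qval Γ i j p q = (-1) ^ Γ.arrows i j * (p - q) ^ Γ.dot i j := by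
  simp [Qval, Qpoly, hij]

theorem Qval_self {I A K : Type*} [CommRing K] (Γ : LoopFreeQuiver I A) (i : I)
    {n : ℕ} (p q : MvPolynomial (Fin n) K) : Qval Γ i i p q = 0 := by
  simp [Qval, Qpoly]

theorem dvd_braid3 {I A K : Type*} [CommRing K] (Γ : LoopFreeQuiver I A) (i j : I)
    {n : ℕ} (p q s : MvPolynomial (Fin n) K) : p - s ∣ Qval Γ i j p q - Qval Γ i j s q := by
  by_cases hij : i = j
  · subst hij; simp [Qval_self]
  · rw [Qval_eq Γ hij, Qval_eq Γ hij, ← mul_sub]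
    refine Dvd.dvd.mul_left ?_ _
    simpa using sub_dvd_pow_sub_pow (p - q) (s - q) (Γ.dot i j)

theorem dvd_braid4_theta {K : Type*} [CommRing K] {n : ℕ} (p q : MvPolynomial (Fin n) K)
    (d : ℕ) : p + q ∣ (-p) ^ d - q ^ d := by
  have h := sub_dvd_pow_sub_pow (-p) q d
  rwa [show -p - q = -(p + q) by ring, neg_dvd] at h

theorem dvd_braid4_zero {I A K : Type*} [CommRing K] (Γ : LoopFreeQuiver I A) (i j : I)
    {n : ℕ} (p q : MvPolynomial (Fin n) K) : q ∣ Qval Γ i j p (-q) - Qval Γ i j p q := by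
  by_cases hij : i = j
  · subst hij; simp [Qval_self]
  · rw [Qval_eq Γ hij, Qval_eq Γ hij, ← mul_sub]
    refine Dvd.dvd.mul_left (dvd_trans ?_ (sub_dvd_pow_sub_pow (p - -q) (p - q) _)) _
    exact ⟨2, by ring⟩

theorem arrows_theta {I A : Type*} {Γ : LoopFreeQuiver I A} (Θ : Γ.Involution) (i j : I) :
    Γ.arrows (Θ.vert j) (Θ.vert i) = Γ.arrows i j := by
  have ht : ∀ a, Θ.vert (Γ.t a) = Γ.o (Θ.arr a) := fun a => by
    rw [← Θ.vert_involutive (Γ.o (Θ.arr a)), Θ.vert_o, Θ.arr_involutive]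
  unfold LoopFreeQuiver.arrows
  rw [← Set.ncard_image_of_injective _ Θ.arr_involutive.injective]
  congr 1
  ext a
  simp only [Set.mem_image, Set.mem_ofPred_eq]
  constructor
  · rintro ⟨b, ⟨h1, h2⟩, rfl⟩
    rw [← Θ.vert_o, ← ht, h1, h2]
    exact ⟨Θ.vert_involutive i, Θ.vert_involutive j⟩
  · rintro ⟨h1, h2⟩
    exact ⟨Θ.arr a, ⟨by rw [← ht, h2], by rw [← Θ.vert_o, h1]⟩, Θ.arr_involutive a⟩

theorem dvd_braid4_ne {I A K : Type*} [CommRing K] {Γ : LoopFreeQuiver I A} (Θ : Γ.Involution)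
    (gam : I → K) (hgam : ∀ i, Θ.vert i ≠ i → gam i = 0) (i j : I) (hj : gam j ≠ 0)
    {n : ℕ} (p q : MvPolynomial (Fin n) K) :
    p * q ∣ MvPolynomial.C (gam i) * (Qval Γ i j p (-q) - Qval Γ i j p q) := by
  by_cases hi : gam i = 0
  · simp [hi]
  by_cases hij : i = j
  · subst hij; simp [Qval_self]
  have h1 : Θ.vert i = i := by_contra fun h => hi (hgam i h)
  have h2 : Θ.vert j = j := by_contra fun h => hj (hgam j h)
  have h3 : Γ.dot i j = 2 * Γ.arrows i j := by
    have := arrows_theta Θ i j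
    rw [h1, h2] at this
    rw [LoopFreeQuiver.dot, this]; ring
  rw [Qval_eq Γ hij, Qval_eq Γ hij, ← mul_sub, h3, pow_mul, pow_mul]
  refine Dvd.dvd.mul_left (Dvd.dvd.mul_left (dvd_trans ?_ (sub_dvd_pow_sub_pow _ _ _)) _) _
  exact ⟨4, by ring⟩

/-- The interpolating quiver Hecke algebra `V_β(Γ, λ, γ)`: the unitary associative `K`-algebra
with the generators `Gen β` and the relations `Rel`. -/
abbrev V {I A K : Type*} [CommRing K] (Γ : LoopFreeQuiver I A) (Θ : Γ.Involution)
    (lam : I → ℕ) (gam : I → K) {n : ℕ} (β : Finset (Fin n → I)) :=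
  RingQuot (Rel Γ Θ.vert lam gam β)

section Elements

variable {I A K : Type*} [CommRing K] (Γ : LoopFreeQuiver I A) (Θ : Γ.Involution)
    (lam : I → ℕ) (gam : I → K) {n : ℕ} (β : Finset (Fin n → I))

/-- The generator `y_{a+1}` of `V_β(Γ, λ, γ)`. -/
def V.y (a : Fin n) : V Γ Θ lam gam β :=
  RingQuot.mkAlgHom K (Rel Γ Θ.vert lam gam β) (fy K β a)

/-- The generator `ψ_b` of `V_β(Γ, λ, γ)`. -/
def V.psi (b : Fin n) : V Γ Θ lam gam β :=
  RingQuot.mkAlgHom K (Rel Γ Θ.vert lam gam β) (fpsi K β b)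

/-- The generator `e(i)` of `V_β(Γ, λ, γ)`. -/
def V.e (i : β) : V Γ Θ lam gam β :=
  RingQuot.mkAlgHom K (Rel Γ Θ.vert lam gam β) (fe K β i)

/-- The product `y_1^{a_1} ⋯ y_n^{a_n}`. -/
def V.yMonomial (a : Fin n → ℕ) : V Γ Θ lam gam β :=
  (List.ofFn fun k => V.y Γ Θ lam gam β k ^ a k).prod

/-- The product `ψ_{a_1} ⋯ ψ_{a_k}` for a word `a_1, …, a_k`. -/
def V.psiWord (l : List (Fin n)) : V Γ Θ lam gam β :=
  (l.map (V.psi Γ Θ lam gam β)).prod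

end Elements

end

end InterpolatingKLR

/-! Spanning. Filter by the number of factors ψ. A factor ψ_b moves past a polynomial in the y_a at
the cost of a term with one ψ fewer, ψ_b² e(i) is a polynomial times e(i), and the braid relations
hold up to products with fewer ψ. Hence, modulo shorter products, ψ_l e(i) depends only on the
element represented by the reduced word l (Matsumoto's theorem, `Reduced.rel`), and it vanishes if l
is not reduced (`induction_not_reduced`). Induction on length gives `Model.span_eq_top`, for every
algebra generated by elements satisfying the relations.

Independence over a domain R with 2 ≠ 0. The algebra acts on families, indexed by β, of rational
functions in x_1, …, x_n: y_a multiplies by x_a, and ψ_b is f ↦ α(σ_b f − δ f), where σ_b is the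
reflection, acting on variables and labels together, and δ is 1 where ψ_b is a divided difference
and 0 elsewhere. The relations become identities between rational functions (`isModel_polyRep`); the
braid relations are `braid3_identity` and `braid4_identity`. For a reduced word of w, the operator
ψ_w is a combination of the σ_v with nonzero coefficient at v = w, and all other v that occur are
shorter than w. Dedekind's independence of automorphisms and the choice of a longest w give
independence (`polyRep_sum_eq_zero`).

Arbitrary K. There may be zero divisors, or 2 may vanish, so K is replaced by R = ℤ[X_i : i ∈ I],
with parameter X_i where γ_i ≠ 0 and 0 where γ_i = 0. The image B of the free algebra in the
endomorphisms is free over R on the family, since the spanning argument applies to B too. Then K ⊗ B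
satisfies the relations over K and is free on the image of the family. As V maps to K ⊗ B, the
family is independent in V. -/

namespace InterpolatingKLR

/-! ### Descents and reduced words in the group of signed permutations -/

section SignedPermutations

variable {n : ℕ}

/-- The integer represented by a point of `{±1, …, ±n}`. -/
def ptVal (x : Fin n × ℤˣ) : ℤ := x.2 * (x.1.1 + 1)

/-- The smaller of the two adjacent points exchanged by `r b`. -/
def lo : Fin n → Fin n × ℤˣ
  | ⟨0, h⟩ => (⟨0, h⟩, -1)
  | ⟨a + 1, h⟩ => (⟨a, Nat.lt_of_succ_lt h⟩, 1)

/-- The larger of the two adjacent points exchanged by `r b`. -/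
def hi (b : Fin n) : Fin n × ℤˣ := (b, 1)

theorem ptVal_injective : Function.Injective (ptVal (n := n)) := by
  rintro ⟨a, s⟩ ⟨b, t⟩ h
  have : a.1 = b.1 ∧ s = t := by
    rcases Int.units_eq_one_or s with rfl | rfl <;> rcases Int.units_eq_one_or t with rfl | rfl <;>
      simp [ptVal] at h ⊢ <;> omega
  exact Prod.ext (Fin.ext this.1) this.2

theorem ptVal_ne_zero (x : Fin n × ℤˣ) : ptVal x ≠ 0 := by
  obtain ⟨a, s⟩ := x
  rcases Int.units_eq_one_or s with rfl | rfl <;>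
    simp only [ptVal, Units.val_one, Units.val_neg] <;> omega

@[simp] theorem ptVal_negPt (x : Fin n × ℤˣ) : ptVal (negPt x) = - ptVal x := by
  simp [ptVal, negPt]

@[simp] theorem negPt_negPt (x : Fin n × ℤˣ) : negPt (negPt x) = x := by
  simp [negPt]

theorem apply_negPt (w : SignedPerm n) (x : Fin n × ℤˣ) : w.1 (negPt x) = negPt (w.1 x) := w.2 x

theorem r_zero_apply (h : 0 < n) (x : Fin n × ℤˣ) :
    (r ⟨0, h⟩).1 x = if x.1 = ⟨0, h⟩ then negPt x else x := by
  obtain ⟨c, s⟩ := x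
  rcases Int.units_eq_one_or s with rfl | rfl <;>
    simp [r, Equiv.swap_apply_def, negPt] <;> split_ifs <;> simp_all

theorem r_succ_apply (a : ℕ) (h : a + 1 < n) (x : Fin n × ℤˣ) :
    (r ⟨a + 1, h⟩).1 x = (Equiv.swap ⟨a, by omega⟩ ⟨a + 1, h⟩ x.1, x.2) := by
  obtain ⟨c, s⟩ := x
  rcases Int.units_eq_one_or s with rfl | rfl <;>
    simp [r, Equiv.swap_apply_def] <;> split_ifs <;> simp_all

theorem r_apply_r_apply (b : Fin n) (x : Fin n × ℤˣ) : (r b).1 ((r b).1 x) = x := by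
  obtain ⟨_ | a, h⟩ := b
  · by_cases hx : x.1 = ⟨0, h⟩
    · have hx' : (negPt x).1 = ⟨0, h⟩ := hx
      simp [r_zero_apply, hx, hx']
    · simp [r_zero_apply, hx]
  · simp [r_succ_apply]

theorem r_mul_self (b : Fin n) : r b * r b = 1 :=
  Subtype.ext (Equiv.ext (r_apply_r_apply b))

theorem r_inv (b : Fin n) : (r b)⁻¹ = r b := inv_eq_of_mul_eq_one_left (r_mul_self b)

theorem r_mul_cancel_left (b : Fin n) (w : SignedPerm n) : r b * (r b * w) = w := by
  rw [← mul_assoc, r_mul_self, one_mul]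

theorem r_lo (b : Fin n) : (r b).1 (lo b) = hi b := by
  obtain ⟨_ | a, h⟩ := b
  · simp [r_zero_apply, lo, hi, negPt]
  · simp [r_succ_apply, lo, hi]

theorem r_hi (b : Fin n) : (r b).1 (hi b) = lo b := by
  rw [← r_lo, r_apply_r_apply]

/-- On integers the generators are given by a case distinction with affine branches, so questions
about the order of points become problems for `omega`. -/
theorem ptVal_r_zero (h : 0 < n) (x : Fin n × ℤˣ) :
    ptVal ((r ⟨0, h⟩).1 x) =
      if ptVal x = 1 then -1 else if ptVal x = -1 then 1 else ptVal x := by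
  obtain ⟨⟨c, hc⟩, s⟩ := x
  by_cases h0 : c = 0
  · subst h0
    rcases Int.units_eq_one_or s with rfl | rfl <;> simp [r_zero_apply, ptVal, negPt]
  · rcases Int.units_eq_one_or s with rfl | rfl <;>
      simp only [r_zero_apply, ptVal, Fin.mk.injEq, h0, if_false, Units.val_one, Units.val_neg] <;>
      split_ifs <;> omega

theorem ptVal_r_succ (a : ℕ) (h : a + 1 < n) (x : Fin n × ℤˣ) :
    ptVal ((r ⟨a + 1, h⟩).1 x) =
      if ptVal x = a + 1 then (a : ℤ) + 2 else if ptVal x = a + 2 then (a : ℤ) + 1 else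
      if ptVal x = -(a + 1) then -((a : ℤ) + 2) else if ptVal x = -(a + 2) then -((a : ℤ) + 1) else
      ptVal x := by
  obtain ⟨⟨c, hc⟩, s⟩ := x
  by_cases h0 : c = a
  · subst h0
    rcases Int.units_eq_one_or s with rfl | rfl <;> simp [r_succ_apply, ptVal] <;> grind
  by_cases h1 : c = a + 1
  · subst h1
    rcases Int.units_eq_one_or s with rfl | rfl <;> simp [r_succ_apply, ptVal] <;> grind
  rw [r_succ_apply, Equiv.swap_apply_of_ne_of_ne (by simpa using h0) (by simpa using h1)]
  rcases Int.units_eq_one_or s with rfl | rfl <;>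
    simp only [ptVal, Units.val_one, Units.val_neg] <;> split_ifs <;> omega

theorem ptVal_hi (b : Fin n) : ptVal (hi b) = b + 1 := by simp [ptVal, hi]

theorem ptVal_lo_zero (h : 0 < n) : ptVal (lo ⟨0, h⟩) = -1 := by simp [ptVal, lo]

theorem ptVal_lo_succ (a : ℕ) (h : a + 1 < n) : ptVal (lo ⟨a + 1, h⟩) = a + 1 := by
  simp [ptVal, lo]

theorem ptVal_lo_lt_hi (b : Fin n) : ptVal (lo b) < ptVal (hi b) := by
  obtain ⟨_ | a, h⟩ := b
  · simp [ptVal_lo_zero, ptVal_hi]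
  · simp [ptVal_lo_succ, ptVal_hi]

/-- A generator reverses the order of two points only if it exchanges them. -/
theorem eq_of_r_reverses (b : Fin n) {p q : Fin n × ℤˣ} (hpq : ptVal p < ptVal q)
    (h : ptVal ((r b).1 q) < ptVal ((r b).1 p)) :
    (p = lo b ∧ q = hi b) ∨ (p = negPt (hi b) ∧ q = negPt (lo b)) := by
  simp only [← ptVal_injective.eq_iff (a := p), ← ptVal_injective.eq_iff (a := q), ptVal_negPt]
  obtain ⟨_ | a, hb⟩ := b
  · rw [ptVal_r_zero, ptVal_r_zero] at h
    rw [ptVal_lo_zero, ptVal_hi]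
    simp only
    have hp := ptVal_ne_zero p
    have hq := ptVal_ne_zero q
    split_ifs at h <;> push_cast <;> omega
  · rw [ptVal_r_succ, ptVal_r_succ] at h
    rw [ptVal_lo_succ, ptVal_hi]
    simp only
    push_cast
    split_ifs at h <;> omega

theorem r_apply_of_ne (b : Fin n) {x : Fin n × ℤˣ} (h1 : x ≠ lo b) (h2 : x ≠ hi b)
    (h3 : x ≠ negPt (lo b)) (h4 : x ≠ negPt (hi b)) : (r b).1 x = x := by
  simp only [ne_eq, ← ptVal_injective.eq_iff, ptVal_negPt] at *
  obtain ⟨_ | a, hb⟩ := b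
  · rw [ptVal_r_zero]
    rw [ptVal_lo_zero, ptVal_hi] at *
    simp only at *
    split_ifs <;> push_cast at * <;> omega
  · rw [ptVal_r_succ]
    rw [ptVal_lo_succ, ptVal_hi] at *
    simp only at *
    split_ifs <;> push_cast at * <;> omega

/-- An element carrying the pair exchanged by `r c` to the pair exchanged by `r b` conjugates
`r c` to `r b`. -/
theorem mul_r_eq_r_mul (w : SignedPerm n) (b c : Fin n)
    (h : (w.1 (lo c) = lo b ∧ w.1 (hi c) = hi b) ∨
      (w.1 (negPt (hi c)) = lo b ∧ w.1 (negPt (lo c)) = hi b)) : w * r c = r b * w := by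
  have inj : ∀ {x y}, w.1 x = w.1 y → x = y := fun h => w.1.injective h
  apply Subtype.ext
  ext1 x
  change w.1 ((r c).1 x) = (r b).1 (w.1 x)
  have key : (w.1 (lo c) = lo b ∧ w.1 (hi c) = hi b) ∨
      (w.1 (hi c) = negPt (lo b) ∧ w.1 (lo c) = negPt (hi b)) := by
    rcases h with h | ⟨h1, h2⟩
    · exact Or.inl h
    · rw [apply_negPt] at h1 h2
      exact Or.inr ⟨by rw [← h1, negPt_negPt], by rw [← h2, negPt_negPt]⟩
  by_cases h1 : x = lo c
  · subst h1; rcases key with ⟨k1, k2⟩ | ⟨k1, k2⟩ <;>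
      simp [r_lo, r_hi, k1, k2, apply_negPt]
  by_cases h2 : x = hi c
  · subst h2; rcases key with ⟨k1, k2⟩ | ⟨k1, k2⟩ <;>
      simp [r_lo, r_hi, k1, k2, apply_negPt]
  by_cases h3 : x = negPt (lo c)
  · subst h3; rcases key with ⟨k1, k2⟩ | ⟨k1, k2⟩ <;>
      simp [r_lo, r_hi, k1, k2, apply_negPt]
  by_cases h4 : x = negPt (hi c)
  · subst h4; rcases key with ⟨k1, k2⟩ | ⟨k1, k2⟩ <;>
      simp [r_lo, r_hi, k1, k2, apply_negPt]
  rw [r_apply_of_ne c h1 h2 h3 h4, r_apply_of_ne]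
  all_goals intro hx; rcases key with ⟨k1, k2⟩ | ⟨k1, k2⟩
  all_goals
    first
    | (apply h1; apply inj; simp [hx, k1, k2]; done)
    | (apply h2; apply inj; simp [hx, k1, k2]; done)
    | (apply h3; apply inj; simp [hx, k1, k2, apply_negPt]; done)
    | (apply h4; apply inj; simp [hx, k1, k2, apply_negPt])

/-- The element of `B_n` represented by a word. -/
def wordProd (l : List (Fin n)) : SignedPerm n := (l.map r).prod

@[simp] theorem wordProd_nil : wordProd ([] : List (Fin n)) = 1 := rfl

@[simp] theorem wordProd_cons (b : Fin n) (l : List (Fin n)) :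
    wordProd (b :: l) = r b * wordProd l := by simp [wordProd]

@[simp] theorem wordProd_append (l m : List (Fin n)) :
    wordProd (l ++ m) = wordProd l * wordProd m := by simp [wordProd]

/-- The letters of l are applied to p and q one after the other. Since the order is reversed at the
end, some letter c reverses it, and by `eq_of_r_reverses` the pair reached at that moment is the one
exchanged by c, up to a common sign. -/
theorem exists_reversing_letter (l : List (Fin n)) (p q : Fin n × ℤˣ) (hpq : ptVal p < ptVal q)
    (h : ptVal ((wordProd l)⁻¹.1 q) < ptVal ((wordProd l)⁻¹.1 p)) :
    ∃ l₁ c l₂, l = l₁ ++ c :: l₂ ∧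
      ((p = (wordProd l₁).1 (lo c) ∧ q = (wordProd l₁).1 (hi c)) ∨
        (p = (wordProd l₁).1 (negPt (hi c)) ∧ q = (wordProd l₁).1 (negPt (lo c)))) := by
  induction l generalizing p q with
  | nil => simp at h; omega
  | cons c l ih =>
    by_cases hc : ptVal ((r c).1 q) < ptVal ((r c).1 p)
    · exact ⟨[], c, l, rfl, by simpa using eq_of_r_reverses c hpq hc⟩
    · have hlt : ptVal ((r c).1 p) < ptVal ((r c).1 q) := by
        refine lt_of_le_of_ne (not_lt.1 hc) fun h' => ?_
        have := (r c).1.injective (ptVal_injective h')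
        subst this
        omega
      have hinv : ∀ x, (wordProd (c :: l))⁻¹.1 x = (wordProd l)⁻¹.1 ((r c).1 x) := by
        intro x
        rw [wordProd_cons, mul_inv_rev, r_inv]
        rfl
      rw [hinv, hinv] at h
      obtain ⟨l₁, d, l₂, rfl, hd⟩ := ih _ _ hlt h
      refine ⟨c :: l₁, d, l₂, rfl, ?_⟩
      have hmul : ∀ x, (wordProd (c :: l₁)).1 x = (r c).1 ((wordProd l₁).1 x) := fun x => by
        rw [wordProd_cons]; rfl
      simp only [hmul]
      rcases hd with ⟨h1, h2⟩ | ⟨h1, h2⟩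
      · exact Or.inl ⟨by rw [← h1, r_apply_r_apply], by rw [← h2, r_apply_r_apply]⟩
      · exact Or.inr ⟨by rw [← h1, r_apply_r_apply], by rw [← h2, r_apply_r_apply]⟩

/-- `b` is a left descent of `w`. -/
def Descent (b : Fin n) (w : SignedPerm n) : Prop :=
  ptVal (w⁻¹.1 (hi b)) < ptVal (w⁻¹.1 (lo b))

theorem r_mul_inv_apply (b : Fin n) (w : SignedPerm n) (x : Fin n × ℤˣ) :
    (r b * w)⁻¹.1 x = w⁻¹.1 ((r b).1 x) := by
  rw [mul_inv_rev, r_inv]; rfl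

/-- Multiplication by `r b` swaps the two values compared in `Descent`, and these are distinct
because w⁻¹ is injective. -/
theorem descent_r_mul (b : Fin n) (w : SignedPerm n) : Descent b (r b * w) ↔ ¬ Descent b w := by
  simp only [Descent, r_mul_inv_apply, r_lo, r_hi, not_lt]
  refine ⟨le_of_lt, fun h => lt_of_le_of_ne h fun h' => ?_⟩
  have := w⁻¹.1.injective (ptVal_injective h')
  have h2 := ptVal_lo_lt_hi b
  rw [this] at h2
  omega

/-- The exchange property. -/
theorem Descent.exists_word {b : Fin n} {l : List (Fin n)} (h : Descent b (wordProd l)) :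
    ∃ l', wordProd l' = r b * wordProd l ∧ l'.length + 1 = l.length := by
  obtain ⟨l₁, c, l₂, rfl, hc⟩ := exists_reversing_letter l _ _ (ptVal_lo_lt_hi b) h
  refine ⟨l₁ ++ l₂, ?_, by simp; omega⟩
  -- The prefix l₁ carries the pair of c to the pair of b, so multiplying by `r b` on the left
  -- amounts to deleting the letter c.
  have hconj : wordProd l₁ * r c = r b * wordProd l₁ := by
    apply mul_r_eq_r_mul
    rcases hc with ⟨h1, h2⟩ | ⟨h1, h2⟩
    · exact Or.inl ⟨h1.symm, h2.symm⟩
    · exact Or.inr ⟨h1.symm, h2.symm⟩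
  rw [wordProd_append, wordProd_append, wordProd_cons, ← mul_assoc (r b), ← hconj, mul_assoc,
    r_mul_cancel_left]

/-- A word of minimal length among those representing the same element. -/
def Reduced (l : List (Fin n)) : Prop :=
  ∀ l' : List (Fin n), wordProd l' = wordProd l → l.length ≤ l'.length

theorem Reduced.tail {b : Fin n} {l : List (Fin n)} (h : Reduced (b :: l)) : Reduced l := by
  intro l' hl'
  have := h (b :: l') (by simp [hl'])
  simpa using this

theorem Reduced.descent {b : Fin n} {l : List (Fin n)} (h : Reduced (b :: l)) :
    Descent b (wordProd (b :: l)) := by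
  rw [wordProd_cons, descent_r_mul]
  intro hd
  obtain ⟨l', hl', hlen⟩ := hd.exists_word
  have := h l' (by rw [hl', wordProd_cons])
  simp at this
  omega

/-- Otherwise b is a descent of the product of b :: l, which has a word m no longer than l. Exchange
in m then yields a word for the product of l that is shorter than l. -/
theorem Reduced.descent_of_not_reduced {b : Fin n} {l : List (Fin n)} (hl : Reduced l)
    (h : ¬ Reduced (b :: l)) : Descent b (wordProd l) := by
  by_contra hd
  rw [← descent_r_mul] at hd
  simp only [Reduced, not_forall, not_le] at h
  obtain ⟨m, hm, hlen⟩ := h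
  rw [← wordProd_cons, ← hm] at hd
  obtain ⟨m', hm', hlen'⟩ := hd.exists_word
  have := hl m' (by rw [hm', hm, wordProd_cons, r_mul_cancel_left])
  simp at hlen
  omega

theorem Reduced.of_length_le {l l' : List (Fin n)} (h : Reduced l)
    (hw : wordProd l' = wordProd l) (hlen : l'.length ≤ l.length) : Reduced l' :=
  fun m hm => hlen.trans (h m (hm.trans hw))

theorem Descent.r_mul_of_lt {b c : Fin n} (hbc : b.1 + 1 < c.1) {w : SignedPerm n} :
    Descent c (r b * w) ↔ Descent c w := by
  have h : (r b).1 (hi c) = hi c ∧ (r b).1 (lo c) = lo c := by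
    simp only [← ptVal_injective.eq_iff]
    obtain ⟨_ | b, hb⟩ := b <;> obtain ⟨_ | c, hc⟩ := c <;> simp only at hbc
    · omega
    · rw [ptVal_r_zero, ptVal_r_zero, ptVal_hi, ptVal_lo_succ]
      simp only
      constructor <;> push_cast <;> split_ifs <;> omega
    · omega
    · rw [ptVal_r_succ, ptVal_r_succ, ptVal_hi, ptVal_lo_succ]
      simp only
      constructor <;> push_cast <;> split_ifs <;> omega
  simp only [Descent, r_mul_inv_apply, h]

theorem r_comm {b c : Fin n} (hbc : b.1 + 1 < c.1) : r b * r c = r c * r b := by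
  have h : (r b).1 (hi c) = hi c ∧ (r b).1 (lo c) = lo c := by
    simp only [← ptVal_injective.eq_iff]
    obtain ⟨_ | b, hb⟩ := b <;> obtain ⟨_ | c, hc⟩ := c <;> simp only at hbc
    · omega
    · rw [ptVal_r_zero, ptVal_r_zero, ptVal_hi, ptVal_lo_succ]
      simp only
      constructor <;> push_cast <;> split_ifs <;> omega
    · omega
    · rw [ptVal_r_succ, ptVal_r_succ, ptVal_hi, ptVal_lo_succ]
      simp only
      constructor <;> push_cast <;> split_ifs <;> omega
  exact mul_r_eq_r_mul _ _ _ (Or.inl h.symm)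

/-- The braid relation is a conjugation: r_{b+1} r_{b+2} carries the pair exchanged by r_{b+1} to
the pair exchanged by r_{b+2}. -/
theorem r_braid3 (b : ℕ) (h : b + 2 < n) :
    r ⟨b + 1, by omega⟩ * r ⟨b + 2, h⟩ * r ⟨b + 1, by omega⟩ =
      r ⟨b + 2, h⟩ * (r ⟨b + 1, by omega⟩ * r ⟨b + 2, h⟩) := by
  apply mul_r_eq_r_mul
  left
  simp [r_succ_apply, lo, hi, Equiv.swap_apply_def]
  omega

/-- The element r_0 r_1 r_0 sends 1 to −2 and 2 to −1. It preserves the pair of r_1 up to sign and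
hence commutes with r_1. -/
theorem r_braid4 (h : 1 < n) :
    r ⟨0, by omega⟩ * r ⟨1, h⟩ * r ⟨0, by omega⟩ * r ⟨1, h⟩ =
      r ⟨1, h⟩ * (r ⟨0, by omega⟩ * r ⟨1, h⟩ * r ⟨0, by omega⟩) := by
  apply mul_r_eq_r_mul
  right
  simp [r_succ_apply, r_zero_apply, lo, hi, negPt]

/-- With x and y the values of w⁻¹ at 1 and 2, the two hypotheses say y < x < 0. All the conclusions
are linear consequences; they allow a word of w to begin with either expression of the longest
element of the dihedral group of order 8. -/
theorem descent_r_r_mul_zero_one (h : 1 < n) {w : SignedPerm n} (h0 : Descent ⟨0, by omega⟩ w)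
    (h1 : Descent ⟨1, h⟩ w) :
    Descent ⟨1, h⟩ (r ⟨0, by omega⟩ * w) ∧
    Descent ⟨0, by omega⟩ (r ⟨1, h⟩ * w) ∧
    Descent ⟨0, by omega⟩ (r ⟨1, h⟩ * (r ⟨0, by omega⟩ * w)) ∧
    Descent ⟨1, h⟩ (r ⟨0, by omega⟩ * (r ⟨1, h⟩ * w)) ∧
    Descent ⟨1, h⟩ (r ⟨0, by omega⟩ * (r ⟨1, h⟩ * (r ⟨0, by omega⟩ * w))) ∧
    Descent ⟨0, by omega⟩ (r ⟨1, h⟩ * (r ⟨0, by omega⟩ * (r ⟨1, h⟩ * w))) := by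
  have e : ∀ a : Fin n, ptVal (w⁻¹.1 (a, -1)) = - ptVal (w⁻¹.1 (a, 1)) := fun a => by
    rw [← ptVal_negPt, ← apply_negPt]; rfl
  simp only [Descent, r_mul_inv_apply, hi, lo, r_zero_apply, r_succ_apply, negPt, if_true, zero_add,
    Equiv.swap_apply_left, Equiv.swap_apply_right, e, Fin.mk.injEq, one_ne_zero, if_false,
    neg_neg] at *
  omega

/-- The hypotheses say that three consecutive values of w⁻¹ decrease. -/
theorem descent_r_r_mul_succ (b : ℕ) (h : b + 2 < n) {w : SignedPerm n}
    (h0 : Descent ⟨b + 1, by omega⟩ w) (h1 : Descent ⟨b + 2, h⟩ w) :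
    Descent ⟨b + 2, h⟩ (r ⟨b + 1, by omega⟩ * w) ∧
    Descent ⟨b + 1, by omega⟩ (r ⟨b + 2, h⟩ * w) ∧
    Descent ⟨b + 1, by omega⟩ (r ⟨b + 2, h⟩ * (r ⟨b + 1, by omega⟩ * w)) ∧
    Descent ⟨b + 2, h⟩ (r ⟨b + 1, by omega⟩ * (r ⟨b + 2, h⟩ * w)) := by
  have e1 : Equiv.swap (⟨b, by omega⟩ : Fin n) ⟨b + 1, by omega⟩ ⟨b + 2, h⟩ = ⟨b + 2, h⟩ :=
    Equiv.swap_apply_of_ne_of_ne (by simp) (by simp)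
  have e2 : Equiv.swap (⟨b + 1, by omega⟩ : Fin n) ⟨b + 2, h⟩ ⟨b, by omega⟩ = ⟨b, by omega⟩ :=
    Equiv.swap_apply_of_ne_of_ne (by simp) (by simp)
  simp only [Descent, r_mul_inv_apply, hi, lo, r_succ_apply, Nat.add_assoc, Nat.reduceAdd] at *
  simp only [Equiv.swap_apply_left, Equiv.swap_apply_right, e1, e2] at *
  omega

/-- Matsumoto's theorem: a preorder on words which is compatible with adding a letter on
the left and under which braid moves at the beginning of a word hold relates any two reduced words
of the same element. -/
theorem Reduced.rel (R : List (Fin n) → List (Fin n) → Prop)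
    (hrefl : ∀ l, R l l) (htrans : ∀ l₁ l₂ l₃, R l₁ l₂ → R l₂ l₃ → R l₁ l₃)
    (hsymm : ∀ l₁ l₂, R l₁ l₂ → R l₂ l₁)
    (hcons : ∀ b l l', R l l' → R (b :: l) (b :: l'))
    (hcomm : ∀ (b c : Fin n) (l : List (Fin n)), b.1 + 1 < c.1 → R (b :: c :: l) (c :: b :: l))
    (hbraid3 : ∀ (b : ℕ) (h : b + 2 < n) (l : List (Fin n)),
      R (⟨b + 1, by omega⟩ :: ⟨b + 2, h⟩ :: ⟨b + 1, by omega⟩ :: l)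
        (⟨b + 2, h⟩ :: ⟨b + 1, by omega⟩ :: ⟨b + 2, h⟩ :: l))
    (hbraid4 : ∀ (h : 1 < n) (l : List (Fin n)),
      R (⟨0, by omega⟩ :: ⟨1, h⟩ :: ⟨0, by omega⟩ :: ⟨1, h⟩ :: l)
        (⟨1, h⟩ :: ⟨0, by omega⟩ :: ⟨1, h⟩ :: ⟨0, by omega⟩ :: l))
    {l l' : List (Fin n)} (hl : Reduced l) (hl' : Reduced l') (h : wordProd l = wordProd l') :
    R l l' := by
  obtain ⟨k, hk⟩ : ∃ k, l.length = k := ⟨_, rfl⟩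
  induction k using Nat.strong_induction_on generalizing l l' with
  | _ k ih =>
  have hlen : l.length = l'.length := le_antisymm (hl _ h.symm) (hl' _ h)
  rcases l with _ | ⟨b, m⟩ <;> rcases l' with _ | ⟨c, m'⟩
  · exact hrefl _
  · simp at hlen
  · simp at hlen
  simp only [List.length_cons] at hk hlen
  by_cases hbc : b = c
  · subst hbc
    exact hcons _ _ _ (ih m.length (by omega) hl.tail hl'.tail (by simpa using h) rfl)
  wlog hlt : b.1 < c.1 generalizing b c m m'
  · exact hsymm _ _ (this c m' hl' (by omega) b m hl h.symm (by omega) (Ne.symm hbc) (by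
      have : b.1 ≠ c.1 := fun h => hbc (Fin.ext h)
      omega))
  have hdb := hl.descent
  have hdc := hl'.descent
  rw [← h] at hdc
  set w := wordProd (b :: m) with hw
  have hm : wordProd m = r b * w := by rw [hw, wordProd_cons, r_mul_cancel_left]
  have hm' : wordProd m' = r c * w := by rw [h, wordProd_cons, r_mul_cancel_left]
  -- The tails m and m' are shorter than l, so the induction hypothesis compares them with any words
  -- of the same elements and lengths. It remains to choose m₂ and m₃ so that b :: c :: m₂ and c ::
  -- b :: m₃ differ by one braid move.
  have step : ∀ m₂ m₃ : List (Fin n), wordProd (c :: m₂) = wordProd m →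
      wordProd (b :: m₃) = wordProd m' → m₂.length + 1 = m.length → m₃.length + 1 = m'.length →
      R m (c :: m₂) ∧ R m' (b :: m₃) := fun m₂ m₃ h1 h2 h3 h4 =>
    ⟨ih m.length (by omega) hl.tail (hl.tail.of_length_le h1 (by simp; omega)) h1.symm rfl,
      ih m'.length (by omega) hl'.tail (hl'.tail.of_length_le h2 (by simp; omega)) h2.symm rfl⟩
  by_cases hfar : b.1 + 1 < c.1
  · have hd : Descent c (wordProd m) := by rw [hm]; exact (Descent.r_mul_of_lt hfar).2 hdc
    obtain ⟨m₂, hm₂, hlen₂⟩ := hd.exists_word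
    obtain ⟨h1, h2⟩ := step m₂ m₂ (by rw [wordProd_cons, hm₂, r_mul_cancel_left])
      (by rw [wordProd_cons, hm₂, hm, hm', ← mul_assoc, r_comm hfar, mul_assoc,
        r_mul_cancel_left]) hlen₂ (by omega)
    exact htrans _ _ _ (hcons b _ _ h1)
      (htrans _ _ _ (hcomm b c m₂ hfar) (hcons c _ _ (hsymm _ _ h2)))
  have hc : c.1 = b.1 + 1 := by omega
  obtain ⟨c, hcn⟩ := c
  simp only at hc
  obtain ⟨_ | b, hb⟩ := b
  · obtain rfl : c = 1 := hc
    obtain ⟨d1, -, d2, -, d3, -⟩ := descent_r_r_mul_zero_one _ hdb hdc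
    rw [← hm] at d1 d2 d3
    obtain ⟨m₂, hm₂, hlen₂⟩ := d1.exists_word
    rw [← hm₂] at d2 d3
    obtain ⟨m₃, hm₃, hlen₃⟩ := d2.exists_word
    rw [← hm₃] at d3
    obtain ⟨m₄, hm₄, hlen₄⟩ := d3.exists_word
    -- Successive exchanges produce m₄ such that 0101m₄ and 1010m₄ both represent w.
    obtain ⟨h1, h2⟩ := step (⟨0, hb⟩ :: ⟨1, hcn⟩ :: m₄) (⟨1, hcn⟩ :: ⟨0, hb⟩ :: m₄)
      (by simp only [wordProd_cons, hm₄, hm₃, hm₂, r_mul_cancel_left])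
      (by
        simp only [wordProd_cons, hm₄, hm₃, hm₂, hm, hm']
        have := congrArg (· * (r ⟨1, hcn⟩ * (r ⟨0, hb⟩ * w))) (r_braid4 hcn)
        simp only [mul_assoc, r_mul_cancel_left] at this
        rw [← this]
        simp only [r_mul_cancel_left]) (by simp; omega) (by simp; omega)
    exact htrans _ _ _ (hcons _ _ _ h1)
      (htrans _ _ _ (hbraid4 _ m₄) (hcons _ _ _ (hsymm _ _ h2)))
  · obtain rfl : c = b + 2 := hc
    obtain ⟨d1, -, d2, -⟩ := descent_r_r_mul_succ _ _ hdb hdc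
    rw [← hm] at d1 d2
    obtain ⟨m₂, hm₂, hlen₂⟩ := d1.exists_word
    rw [← hm₂] at d2
    obtain ⟨m₃, hm₃, hlen₃⟩ := d2.exists_word
    obtain ⟨h1, h2⟩ := step (⟨b + 1, hb⟩ :: m₃) (⟨b + 2, hcn⟩ :: m₃)
      (by simp only [wordProd_cons, hm₃, hm₂, r_mul_cancel_left])
      (by
        simp only [wordProd_cons, hm₃, hm₂, hm, hm']
        have := congrArg (· * (r ⟨b + 1, hb⟩ * w)) (r_braid3 b hcn)
        simp only [mul_assoc, r_mul_cancel_left] at this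
        rw [← this]
        simp only [r_mul_cancel_left]) (by simp; omega) (by simp; omega)
    exact htrans _ _ _ (hcons _ _ _ h1)
      (htrans _ _ _ (hbraid3 _ _ m₃) (hcons _ _ _ (hsymm _ _ h2)))

/-- A non-reduced word can be transformed by a relation as in `Reduced.rel` so that, after deleting
some letters on the left, it begins with a repeated letter. -/
theorem induction_not_reduced (P : List (Fin n) → Prop)
    (hcons : ∀ b l, P l → P (b :: l))
    (hrel : ∀ b l l', Reduced l → Reduced l' → wordProd l = wordProd l' → P (b :: l') → P (b :: l))
    (hsq : ∀ b l, P (b :: b :: l)) {l : List (Fin n)} (hl : ¬ Reduced l) : P l := by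
  induction l with
  | nil => exact absurd (fun _ _ => Nat.zero_le _) hl
  | cons b m ih =>
    by_cases hm : Reduced m
    · have hd := hm.descent_of_not_reduced hl
      obtain ⟨m₂, hm₂, hlen⟩ := hd.exists_word
      -- Since b is a descent, m can be replaced by a reduced word starting with b; prefixing b
      -- produces the repeated letter.
      have hw : wordProd (b :: m₂) = wordProd m := by rw [wordProd_cons, hm₂, r_mul_cancel_left]
      exact hrel b _ _ hm (hm.of_length_le hw (by simp; omega)) hw.symm (hsq b m₂)
    · exact hcons _ _ (ih hm)

end SignedPermutations

end InterpolatingKLR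

namespace InterpolatingKLR

open MvPolynomial

/-! ### Spanning -/

/-! ### Evaluation of polynomials at commuting elements. -/

section Evaluation

variable {K : Type*} [CommRing K] {n : ℕ}

/-- Evaluation of polynomials at a commuting family of elements of an algebra. -/
noncomputable def commEval {B : Type*} [Ring B] [Algebra K B] (y : Fin n → B)
    (hy : ∀ a b, y a * y b = y b * y a) : MvPolynomial (Fin n) K →ₐ[K] B :=
  -- The target of `aeval` has to be commutative, so the evaluation takes place in the subalgebra
  -- generated by the y_a.
  letI : CommRing (Algebra.adjoin K (Set.range y)) :=
    { (Algebra.adjoin K (Set.range y)).toRing with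
      mul_comm := (Algebra.isMulCommutative_adjoin K (s := Set.range y) (by
        rintro _ ⟨a, rfl⟩ _ ⟨b, rfl⟩; exact hy a b)).is_comm.comm }
  (Algebra.adjoin K (Set.range y)).val.comp
    (aeval fun a => ⟨y a, Algebra.subset_adjoin ⟨a, rfl⟩⟩)

@[simp] theorem commEval_X {B : Type*} [Ring B] [Algebra K B] (y : Fin n → B)
    (hy : ∀ a b, y a * y b = y b * y a) (a : Fin n) : commEval (K := K) y hy (X a) = y a := by
  simp only [commEval, AlgHom.comp_apply, aeval_X]
  rfl

theorem fpoly_monomial {I : Type*} (β : Finset (Fin n → I)) (m : Fin n →₀ ℕ) :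
    fpoly K β (monomial m 1) = (List.ofFn fun a => fy K β a ^ m a).prod :=
  Module.Basis.constr_basis ..

theorem map_fpoly {I : Type*} {β : Finset (Fin n → I)} {B : Type*} [Ring B] [Algebra K B]
    (g : FreeAlgebra K (Gen β) →ₐ[K] B) (φ : MvPolynomial (Fin n) K →ₐ[K] B)
    (h : ∀ a, φ (X a) = g (fy K β a)) (p : MvPolynomial (Fin n) K) :
    g (fpoly K β p) = φ p := by
  suffices hl : g.toLinearMap ∘ₗ fpoly K β = φ.toLinearMap from LinearMap.congr_fun hl p
  refine (basisMonomials (Fin n) K).ext fun m => ?_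
  change g (fpoly K β (monomial m 1)) = φ (monomial m 1)
  have hm : monomial m (1 : K) = (List.ofFn fun a => (X a : MvPolynomial (Fin n) K) ^ m a).prod := by
    rw [List.prod_ofFn, monomial_eq, Finsupp.prod_fintype _ _ (fun _ => pow_zero _)]
    simp
  rw [fpoly_monomial, hm, map_list_prod, map_list_prod, List.map_ofFn, List.map_ofFn]
  congr 2
  funext a
  simp [h]

end Evaluation

/-! ### Straightening in any algebra satisfying the relations. -/

section Presentation

variable {I A K : Type*} [CommRing K] {Γ : LoopFreeQuiver I A} (Θ : Γ.Involution)
    {lam : I → ℕ} {gam : I → K} {n : ℕ} {β : Finset (Fin n → I)}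
    {B : Type*} [Ring B] [Algebra K B] (π : FreeAlgebra K (Gen β) →ₐ[K] B)

/-- The image of `y_{a+1}` under a homomorphism from the free algebra. -/
def Model.y (a : Fin n) : B := π (fy K β a)

/-- The image of `ψ_b` under a homomorphism from the free algebra. -/
def Model.psi (b : Fin n) : B := π (fpsi K β b)

/-- The image of `e(i)` under a homomorphism from the free algebra. -/
def Model.e (i : β) : B := π (fe K β i)

/-- The image of `ψ_{a_1} ⋯ ψ_{a_k}` under a homomorphism from the free algebra. -/
def Model.psiWord (l : List (Fin n)) : B := (l.map (Model.psi π)).prod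

variable (lam gam) in
/-- A homomorphism from the free algebra satisfies the relations of `V_β(Γ, λ, γ)`. -/
def IsModel : Prop := ∀ x y, Rel Γ Θ.vert lam gam β x y → π x = π y

variable {Θ π} (hπ : IsModel Θ lam gam π)

local notation "𝕪" => Model.y π
local notation "𝕡" => Model.psi π
local notation "𝕖" => Model.e π
local notation "𝕨" => Model.psiWord π

@[simp] theorem Model.mk_fy (a : Fin n) : π (fy K β a) = 𝕪 a := rfl
@[simp] theorem Model.mk_fpsi (a : Fin n) : π (fpsi K β a) = 𝕡 a := rfl
@[simp] theorem Model.mk_fe (i : β) : π (fe K β i) = 𝕖 i := rfl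

include hπ

theorem Model.sum_e : ∑ i, 𝕖 i = 1 := by
  simpa using hπ _ _ (Rel.sum_e (Γ := Γ) (θ := Θ.vert))

theorem Model.e_mul_self (i : β) : 𝕖 i * 𝕖 i = 𝕖 i := by
  simpa using hπ _ _ (Rel.e_mul_self i)

theorem Model.e_mul_of_ne {i j : β} (h : i ≠ j) : 𝕖 i * 𝕖 j = 0 := by
  simpa using hπ _ _ (Rel.e_mul_of_ne i j h)

theorem Model.y_comm (a b : Fin n) : 𝕪 a * 𝕪 b = 𝕪 b * 𝕪 a := by
  simpa using hπ _ _ (Rel.y_comm a b)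

theorem Model.y_e (a : Fin n) (i : β) : 𝕪 a * 𝕖 i = 𝕖 i * 𝕪 a := by
  simpa using hπ _ _ (Rel.y_e a i)

/-- The evaluation of polynomials at the images of the `y_a`. -/
noncomputable def Model.poly : MvPolynomial (Fin n) K →ₐ[K] B :=
  commEval 𝕪 (Model.y_comm hπ)

local notation "𝕢" => Model.poly hπ

@[simp] theorem Model.poly_X (a : Fin n) : 𝕢 (X a) = 𝕪 a := commEval_X _ _ _

@[simp] theorem Model.poly_C (c : K) : 𝕢 (C c) = algebraMap K _ c := (𝕢).commutes c

@[simp] theorem Model.mk_fpoly (p : MvPolynomial (Fin n) K) : π (fpoly K β p) = 𝕢 p :=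
  map_fpoly _ _ (fun a => by simp) p

theorem Model.list_prod_eq_poly (m : Fin n → ℕ) :
    (List.ofFn fun a => 𝕪 a ^ m a).prod =
      𝕢 (monomial (Finsupp.equivFunOnFinite.symm m) 1) := by
  rw [← Model.mk_fpoly, fpoly_monomial, map_list_prod, List.map_ofFn]
  congr 2
  funext a
  simp

theorem Model.poly_e (p : MvPolynomial (Fin n) K) (i : β) : 𝕢 p * 𝕖 i = 𝕖 i * 𝕢 p := by
  induction p using MvPolynomial.induction_on with
  | C c => simp [Algebra.commutes]
  | add p q hp hq => simp [add_mul, mul_add, hp, hq]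
  | mul_X p a hp => rw [map_mul, mul_assoc, Model.poly_X, Model.y_e hπ, ← mul_assoc, hp, mul_assoc]

omit hπ in
theorem act_mem (Θ : Γ.Involution) {β : Finset (Fin n → I)} (hβ : IsOrbit Θ.vert β)
    (w : SignedPerm n)
    {i : Fin n → I} (hi : i ∈ β) : act Θ.vert w i ∈ β := by
  obtain ⟨i₀, h₀⟩ := hβ
  rw [← Finset.mem_coe, h₀] at hi ⊢
  obtain ⟨v, rfl⟩ := hi
  exact ⟨w * v, act_mul Θ.vert_involutive w v i₀⟩

omit hπ in
/-- The action of `B_n` on the orbit `β`. -/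
def orbitAct (Θ : Γ.Involution) {β : Finset (Fin n → I)} (hβ : IsOrbit Θ.vert β)
    (w : SignedPerm n) (i : β) : β :=
  ⟨act Θ.vert w i.1, act_mem Θ hβ w i.2⟩

variable (hβ : IsOrbit Θ.vert β)

include hβ

local notation "β∙" => orbitAct Θ hβ

theorem Model.psi_e (b : Fin n) (i : β) : 𝕡 b * 𝕖 i = 𝕖 (β∙ (r b) i) * 𝕡 b := by
  simpa using hπ _ _ (Rel.psi_e b i (β∙ (r b) i) rfl)

theorem Model.psiWord_e (l : List (Fin n)) (i : β) : 𝕨 l * 𝕖 i = 𝕖 (β∙ (wordProd l) i) * 𝕨 l := by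
  induction l with
  | nil =>
    have : orbitAct Θ hβ 1 i = i := Subtype.ext (act_one Θ.vert _)
    simp [Model.psiWord, this]
  | cons b l ih =>
    have h1 : 𝕨 (b :: l) = 𝕡 b * 𝕨 l := by simp [Model.psiWord]
    have h2 : β∙ (wordProd (b :: l)) i = β∙ (r b) (β∙ (wordProd l) i) := Subtype.ext <| by
      rw [wordProd_cons]; exact act_mul Θ.vert_involutive _ _ _
    rw [h1, h2, mul_assoc, ih, ← mul_assoc, Model.psi_e hπ hβ, mul_assoc]

omit hβ

omit hπ in
theorem Model.psiWord_cons (b : Fin n) (l : List (Fin n)) : 𝕨 (b :: l) = 𝕡 b * 𝕨 l := by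
  simp [Model.psiWord]

/-- Every relation between ψ_b and y_a moves the polynomial factor to the left, with an error term
free of ψ. -/
theorem Model.exists_psi_mul_y_mul_e (b a : Fin n) (j : β) :
    ∃ q q', 𝕡 b * 𝕪 a * 𝕖 j = (𝕢 q * 𝕡 b + 𝕢 q') * 𝕖 j := by
  obtain ⟨_ | b, hb⟩ := b
  · by_cases ha : a.1 = 0
    · obtain rfl : a = ⟨0, hb⟩ := Fin.ext ha
      have h := hπ _ _ (Rel.psi0_y1 hb j)
      rw [map_smul, Algebra.smul_def] at h
      refine ⟨- X ⟨0, hb⟩, C (2 * gam (j.1 ⟨0, hb⟩)), ?_⟩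
      simp only [map_mul, map_add, Model.mk_fpsi, Model.mk_fy, Model.mk_fe] at h
      rw [map_neg, Model.poly_X, Model.poly_C, add_mul, map_mul, ← h]
      noncomm_ring
    · have h := hπ _ _ (Rel.psi0_y hb a (by omega))
      refine ⟨X a, 0, ?_⟩
      simp only [map_mul, Model.mk_fpsi, Model.mk_fy] at h
      simp [h]
  · by_cases hab : (a = ⟨b, by omega⟩ ∨ a = ⟨b + 1, hb⟩) ∧ j.1 ⟨b, by omega⟩ = j.1 ⟨b + 1, hb⟩
    · obtain ⟨rfl | rfl, hj⟩ := hab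
      · have h := hπ _ _ (Rel.psi_y_left b hb j hj)
        simp only [map_mul, map_sub, map_neg, Model.mk_fpsi, Model.mk_fy, Model.mk_fe] at h
        refine ⟨X ⟨b + 1, hb⟩, -1, ?_⟩
        simp only [Model.poly_X, map_neg, map_one]
        rw [add_mul, neg_one_mul, ← h]
        noncomm_ring
      · have h := hπ _ _ (Rel.psi_y_right b hb j hj)
        simp only [map_mul, map_sub, Model.mk_fpsi, Model.mk_fy, Model.mk_fe] at h
        refine ⟨X ⟨b, by omega⟩, 1, ?_⟩
        rw [Model.poly_X, map_one, add_mul, one_mul, ← sub_eq_iff_eq_add', ← sub_mul, h]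
    · have h := hπ _ _ (Rel.psi_y_other b hb a j hab)
      simp only [map_mul, map_sub, map_zero, Model.mk_fpsi, Model.mk_fy, Model.mk_fe] at h
      refine ⟨X (Equiv.swap ⟨b, by omega⟩ ⟨b + 1, hb⟩ a), 0, ?_⟩
      rw [Model.poly_X, map_zero, add_zero, ← sub_eq_zero, ← h, sub_mul]

theorem Model.exists_psi_mul_poly_mul_e (b : Fin n) (p : MvPolynomial (Fin n) K) (j : β) :
    ∃ q q', 𝕡 b * 𝕢 p * 𝕖 j = (𝕢 q * 𝕡 b + 𝕢 q') * 𝕖 j := by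
  induction p using MvPolynomial.induction_on with
  | C c => exact ⟨C c, 0, by simp [← Algebra.commutes]⟩
  | add p₁ p₂ h₁ h₂ =>
    obtain ⟨q₁, q₁', h₁⟩ := h₁
    obtain ⟨q₂, q₂', h₂⟩ := h₂
    refine ⟨q₁ + q₂, q₁' + q₂', ?_⟩
    rw [map_add, mul_add, add_mul, h₁, h₂, map_add, map_add]
    noncomm_ring
  | mul_X p a hp =>
    obtain ⟨q, q', hq⟩ := hp
    obtain ⟨s, s', hs⟩ := Model.exists_psi_mul_y_mul_e hπ b a j
    refine ⟨q * s, q * s' + q' * X a, ?_⟩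
    calc 𝕡 b * 𝕢 (p * X a) * 𝕖 j = 𝕡 b * 𝕢 p * 𝕖 j * 𝕪 a := by
          rw [map_mul, Model.poly_X]; simp only [mul_assoc, Model.y_e hπ]
      _ = 𝕢 q * (𝕡 b * 𝕪 a * 𝕖 j) + 𝕢 q' * 𝕪 a * 𝕖 j := by
          rw [hq, add_mul, add_mul]; simp only [mul_assoc, Model.y_e hπ]
      _ = _ := by
          rw [hs]
          simp only [map_mul, map_add, Model.poly_X]
          noncomm_ring

/-- The span of the elements `p(y) ψ_l e(i)` where `l` is a word of length less than `k`. -/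
noncomputable def Model.filt (k : ℕ) : Submodule K B :=
  Submodule.span K {x | ∃ p l i, l.length < k ∧ x = 𝕢 p * 𝕨 l * 𝕖 i}

theorem Model.mem_filt {k : ℕ} (p : MvPolynomial (Fin n) K) {l : List (Fin n)} (i : β)
    (h : l.length < k) : 𝕢 p * 𝕨 l * 𝕖 i ∈ Model.filt hπ k :=
  Submodule.subset_span ⟨p, l, i, h, rfl⟩

theorem Model.filt_mono {k m : ℕ} (h : k ≤ m) :
    Model.filt hπ k ≤ Model.filt hπ m := by
  refine Submodule.span_mono ?_
  rintro _ ⟨p, l, i, hl, rfl⟩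
  exact ⟨p, l, i, by omega, rfl⟩

theorem Model.poly_mul_mem_filt {k : ℕ} (p : MvPolynomial (Fin n) K) {x : B}
    (hx : x ∈ Model.filt hπ k) : 𝕢 p * x ∈ Model.filt hπ k := by
  induction hx using Submodule.span_induction with
  | mem x hx =>
    obtain ⟨q, l, i, hl, rfl⟩ := hx
    rw [← mul_assoc, ← mul_assoc, ← map_mul]
    exact Model.mem_filt hπ _ _ hl
  | zero => simp
  | add x y _ _ hx hy => rw [mul_add]; exact add_mem hx hy
  | smul c x _ hx => rw [mul_smul_comm]; exact Submodule.smul_mem _ _ hx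

include hβ

/-- Most relations are stated after multiplication by an idempotent. To use one in front of a word,
the idempotent of the component reached by that word is inserted. -/
theorem Model.mul_psiWord_mul_e (x : B) (l : List (Fin n)) (i : β) :
    x * 𝕨 l * 𝕖 i = x * 𝕖 (β∙ (wordProd l) i) * 𝕨 l * 𝕖 i := by
  rw [mul_assoc x (𝕖 _), ← Model.psiWord_e hπ hβ, mul_assoc, mul_assoc, mul_assoc,
    Model.e_mul_self hπ]

theorem Model.psi_mul_mem_filt {k : ℕ} (b : Fin n) {x : B} (hx : x ∈ Model.filt hπ k) :
    𝕡 b * x ∈ Model.filt hπ (k + 1) := by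
  induction hx using Submodule.span_induction with
  | mem x hx =>
    obtain ⟨p, l, i, hl, rfl⟩ := hx
    obtain ⟨q, q', hq⟩ := Model.exists_psi_mul_poly_mul_e hπ b p (β∙ (wordProd l) i)
    rw [← mul_assoc, ← mul_assoc, Model.mul_psiWord_mul_e hπ hβ, hq,
      ← Model.mul_psiWord_mul_e hπ hβ, add_mul, add_mul, mul_assoc (𝕢 q),
      ← Model.psiWord_cons]
    exact add_mem (Model.mem_filt hπ _ _ (by simpa using hl))
      (Model.mem_filt hπ _ _ (by omega))
  | zero => simp
  | add x y _ _ hx hy => rw [mul_add]; exact add_mem hx hy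
  | smul c x _ hx => rw [mul_smul_comm]; exact Submodule.smul_mem _ _ hx

theorem Model.mul_psiWord_mul_e_mem {x : B} {l : List (Fin n)} {i : β} {k : ℕ}
    (h : ∃ p : MvPolynomial (Fin n) K, ∃ m : List (Fin n), m.length + l.length < k ∧
      x * 𝕖 (β∙ (wordProd l) i) = 𝕢 p * 𝕨 m * 𝕖 (β∙ (wordProd l) i)) :
    x * 𝕨 l * 𝕖 i ∈ Model.filt hπ k := by
  obtain ⟨p, m, hm, hx⟩ := h
  rw [Model.mul_psiWord_mul_e hπ hβ, hx, ← Model.mul_psiWord_mul_e hπ hβ]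
  have : 𝕢 p * 𝕨 m * 𝕨 l = 𝕢 p * 𝕨 (m ++ l) := by simp [Model.psiWord, mul_assoc]
  rw [this]
  exact Model.mem_filt hπ _ _ (by simpa using hm)

theorem Model.psi_mul_psi_mul_psiWord_mem (b : Fin n) (l : List (Fin n)) (i : β) :
    𝕨 (b :: b :: l) * 𝕖 i ∈ Model.filt hπ (l.length + 2) := by
  rw [Model.psiWord_cons, Model.psiWord_cons, ← mul_assoc, ← pow_two]
  apply Model.mul_psiWord_mul_e_mem hπ hβ
  set j := β∙ (wordProd l) i
  have hnil : 𝕨 [] = 1 := rfl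
  obtain ⟨_ | b, hb⟩ := b
  · by_cases hj : gam (j.1 ⟨0, hb⟩) = 0
    · have h := hπ _ _ (Rel.psi0_sq_zero hb j hj)
      simp only [map_mul, map_pow, map_neg, map_one, Model.mk_fpsi, Model.mk_fy, Model.mk_fe] at h
      refine ⟨(-1) ^ lam (Θ.vert (j.1 ⟨0, hb⟩)) * X ⟨0, hb⟩ ^
        (lam (j.1 ⟨0, hb⟩) + lam (Θ.vert (j.1 ⟨0, hb⟩))), [], by simp, h.trans ?_⟩
      simp [hnil]
    · have h := hπ _ _ (Rel.psi0_sq_ne hb j hj)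
      simp only [map_mul, map_pow, map_zero, Model.mk_fpsi, Model.mk_fe] at h
      exact ⟨0, [], by simp, by simp [h]⟩
  · have h := hπ _ _ (Rel.psi_sq b hb j)
    simp only [map_mul, map_pow, Model.mk_fpsi, Model.mk_fe, Model.mk_fpoly hπ] at h
    exact ⟨_, [], by simp, by rw [h, hnil, mul_one]⟩

theorem Model.braid3_mem (b : ℕ) (h : b + 2 < n) (l : List (Fin n)) (i : β) :
    (𝕨 (⟨b + 1, by omega⟩ :: ⟨b + 2, h⟩ :: ⟨b + 1, by omega⟩ :: l) -
      𝕨 (⟨b + 2, h⟩ :: ⟨b + 1, by omega⟩ :: ⟨b + 2, h⟩ :: l)) * 𝕖 i ∈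
      Model.filt hπ (l.length + 3) := by
  simp only [Model.psiWord_cons]
  rw [← neg_sub, neg_mul, neg_mem_iff]
  simp only [← mul_assoc]
  rw [← sub_mul]
  apply Model.mul_psiWord_mul_e_mem hπ hβ
  set j := β∙ (wordProd l) i
  have hnil : 𝕨 [] = 1 := rfl
  by_cases hj : j.1 ⟨b, by omega⟩ = j.1 ⟨b + 2, h⟩
  · obtain ⟨p, hp⟩ := dvd_braid3 Γ (j.1 ⟨b, by omega⟩) (j.1 ⟨b + 1, by omega⟩)
      (X ⟨b, by omega⟩ : MvPolynomial (Fin n) K) (X ⟨b + 1, by omega⟩) (X ⟨b + 2, h⟩)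
    have h := hπ _ _ (Rel.braid3_eq b h j hj p hp.symm)
    simp only [map_mul, map_sub, Model.mk_fpsi, Model.mk_fe, Model.mk_fpoly hπ] at h
    exact ⟨p, [], by simp, by rw [h, hnil, mul_one]⟩
  · have h := hπ _ _ (Rel.braid3_ne b h j hj)
    simp only [map_mul, map_sub, Model.mk_fpsi, Model.mk_fe, map_zero] at h
    exact ⟨0, [], by simp, by rw [h]; simp⟩

/-- The error terms contain at most one ψ. If γ_{i_1} ≠ 0 the error is a sum of two terms of
different lengths, so `Model.mul_psiWord_mul_e_mem` does not apply; in that case `hgam` makes the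
fraction a polynomial. -/
theorem Model.braid4_mem (hgam : ∀ i, Θ.vert i ≠ i → gam i = 0) (h : 1 < n)
    (l : List (Fin n)) (i : β) :
    (𝕨 (⟨0, by omega⟩ :: ⟨1, h⟩ :: ⟨0, by omega⟩ :: ⟨1, h⟩ :: l) -
      𝕨 (⟨1, h⟩ :: ⟨0, by omega⟩ :: ⟨1, h⟩ :: ⟨0, by omega⟩ :: l)) * 𝕖 i ∈
      Model.filt hπ (l.length + 4) := by
  have hx : 𝕨 (⟨0, by omega⟩ :: ⟨1, h⟩ :: ⟨0, by omega⟩ :: ⟨1, h⟩ :: l) -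
      𝕨 (⟨1, h⟩ :: ⟨0, by omega⟩ :: ⟨1, h⟩ :: ⟨0, by omega⟩ :: l) =
      ((𝕡 ⟨0, by omega⟩ * 𝕡 ⟨1, h⟩) ^ 2 - (𝕡 ⟨1, h⟩ * 𝕡 ⟨0, by omega⟩) ^ 2) * 𝕨 l := by
    simp only [Model.psiWord_cons, pow_two, mul_assoc, sub_mul]
  rw [hx]
  have hnil : 𝕨 [] = 1 := rfl
  by_cases hj : gam ((β∙ (wordProd l) i).1 ⟨0, by omega⟩) = 0
  · apply Model.mul_psiWord_mul_e_mem hπ hβ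
    set j := β∙ (wordProd l) i
    by_cases hj' : Θ.vert (j.1 ⟨0, by omega⟩) = j.1 ⟨1, h⟩
    · obtain ⟨p, hp⟩ := dvd_braid4_theta (X ⟨0, by omega⟩ : MvPolynomial (Fin n) K) (X ⟨1, h⟩)
        (lam (j.1 ⟨0, by omega⟩) + lam (Θ.vert (j.1 ⟨0, by omega⟩)))
      have h := hπ _ _ (Rel.braid4_theta h j hj hj' p hp.symm)
      simp only [map_mul, map_sub, map_pow, map_neg, map_one, Model.mk_fpsi, Model.mk_fe,
        Model.mk_fpoly hπ] at h
      refine ⟨(-1) ^ lam (Θ.vert (j.1 ⟨0, by omega⟩)) * p, [⟨1, by omega⟩], by simp; omega, h.trans ?_⟩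
      simp [Model.psiWord]
    · obtain ⟨p, hp⟩ := (dvd_braid4_zero Γ (j.1 ⟨1, h⟩) (j.1 ⟨0, by omega⟩)
        (X ⟨0, by omega⟩ : MvPolynomial (Fin n) K) (X ⟨1, h⟩)).mul_left (C (gam (j.1 ⟨1, h⟩)))
      have h := hπ _ _ (Rel.braid4_zero h j hj hj' p hp.symm)
      simp only [map_mul, map_sub, map_pow, Model.mk_fpsi, Model.mk_fe, Model.mk_fpoly hπ] at h
      refine ⟨p, [⟨0, by omega⟩], by simp; omega, h.trans ?_⟩
      simp [Model.psiWord]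
  · obtain ⟨p, hp⟩ := dvd_braid4_ne Θ gam hgam ((β∙ (wordProd l) i).1 ⟨1, h⟩)
        ((β∙ (wordProd l) i).1 ⟨0, by omega⟩) hj
        (X ⟨0, by omega⟩ : MvPolynomial (Fin n) K) (X ⟨1, h⟩)
    have h := hπ _ _ (Rel.braid4_ne h _ hj p hp.symm)
    simp only [map_mul, map_sub, map_pow, Model.mk_fpsi, Model.mk_fe, Model.mk_fpoly hπ, Model.mk_fy,
      AlgHom.commutes] at h
    rw [Model.mul_psiWord_mul_e hπ hβ, h, ← Model.mul_psiWord_mul_e hπ hβ]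
    have e : 𝕢 p * (𝕪 ⟨0, by omega⟩ * 𝕡 ⟨0, by omega⟩
        - algebraMap K B (gam ((β∙ (wordProd l) i).1 ⟨0, by omega⟩))) * 𝕨 l * 𝕖 i =
        𝕢 (p * X ⟨0, by omega⟩) * 𝕨 (⟨0, by omega⟩ :: l) * 𝕖 i -
        𝕢 (p * C (gam ((β∙ (wordProd l) i).1 ⟨0, by omega⟩))) * 𝕨 l * 𝕖 i := by
      simp only [map_mul, Model.poly_X, Model.poly_C, Model.psiWord_cons, mul_assoc, sub_mul, mul_sub]
    rw [e]
    exact sub_mem (Model.mem_filt hπ _ _ (by simp))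
      (Model.mem_filt hπ _ _ (by omega))

/-- Matsumoto's theorem for the relation "same length, and equal modulo shorter words". Equality of
lengths is carried along so that transitivity and symmetry refer to one step of the filtration. -/
theorem Model.psiWord_sub_mem_filt (hgam : ∀ i, Θ.vert i ≠ i → gam i = 0) {l l' : List (Fin n)}
    (hl : Reduced l) (hl' : Reduced l') (h : wordProd l = wordProd l') (i : β) :
    (𝕨 l - 𝕨 l') * 𝕖 i ∈ Model.filt hπ l.length := by
  refine (Reduced.rel (fun l l' => l.length = l'.length ∧
    ∀ i, (𝕨 l - 𝕨 l') * 𝕖 i ∈ Model.filt hπ l.length)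
    ?_ ?_ ?_ ?_ ?_ ?_ ?_ hl hl' h).2 i
  · exact fun l => ⟨rfl, by simp⟩
  · rintro l₁ l₂ l₃ ⟨h1, h2⟩ ⟨h3, h4⟩
    refine ⟨h1.trans h3, fun i => ?_⟩
    rw [← sub_add_sub_cancel _ (𝕨 l₂), add_mul]
    exact add_mem (h2 i) (h1 ▸ h4 i)
  · rintro l₁ l₂ ⟨h1, h2⟩
    refine ⟨h1.symm, fun i => ?_⟩
    rw [← neg_sub, neg_mul, neg_mem_iff, ← h1]
    exact h2 i
  · rintro b l₁ l₂ ⟨h1, h2⟩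
    refine ⟨by simp [h1], fun i => ?_⟩
    rw [Model.psiWord_cons, Model.psiWord_cons, ← mul_sub, mul_assoc]
    exact Model.psi_mul_mem_filt hπ hβ b (h2 i)
  · intro b c l hbc
    refine ⟨by simp, fun i => ?_⟩
    have h := hπ _ _ (Rel.psi_comm b c hbc)
    simp only [map_mul, Model.mk_fpsi] at h
    simp only [Model.psiWord_cons, ← mul_assoc, h, sub_self, zero_mul]
    exact zero_mem _
  · exact fun b h l => ⟨by simp, fun i => Model.braid3_mem hπ hβ b h l i⟩
  · exact fun h l => ⟨by simp, fun i => Model.braid4_mem hπ hβ hgam h l i⟩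

theorem Model.psiWord_mem_filt_of_not_reduced (hgam : ∀ i, Θ.vert i ≠ i → gam i = 0)
    {l : List (Fin n)} (hl : ¬ Reduced l) (i : β) :
    𝕨 l * 𝕖 i ∈ Model.filt hπ l.length := by
  refine induction_not_reduced (fun l => ∀ i, 𝕨 l * 𝕖 i ∈ Model.filt hπ l.length)
    ?_ ?_ ?_ hl i
  · intro b l h i
    rw [Model.psiWord_cons, mul_assoc]
    exact Model.psi_mul_mem_filt hπ hβ b (h i)
  · intro b l l' hl hl' hw h i
    have hlen : l.length = l'.length := le_antisymm (hl _ hw.symm) (hl' _ hw)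
    have e : 𝕨 (b :: l) * 𝕖 i = 𝕡 b * ((𝕨 l - 𝕨 l') * 𝕖 i) + 𝕨 (b :: l') * 𝕖 i := by
      rw [Model.psiWord_cons, Model.psiWord_cons]; simp only [mul_assoc, sub_mul, mul_sub]; abel
    rw [e]
    refine add_mem (Model.psi_mul_mem_filt hπ hβ b
      (Model.psiWord_sub_mem_filt hπ hβ hgam hl hl' hw i)) ?_
    have := h i
    rwa [List.length_cons, ← hlen] at this
  · exact fun b l i => Model.psi_mul_psi_mul_psiWord_mem hπ hβ b l i

/-- Modulo shorter words, which the induction covers, a reduced word may be replaced by the chosen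
one for the same element, and a non-reduced word vanishes. -/
theorem Model.filt_le_span (hgam : ∀ i, Θ.vert i ≠ i → gam i = 0)
    (red : SignedPerm n → List (Fin n)) (hred : ∀ w, IsReducedExpression w (red w)) (k : ℕ) :
    Model.filt hπ k ≤
      Submodule.span K {x | ∃ p w i, x = 𝕢 p * 𝕨 (red w) * 𝕖 i} := by
  set S := Submodule.span K {x | ∃ p w i, x = 𝕢 p * 𝕨 (red w) * 𝕖 i} with hS
  have hmul : ∀ (p : MvPolynomial (Fin n) K) (x : B), x ∈ S → 𝕢 p * x ∈ S := by
    intro p x hx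
    induction hx using Submodule.span_induction with
    | mem x hx =>
      obtain ⟨q, w, i, rfl⟩ := hx
      rw [← mul_assoc, ← mul_assoc, ← map_mul]
      exact Submodule.subset_span ⟨_, _, _, rfl⟩
    | zero => simp
    | add x y _ _ hx hy => rw [mul_add]; exact add_mem hx hy
    | smul c x _ hx => rw [mul_smul_comm]; exact Submodule.smul_mem _ _ hx
  induction k with
  | zero =>
    refine Submodule.span_le.2 ?_
    rintro _ ⟨p, l, i, hl, rfl⟩
    exact absurd hl (Nat.not_lt_zero _)
  | succ k ih =>
    refine Submodule.span_le.2 ?_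
    rintro _ ⟨p, l, i, hl, rfl⟩
    rw [SetLike.mem_coe, mul_assoc]
    apply hmul
    have hle := (Model.filt_mono hπ (Nat.lt_succ_iff.1 hl)).trans ih
    by_cases hr : Reduced l
    · have hr' : Reduced (red (wordProd l)) := fun m hm => (hred _).2 m (hm.trans (hred _).1)
      have := Model.psiWord_sub_mem_filt hπ hβ hgam hr hr' (hred _).1.symm i
      have h2 : 𝕨 (red (wordProd l)) * 𝕖 i ∈ S :=
        Submodule.subset_span ⟨1, _, i, by rw [map_one, one_mul]⟩
      have := add_mem (hle this) h2
      rwa [sub_mul, sub_add_cancel] at this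
    · exact hle (Model.psiWord_mem_filt_of_not_reduced hπ hβ hgam hr i)

theorem Model.exists_mem_filt (hsurj : Function.Surjective π) (x : B) :
    ∃ k, x ∈ Model.filt hπ k := by
  -- The union of the filtration is shown to be stable under left multiplication. It contains 1, the
  -- sum of the e(i), which are the terms with empty word; the bound being strict, these lie in step
  -- 1.
  suffices h : ∀ (f : FreeAlgebra K (Gen β)) (z : B), (∃ k, z ∈ Model.filt hπ k) →
      ∃ k, π f * z ∈ Model.filt hπ k by
    obtain ⟨f, rfl⟩ := hsurj x
    have h1 : (1 : B) ∈ Model.filt hπ 1 := by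
      rw [← Model.sum_e hπ]
      refine sum_mem fun i _ => ?_
      simpa [Model.psiWord] using Model.mem_filt hπ 1 (l := []) i (k := 1) (by simp)
    have := h f 1 ⟨1, h1⟩
    rwa [mul_one] at this
  intro f
  induction f using FreeAlgebra.induction with
  | grade0 c =>
    rintro z ⟨k, hz⟩
    refine ⟨k, ?_⟩
    rw [AlgHom.commutes, ← Algebra.smul_def]
    exact Submodule.smul_mem _ _ hz
  | grade1 g =>
    rintro z ⟨k, hz⟩
    rcases g with a | b | i
    · refine ⟨k, ?_⟩
      change 𝕪 a * z ∈ _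
      rw [← Model.poly_X]
      exact Model.poly_mul_mem_filt hπ _ hz
    · exact ⟨k + 1, Model.psi_mul_mem_filt hπ hβ b hz⟩
    · refine ⟨k, ?_⟩
      change 𝕖 i * z ∈ _
      induction hz using Submodule.span_induction with
      | mem x hx =>
        obtain ⟨p, l, j, hl, rfl⟩ := hx
        rw [Model.mul_psiWord_mul_e hπ hβ, Model.poly_e hπ]
        by_cases hij : i = β∙ (wordProd l) j
        · rw [← hij]
          simp only [← mul_assoc]
          rw [Model.e_mul_self hπ, hij, ← Model.poly_e hπ, ← Model.mul_psiWord_mul_e hπ hβ]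
          exact Model.mem_filt hπ _ _ hl
        · simp only [← mul_assoc]
          rw [Model.e_mul_of_ne hπ hij]
          simp
      | zero => simp
      | add x y _ _ hx hy => rw [mul_add]; exact add_mem hx hy
      | smul c x _ hx => rw [mul_smul_comm]; exact Submodule.smul_mem _ _ hx
  | mul f g hf hg =>
    intro z hz
    rw [map_mul, mul_assoc]
    exact hf _ (hg _ hz)
  | add f g hf hg =>
    intro z hz
    obtain ⟨k, hk⟩ := hf z hz
    obtain ⟨m, hm⟩ := hg z hz
    refine ⟨max k m, ?_⟩
    rw [map_add, add_mul]
    exact add_mem (Model.filt_mono hπ (le_max_left _ _) hk)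
      (Model.filt_mono hπ (le_max_right _ _) hm)

theorem Model.span_eq_top (hsurj : Function.Surjective π) (hgam : ∀ i, Θ.vert i ≠ i → gam i = 0)
    (red : SignedPerm n → List (Fin n)) (hred : ∀ w, IsReducedExpression w (red w)) :
    Submodule.span K (Set.range fun x : (Fin n → ℕ) × SignedPerm n × β =>
      (List.ofFn fun a => 𝕪 a ^ x.1 a).prod * 𝕨 (red x.2.1) * 𝕖 x.2.2) = ⊤ := by
  rw [eq_top_iff]
  rintro x -
  obtain ⟨k, hk⟩ := Model.exists_mem_filt hπ hβ hsurj x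
  refine Submodule.span_le.2 ?_ (Model.filt_le_span hπ hβ hgam red hred k hk)
  rintro _ ⟨p, w, i, rfl⟩
  rw [SetLike.mem_coe]
  induction p using MvPolynomial.induction_on' with
  | monomial m c =>
    have : monomial m c = c • monomial (Finsupp.equivFunOnFinite.symm (m : Fin n → ℕ)) (1 : K) := by
      rw [smul_monomial, smul_eq_mul, mul_one]
      congr 1
      ext; simp
    rw [this, map_smul, ← Model.list_prod_eq_poly hπ, smul_mul_assoc, smul_mul_assoc]
    exact Submodule.smul_mem _ _ (Submodule.subset_span ⟨(m, w, i), rfl⟩)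
  | add p q hp hq =>
    rw [map_add, add_mul, add_mul]
    exact add_mem hp hq

end Presentation

end InterpolatingKLR

namespace InterpolatingKLR

/-! ### Local identities for the polynomial representation -/

section LocalIdentities

open scoped Classical in
/-- The coefficient of the reflection in the operator representing `ψ_a`, `a ≥ 1`. -/
noncomputable def alphaA {I A : Type*} (Γ : LoopFreeQuiver I A)
    {F : Type*} [Field F] (p q : I) (u v : F) : F :=
  if p = q then (u - v)⁻¹ else (v - u) ^ Γ.arrows p q

open scoped Classical in
/-- The indicator of the positions at which `ψ_a`, `a ≥ 1`, is a divided difference operator. -/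
noncomputable def deltaA {I F : Type*} [Field F] (p q : I) : F := if p = q then 1 else 0

open scoped Classical in
/-- The coefficient of the reflection in the operator representing `ψ_0`. -/
noncomputable def alphaB {I F : Type*} [Field F] (lam : I → ℕ) (g : I → F) (p : I) (u : F) : F :=
  if g p = 0 then u ^ lam p else - (g p / u)

open scoped Classical in
/-- The indicator of the positions at which `ψ_0` is a divided difference operator. -/
noncomputable def deltaB {I F : Type*} [Field F] (g : I → F) (p : I) : F := if g p = 0 then 0 else 1

open scoped Classical in
/-- The value of the polynomial `Q_{pq}`. -/
noncomputable def qVal {I A : Type*} (Γ : LoopFreeQuiver I A)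
    {F : Type*} [Field F] (p q : I) (u v : F) : F :=
  if p = q then 0 else (-1) ^ Γ.arrows p q * (u - v) ^ Γ.dot p q

variable {I A F : Type*} [Field F] (Γ : LoopFreeQuiver I A)

theorem sub_pow_comm (u v : F) (N : ℕ) : (v - u) ^ N = (-1) ^ N * (u - v) ^ N := by
  rw [← mul_pow]; ring

theorem neg_one_pow_mul_self (N : ℕ) : ((-1 : F) ^ N) * (-1) ^ N = 1 := by
  rw [← mul_pow]; simp

-- The variables g, g1, …, g3 stand for the images of one function under the six elements of S_3,
-- with the word as subscript and g3 for the longest element. The identity holds with these as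
-- unknowns, so it is proved coefficientwise, by cases on which of the labels p, q, t coincide.
open scoped Classical in
theorem braid3_identity (p q t : I) (u v w g g1 g2 g12 g21 g3 : F)
    (huv : u - v ≠ 0) (huw : u - w ≠ 0) (hvw : v - w ≠ 0) :
    alphaA Γ q t v w * (alphaA Γ p t u w * (alphaA Γ p q u v * (g3 - deltaA p q * g21) -
        deltaA p t * (alphaA Γ t q w v * (g - deltaA t q * g2))) -
      deltaA q t * (alphaA Γ p q u v * (alphaA Γ p t u w * (g12 - deltaA p t * g1) -
        deltaA p q * (alphaA Γ q t v w * (g2 - deltaA q t * g))))) -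
    alphaA Γ p q u v * (alphaA Γ p t u w * (alphaA Γ q t v w * (g3 - deltaA q t * g12) -
        deltaA p t * (alphaA Γ q p v u * (g - deltaA q p * g1))) -
      deltaA p q * (alphaA Γ q t v w * (alphaA Γ p t u w * (g21 - deltaA p t * g2) -
        deltaA q t * (alphaA Γ p q u v * (g1 - deltaA p q * g))))) =
    (if p = t then (qVal Γ p q u v - qVal Γ p q w v) / (u - w) else 0) * g := by
  have hvu : v - u ≠ 0 := by rwa [← neg_sub, neg_ne_zero]
  have hwv : w - v ≠ 0 := by rwa [← neg_sub, neg_ne_zero]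
  have hwu : w - u ≠ 0 := by rwa [← neg_sub, neg_ne_zero]
  by_cases hpq : p = q
  · subst hpq
    by_cases hpt : p = t
    · subst hpt
      simp only [alphaA, deltaA, qVal, if_true]
      field_simp
      ring
    · have htp := Ne.symm hpt
      simp only [alphaA, deltaA, if_true, hpt, htp, if_false]
      field_simp
      ring
  · have hqp := Ne.symm hpq
    by_cases hpt : p = t
    · subst hpt
      simp only [alphaA, deltaA, qVal, LoopFreeQuiver.dot, if_true, hpq, hqp, if_false]
      rw [sub_pow_comm u v, sub_pow_comm v w, pow_add, pow_add]
      have hwv2 : ∀ N, (v - w) ^ N = (-1) ^ N * (w - v) ^ N := fun N => sub_pow_comm w v N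
      have he := neg_one_pow_mul_self (F := F) (Γ.arrows q p)
      simp only [hwv2]
      field_simp
      -- The two sides agree once the square of (−1)^{|q → p|} is replaced by 1.
      linear_combination (-(g * (w - v) ^ Γ.arrows q p * (w - v) ^ Γ.arrows p q)) * he
    · have htp := Ne.symm hpt
      by_cases hqt : q = t
      · subst hqt
        simp only [alphaA, deltaA, if_true, hpq, hqp, if_false]
        field_simp
        ring
      · have htq := Ne.symm hqt
        simp only [alphaA, deltaA, hpq, hqp, hpt, hqt, htq, if_false]
        ring

-- As for `braid3_identity`, y, ya, …, yabab are the images of one function under the eight elements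
-- of the dihedral group, with a for r_0 and b for r_1. The labels p and q are those of the target
-- component. They are the images under θ of the labels i_1 and i_2 in the defining relation.
open scoped Classical in
theorem braid4_identity {θ : I → I} (hθ : Function.Involutive θ) (lam : I → ℕ) (g : I → F)
    (harr : ∀ i j, Γ.arrows (θ j) (θ i) = Γ.arrows i j) (hgam : ∀ i, θ i ≠ i → g i = 0)
    (hstrong : ∀ i, g i = 0 → θ i ≠ i ∨ lam i + lam (θ i) = 0) (p q : I)
    (u v y ya yb yab yba yaba ybab yabab : F) (hu : u ≠ 0) (hv : v ≠ 0) (huv : u - v ≠ 0)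
    (huv' : u + v ≠ 0) :
    alphaB lam g p u * ((alphaA Γ (θ p) q (-u) v * ((alphaB lam g q v * ((alphaA Γ (θ q) (θ p)
    (-v) (-u) * (yabab - deltaA (θ q) (θ p) * yaba)) - deltaB g q * (alphaA Γ q (θ p) v (-u) *
    (ya - deltaA q (θ p) * yab)))) - deltaA (θ p) q * (alphaB lam g (θ p) (-u) * ((alphaA Γ p q
    u v * (yb - deltaA p q * y)) - deltaB g (θ p) * (alphaA Γ (θ p) q (-u) v * (yab - deltaA (θ
    p) q * ya)))))) - deltaB g p * (alphaA Γ p q u v * ((alphaB lam g q v * ((alphaA Γ (θ q) p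
    (-v) u * (ybab - deltaA (θ q) p * yba)) - deltaB g q * (alphaA Γ q p v u * (y - deltaA q p *
    yb)))) - deltaA p q * (alphaB lam g p u * ((alphaA Γ (θ p) q (-u) v * (yab - deltaA (θ p) q
    * ya)) - deltaB g p * (alphaA Γ p q u v * (yb - deltaA p q * y))))))) - alphaA Γ p q u v *
    ((alphaB lam g q v * ((alphaA Γ (θ q) p (-v) u * ((alphaB lam g p u * (yabab - deltaB g p *
    ybab)) - deltaA (θ q) p * (alphaB lam g (θ q) (-v) * (yb - deltaB g (θ q) * yba)))) - deltaB
    g q * (alphaA Γ q p v u * ((alphaB lam g p u * (ya - deltaB g p * y)) - deltaA q p * (alphaB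
    lam g q v * (yba - deltaB g q * yb)))))) - deltaA p q * (alphaB lam g p u * ((alphaA Γ (θ p)
    q (-u) v * ((alphaB lam g q v * (yaba - deltaB g q * yab)) - deltaA (θ p) q * (alphaB lam g
    (θ p) (-u) * (y - deltaB g (θ p) * ya)))) - deltaB g p * (alphaA Γ p q u v * ((alphaB lam g
    q v * (yba - deltaB g q * yb)) - deltaA p q * (alphaB lam g p u * (ya - deltaB g p *
    y))))))) =
    if g p = 0 then
      if θ p = q then
        (-1) ^ lam p * (((-u) ^ (lam q + lam p) - v ^ (lam q + lam p)) / (u + v)) *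
          (alphaA Γ p q u v * (yb - deltaA p q * y))
      else g q * ((qVal Γ q (θ p) u (-v) - qVal Γ q (θ p) u v) / v) *
        (alphaB lam g p u * (ya - deltaB g p * y))
    else g q * ((qVal Γ q p u (-v) - qVal Γ q p u v) / (u * v)) *
      (u * (alphaB lam g p u * (ya - deltaB g p * y)) - g p * y) := by
  have hvu : v - u ≠ 0 := by rwa [← neg_sub, neg_ne_zero]
  have hvu' : v + u ≠ 0 := by rwa [add_comm]
  have h1 : u - -v ≠ 0 := by rwa [sub_neg_eq_add]
  have h2 : v - -u ≠ 0 := by rwa [sub_neg_eq_add]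
  have h3 : -u - v ≠ 0 := by rwa [← neg_add', neg_ne_zero]
  have h4 : -v - u ≠ 0 := by rwa [← neg_add', neg_ne_zero]
  have h5 : -u - -v ≠ 0 := by rwa [neg_sub_neg]
  have h6 : -v - -u ≠ 0 := by rwa [neg_sub_neg]
  have h7 : -v + u ≠ 0 := by rwa [neg_add_eq_sub]
  -- These rewrite powers with symbolic exponents to fixed bases u, v, u − v and u + v, up to sign,
  -- since `ring` does not identify powers of opposite bases.
  have e1 : ∀ N, (-u) ^ N = (-1) ^ N * u ^ N := fun N => neg_pow u N
  have e2 : ∀ N, (-v) ^ N = (-1) ^ N * v ^ N := fun N => neg_pow v N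
  have e3 : ∀ N, (v - u) ^ N = (-1) ^ N * (u - v) ^ N := fun N => sub_pow_comm u v N
  have e4 : ∀ N, (-u - v) ^ N = (-1) ^ N * (u + v) ^ N := fun N => by rw [← mul_pow]; ring
  have e6 : ∀ N, (v + u) ^ N = (u + v) ^ N := fun N => by rw [add_comm]
  have e9 : ∀ N, (-u + v) ^ N = (-1) ^ N * (u - v) ^ N := fun N => by rw [← mul_pow]; ring
  have hgθ : ∀ i, g (θ i) = g i := fun i => by
    by_cases h : θ i = i
    · rw [h]
    · rw [hgam i h, hgam (θ i) (by rw [hθ]; exact Ne.symm h)]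
  by_cases hp : g p = 0
  · have hpθ : g (θ p) = 0 := by rw [hgθ, hp]
    by_cases hθpq : θ p = q
    · subst hθpq
      by_cases hpp : θ p = p
      · have hl : lam p = 0 := by
          rcases hstrong p hp with h | h
          · exact absurd hpp h
          · omega
        simp only [alphaA, deltaA, alphaB, deltaB, qVal, hpp, hp, hl, if_true]
        field_simp
        ring
      · have hpp' := Ne.symm hpp
        simp only [alphaA, deltaA, alphaB, deltaB, hθ p, hp, hpθ, hpp, hpp', if_true, if_false]
        simp only [sub_neg_eq_add, e1, e2, e3, e9, pow_add]
        have he1 := neg_one_pow_mul_self (F := F) (lam p)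
        field_simp
        linear_combination ((u + v) ^ 4 * u ^ lam p * (-1) ^ lam (θ p) * u ^ lam (θ p) *
          (-1) ^ Γ.arrows p (θ p) * (u - v) ^ Γ.arrows p (θ p) * yb) * he1
    · by_cases hq : g q = 0
      · have hqθ : g (θ q) = 0 := by rw [hgθ, hq]
        have hθqp : θ q ≠ p := by rintro rfl; exact hθpq (hθ q)
        by_cases hpq : p = q
        · subst hpq
          simp only [alphaA, deltaA, alphaB, deltaB, hp, hpθ, hθpq, Ne.symm hθpq, if_true, if_false]
          simp only [sub_neg_eq_add, e1, e2, e4, e6]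
          field_simp
          ring
        · have a1 : Γ.arrows (θ q) (θ p) = Γ.arrows p q := harr p q
          have a2 : Γ.arrows (θ q) p = Γ.arrows (θ p) q := by rw [← harr (θ p) q, hθ]
          have hpq' : θ q ≠ θ p := fun h => hpq (hθ.injective h).symm
          simp only [alphaA, deltaA, alphaB, deltaB, hp, hpθ, hq, hqθ, hθpq, Ne.symm hθpq, hpq,
            Ne.symm hpq, hpq', hθqp, if_true, if_false, a1, a2]
          simp only [sub_neg_eq_add, e1, e2, e3, e4, e6, e9]
          field_simp
          ring
      · have hθq : θ q = q := by_contra fun h => hq (hgam q h)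
        have hpq : p ≠ q := by rintro rfl; exact hq hp
        have a1 : Γ.arrows q (θ p) = Γ.arrows p q := by rw [← harr p q, hθq]
        have a2 : Γ.arrows (θ p) q = Γ.arrows q p := by rw [← harr q p, hθq]
        have hqθp := Ne.symm hθpq
        simp only [alphaA, deltaA, alphaB, deltaB, qVal, LoopFreeQuiver.dot, hp, hpθ, hq, hθpq,
            hqθp, hpq, hpq.symm, hθq, if_true, if_false, a1, a2, sub_neg_eq_add]
        simp only [e1, e3, e4, e6, e9, pow_add]
        field_simp
        ring
  have hθp : θ p = p := by_contra fun h => hp (hgam p h)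
  by_cases hq : g q = 0
  · have hpq : p ≠ q := by rintro rfl; exact hp hq
    have hpq' : p ≠ θ q := by
      rintro rfl
      rw [hθ] at hθp
      exact hpq hθp.symm
    have hgq : g (θ q) = 0 := by rw [hgθ, hq]
    have a1 : Γ.arrows (θ q) p = Γ.arrows p q := by rw [← harr p q, hθp]
    simp only [alphaA, deltaA, alphaB, deltaB, hθp, hp, hq, hgq, hpq, hpq.symm,
      hpq'.symm, if_true, if_false, a1]
    simp only [sub_neg_eq_add, e2, e3, e4, e6, e9]
    field_simp
    ring
  · have hθq : θ q = q := by_contra fun h => hq (hgam q h)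
    by_cases hpq : p = q
    · subst hpq
      simp only [alphaA, deltaA, alphaB, deltaB, qVal, hθp, hp, if_true, if_false]
      field_simp
      ring
    -- Both labels are fixed by θ, so a single exponent remains and its powers may be treated as
    -- unknowns.
    · have a1 : Γ.arrows q p = Γ.arrows p q := by rw [← harr p q, hθp, hθq]
      have hqp := Ne.symm hpq
      simp only [alphaA, deltaA, alphaB, deltaB, qVal, LoopFreeQuiver.dot, hθp, hθq, hp, hq, hpq,
        hqp, if_false, a1, sub_neg_eq_add]
      simp only [e3, e4, e6, e9, pow_add]
      generalize (-1 : F) ^ Γ.arrows p q = ε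
      generalize (u + v) ^ Γ.arrows p q = m
      generalize (u - v) ^ Γ.arrows p q = m'
      field_simp
      ring

end LocalIdentities

end InterpolatingKLR

namespace InterpolatingKLR

open MvPolynomial

/-! ### The polynomial representation -/

/-- A field with an action of `B_n` by automorphisms and elements `x_1, …, x_n` permuted by this
action up to signs, with `x_a ± x_b` invertible. -/
structure SignedField (R F : Type*) [CommRing R] [Field F] [Algebra R F] (n : ℕ) where
  s : SignedPerm n →* (F ≃ₐ[R] F)
  x : Fin n → F
  s_x : ∀ w a, s w (x a) = extend Neg.neg x (w.1 (a, 1))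
  x_ne : ∀ a, x a ≠ 0
  sub_ne : ∀ a b, a ≠ b → x a - x b ≠ 0
  add_ne : ∀ a b, x a + x b ≠ 0
  inj : Function.Injective (algebraMap R F)

section Representation

variable {I A R F : Type*} [CommRing R] [Field F] [Algebra R F] {n : ℕ} (S : SignedField R F n)
  {Γ : LoopFreeQuiver I A} (Θ : Γ.Involution) (lam : I → ℕ) (gam : I → R)
  {β : Finset (Fin n → I)} (hβ : IsOrbit Θ.vert β)

theorem map_alphaA (φ : F ≃ₐ[R] F) (p q : I) (u v : F) :
    φ (alphaA Γ p q u v) = alphaA Γ p q (φ u) (φ v) := by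
  unfold alphaA; split_ifs <;> simp

theorem map_deltaA (φ : F ≃ₐ[R] F) (p q : I) : φ (deltaA p q) = deltaA p q := by
  unfold deltaA; split_ifs <;> simp

theorem map_alphaB (φ : F ≃ₐ[R] F) (p : I) (u : F) :
    φ (alphaB lam (fun i => algebraMap R F (gam i)) p u) =
      alphaB lam (fun i => algebraMap R F (gam i)) p (φ u) := by
  unfold alphaB; split_ifs <;> simp

theorem map_deltaB (φ : F ≃ₐ[R] F) (g : I → F) (p : I) : φ (deltaB g p) = deltaB g p := by
  unfold deltaB; split_ifs <;> simp

/-- The coefficients of the operators representing the `ψ_b`, transformed by `w`. -/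
noncomputable def coefAt (w : SignedPerm n) (j : Fin n → I) : Fin n → F
  | ⟨0, h⟩ => alphaB lam (fun i => algebraMap R F (gam i)) (extend Θ.vert j (w.1 (⟨0, h⟩, 1)))
      (extend Neg.neg S.x (w.1 (⟨0, h⟩, 1)))
  | ⟨a + 1, h⟩ => alphaA Γ (extend Θ.vert j (w.1 (⟨a, by omega⟩, 1)))
      (extend Θ.vert j (w.1 (⟨a + 1, h⟩, 1))) (extend Neg.neg S.x (w.1 (⟨a, by omega⟩, 1)))
      (extend Neg.neg S.x (w.1 (⟨a + 1, h⟩, 1)))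

/-- The indicator of the labels at which the operator representing `ψ_b` is a divided difference
operator, transformed by `w`. -/
noncomputable def diagAt (w : SignedPerm n) (j : Fin n → I) : Fin n → F
  | ⟨0, h⟩ => deltaB (fun i => algebraMap R F (gam i)) (extend Θ.vert j (w.1 (⟨0, h⟩, 1)))
  | ⟨a + 1, h⟩ => deltaA (extend Θ.vert j (w.1 (⟨a, by omega⟩, 1)))
      (extend Θ.vert j (w.1 (⟨a + 1, h⟩, 1)))

/-- Moving a coefficient past σ_w transforms its variables and its labels simultaneously; this is
the reason for the parameter w in `coefAt`. -/
theorem map_coefAt (w : SignedPerm n) (j : Fin n → I) (b : Fin n) :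
    S.s w (coefAt S Θ lam gam 1 (act Θ.vert w⁻¹ j) b) = coefAt S Θ lam gam w j b := by
  have hx : ∀ a, S.s w (extend Neg.neg S.x ((1 : SignedPerm n).1 (a, 1))) =
      extend Neg.neg S.x (w.1 (a, 1)) := fun a => by
    have h : extend Neg.neg S.x ((1 : SignedPerm n).1 (a, 1)) = S.x a := by simp [extend]
    rw [h, S.s_x]
  have hj : ∀ a, extend Θ.vert (act Θ.vert w⁻¹ j) ((1 : SignedPerm n).1 (a, 1)) =
      extend Θ.vert j (w.1 (a, 1)) := fun a => by
    rw [extend_act Θ.vert_involutive, inv_inv]; rfl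
  obtain ⟨_ | b, hb⟩ := b
  · rw [coefAt, coefAt, map_alphaB, hx, hj]
  · rw [coefAt, coefAt, map_alphaA, hx, hx, hj, hj]

theorem map_diagAt (φ : F ≃ₐ[R] F) (w : SignedPerm n) (j : Fin n → I) (b : Fin n) :
    φ (diagAt Θ gam 1 (act Θ.vert w⁻¹ j) b) = diagAt Θ gam w j b := by
  have hj : ∀ a, extend Θ.vert (act Θ.vert w⁻¹ j) ((1 : SignedPerm n).1 (a, 1)) =
      extend Θ.vert j (w.1 (a, 1)) := fun a => by
    rw [extend_act Θ.vert_involutive, inv_inv]; rfl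
  obtain ⟨_ | b, hb⟩ := b
  · rw [diagAt, diagAt, map_deltaB, hj]
  · rw [diagAt, diagAt, map_deltaA, hj, hj]

variable {Θ} in
theorem orbitAct_one (j : β) : orbitAct Θ hβ 1 j = j := Subtype.ext (act_one Θ.vert _)

variable {Θ} in
theorem orbitAct_mul (v w : SignedPerm n) (j : β) :
    orbitAct Θ hβ (v * w) j = orbitAct Θ hβ v (orbitAct Θ hβ w j) :=
  Subtype.ext (act_mul Θ.vert_involutive _ _ _)

variable {Θ} in
theorem orbitAct_eq_iff (w : SignedPerm n) (i j : β) :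
    orbitAct Θ hβ w⁻¹ j = i ↔ j = orbitAct Θ hβ w i := by
  constructor
  · rintro rfl; rw [← orbitAct_mul, mul_inv_cancel, orbitAct_one]
  · rintro rfl; rw [← orbitAct_mul, inv_mul_cancel, orbitAct_one]

variable {Θ}

/-- The action of `B_n` on families of elements of `F` indexed by an orbit. -/
noncomputable def sigma (w : SignedPerm n) (f : β → F) (j : β) : F :=
  S.s w (f (orbitAct Θ hβ w⁻¹ j))

theorem sigma_one (f : β → F) (j : β) : sigma S hβ 1 f j = f j := by
  simp [sigma, orbitAct_one]

theorem sigma_sigma (v w : SignedPerm n) (f : β → F) (j : β) :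
    sigma S hβ v (sigma S hβ w f) j = sigma S hβ (v * w) f j := by
  simp [sigma, orbitAct_mul]

/-- The operator representing `ψ_b`. -/
noncomputable def op (b : Fin n) : (β → F) →ₗ[R] (β → F) where
  toFun f j := coefAt S Θ lam gam 1 j.1 b * (sigma S hβ (r b) f j - diagAt Θ gam 1 j.1 b * f j)
  map_add' f g := by
    funext j
    simp only [sigma, Pi.add_apply, map_add]
    ring
  map_smul' c f := by
    funext j
    simp only [sigma, Pi.smul_apply, RingHom.id_apply, Algebra.smul_def, map_mul]
    simp
    ring

theorem op_apply (b : Fin n) (f : β → F) (j : β) :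
    op S lam gam hβ b f j =
      coefAt S Θ lam gam 1 j.1 b * (sigma S hβ (r b) f j - diagAt Θ gam 1 j.1 b * f j) := rfl

/-- Iterating this rule expands any product of the operators as a combination of the σ_v. -/
theorem sigma_op (w : SignedPerm n) (b : Fin n) (f : β → F) (j : β) :
    sigma S hβ w (op S lam gam hβ b f) j = coefAt S Θ lam gam w j.1 b *
      (sigma S hβ (w * r b) f j - diagAt Θ gam w j.1 b * sigma S hβ w f j) := by
  rw [← sigma_sigma, sigma, op_apply, map_mul, map_sub, map_mul]
  congr 1
  · exact map_coefAt S Θ lam gam w j.1 b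
  · congr 2
    exact map_diagAt Θ gam _ w j.1 b

/-- The diagonal term of ψ_b keeps the component, whereas the reflection moves it by r_b. Both are
compatible with ψ_b e(i) = e(r_b · i) ψ_b because the diagonal term occurs only at components fixed
by r_b. -/
theorem diagAt_ne_zero {gam : I → R} (hgam : ∀ i, Θ.vert i ≠ i → gam i = 0) {b : Fin n} {j : β}
    (h : (diagAt Θ gam 1 j.1 b : F) ≠ 0) : orbitAct Θ hβ (r b) j = j := by
  apply Subtype.ext
  obtain ⟨_ | b, hb⟩ := b
  · have h1 : Θ.vert (j.1 ⟨0, hb⟩) = j.1 ⟨0, hb⟩ := by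
      by_contra h'
      exact h (by simp [diagAt, deltaB, extend, hgam _ h'])
    exact (act_r_zero Θ.vert hb j.1).trans (by rw [h1]; exact Function.update_eq_self _ _)
  · have h1 : j.1 ⟨b, by omega⟩ = j.1 ⟨b + 1, hb⟩ := by
      by_contra h'
      exact h (by simp [diagAt, deltaA, extend, h'])
    refine (act_r_succ Θ.vert hb j.1).trans ?_
    funext c
    simp only [Function.comp_apply, Equiv.swap_apply_def]
    split_ifs with h2 h3
    · rw [h2, h1]
    · rw [h3, h1]
    · rfl

/-- The projection to the component indexed by `i`. -/
noncomputable def proj (i : β) : (β → F) →ₗ[R] (β → F) where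
  toFun f j := open scoped Classical in if j = i then f j else 0
  map_add' f g := by
    funext j
    simp only [Pi.add_apply]
    split_ifs <;> simp
  map_smul' c f := by
    funext j
    simp only [Pi.smul_apply, RingHom.id_apply]
    split_ifs <;> simp

open scoped Classical in
theorem proj_apply (i : β) (f : β → F) (j : β) :
    (proj i : (β → F) →ₗ[R] (β → F)) f j = if j = i then f j else 0 := by
  simp only [proj, LinearMap.coe_mk, AddHom.coe_mk]

theorem op_proj {gam : I → R} (hgam : ∀ i, Θ.vert i ≠ i → gam i = 0) (b : Fin n) (i : β)
    (f : β → F) :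
    op S lam gam hβ b ((proj i : _ →ₗ[R] _) f) =
      (proj (orbitAct Θ hβ (r b) i) : _ →ₗ[R] _) (op S lam gam hβ b f) := by
  classical
  funext j
  rw [op_apply, proj_apply, proj_apply, sigma, proj_apply, op_apply, sigma]
  simp only [orbitAct_eq_iff]
  by_cases hd : (diagAt Θ gam 1 j.1 b : F) = 0
  · rw [hd]
    split_ifs <;> simp
  · have hj : j = i ↔ j = orbitAct Θ hβ (r b) i := by
      have := diagAt_ne_zero hβ hgam hd
      rw [← orbitAct_eq_iff, r_inv, this]
    simp only [hj]
    split_ifs <;> simp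

/-- The homomorphism from the free algebra to the endomorphisms of `F^β` given by the polynomial
representation. -/
noncomputable def polyRep : FreeAlgebra R (Gen β) →ₐ[R] Module.End R (β → F) :=
  FreeAlgebra.lift R fun
    | Gen.y a => Algebra.lsmul R R (β → F) (S.x a)
    | Gen.psi b => op S lam gam hβ b
    | Gen.e i => proj i

theorem polyRep_y (a : Fin n) (f : β → F) (j : β) :
    polyRep S lam gam hβ (fy R β a) f j = S.x a * f j := by
  simp [polyRep, fy]

theorem polyRep_psi (b : Fin n) : polyRep S lam gam hβ (fpsi R β b) = op S lam gam hβ b := by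
  simp [polyRep, fpsi]

theorem polyRep_e (i : β) : polyRep S lam gam hβ (fe R β i) = proj i := by
  simp [polyRep, fe]

theorem polyRep_fpoly (p : MvPolynomial (Fin n) R) (f : β → F) (j : β) :
    polyRep S lam gam hβ (fpoly R β p) f j = aeval S.x p * f j := by
  rw [map_fpoly (polyRep S lam gam hβ) ((Algebra.lsmul R R (β → F)).comp (aeval S.x))]
  · simp
  · intro a
    simp [polyRep, fy]

theorem aeval_Qval (p q : I) (P Q : MvPolynomial (Fin n) R) :
    aeval S.x (Qval Γ p q P Q) = qVal Γ p q (aeval S.x P) (aeval S.x Q) := by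
  by_cases h : p = q
  · subst h; simp [Qval_self, qVal]
  · simp [Qval_eq Γ h, qVal, h]

end Representation

end InterpolatingKLR

namespace InterpolatingKLR

open MvPolynomial

/-! ### The braid relations for the operators. -/

section Relations

variable {I A R F : Type*} [CommRing R] [Field F] [Algebra R F] {n : ℕ} (S : SignedField R F n)
  {Γ : LoopFreeQuiver I A} {Θ : Γ.Involution} (lam : I → ℕ) (gam : I → R)
  {β : Finset (Fin n → I)} (hβ : IsOrbit Θ.vert β)

theorem SignedPerm.mul_apply (v w : SignedPerm n) (x : Fin n × ℤˣ) :
    (v * w).1 x = v.1 (w.1 x) := rfl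

theorem mul_r_mul_r_cancel (w : SignedPerm n) (b : Fin n) : w * r b * r b = w := by
  rw [mul_assoc, r_mul_self, mul_one]

theorem r_succ_apply_left (a : ℕ) (h : a + 1 < n) (s : ℤˣ) :
    (r ⟨a + 1, h⟩).1 (⟨a, by omega⟩, s) = (⟨a + 1, h⟩, s) := by
  rw [r_succ_apply]; simp

theorem r_succ_apply_right (a : ℕ) (h : a + 1 < n) (s : ℤˣ) :
    (r ⟨a + 1, h⟩).1 (⟨a + 1, h⟩, s) = (⟨a, by omega⟩, s) := by
  rw [r_succ_apply]; simp

theorem r_succ_apply_other (a : ℕ) (h : a + 1 < n) {c : Fin n} (h1 : c.1 ≠ a) (h2 : c.1 ≠ a + 1)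
    (s : ℤˣ) : (r ⟨a + 1, h⟩).1 (c, s) = (c, s) := by
  rw [r_succ_apply]
  simp only
  rw [Equiv.swap_apply_of_ne_of_ne (by simpa [Fin.ext_iff]) (by simpa [Fin.ext_iff])]

theorem r_zero_apply_zero (h : 0 < n) (s : ℤˣ) :
    (r ⟨0, h⟩).1 (⟨0, h⟩, s) = (⟨0, h⟩, -s) := by
  rw [r_zero_apply]; simp [negPt]

theorem r_zero_apply_other (h : 0 < n) {c : Fin n} (h1 : c.1 ≠ 0) (s : ℤˣ) :
    (r ⟨0, h⟩).1 (c, s) = (c, s) := by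
  rw [r_zero_apply, if_neg]
  simpa [Fin.ext_iff]

theorem extend_pos {J : Type*} (θ : J → J) (i : Fin n → J) (a : Fin n) :
    extend θ i (a, 1) = i a := by simp [extend]

theorem extend_neg {J : Type*} (θ : J → J) (i : Fin n → J) (a : Fin n) :
    extend θ i (a, -1) = θ (i a) := by simp [extend]

theorem SignedPerm.one_apply (x : Fin n × ℤˣ) : (1 : SignedPerm n).1 x = x := rfl

open scoped Classical in
theorem op_braid3 (b : ℕ) (hb : b + 2 < n) (f : β → F) (k : β) :
    op S lam gam hβ ⟨b + 2, hb⟩ (op S lam gam hβ ⟨b + 1, by omega⟩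
        (op S lam gam hβ ⟨b + 2, hb⟩ f)) k -
      op S lam gam hβ ⟨b + 1, by omega⟩ (op S lam gam hβ ⟨b + 2, hb⟩
        (op S lam gam hβ ⟨b + 1, by omega⟩ f)) k =
    (if k.1 ⟨b, by omega⟩ = k.1 ⟨b + 2, hb⟩ then
      (qVal Γ (k.1 ⟨b, by omega⟩) (k.1 ⟨b + 1, by omega⟩) (S.x ⟨b, by omega⟩)
          (S.x ⟨b + 1, by omega⟩)
        - qVal Γ (k.1 ⟨b, by omega⟩) (k.1 ⟨b + 1, by omega⟩) (S.x ⟨b + 2, hb⟩)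
          (S.x ⟨b + 1, by omega⟩)) / (S.x ⟨b, by omega⟩ - S.x ⟨b + 2, hb⟩)
      else 0) * f k := by
  have e1 := r_succ_apply_left (n := n) b (by omega)
  have e2 := r_succ_apply_right (n := n) b (by omega)
  have e3 := r_succ_apply_other (n := n) b (by omega) (c := ⟨b + 2, hb⟩) (by simp) (by simp)
  have e4 := r_succ_apply_left (n := n) (b + 1) hb
  have e5 := r_succ_apply_right (n := n) (b + 1) hb
  have e6 := r_succ_apply_other (n := n) (b + 1) hb (c := ⟨b, by omega⟩) (by simp)
    (by simp only; omega)
  have hr := r_braid3 b hb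
  rw [← mul_assoc] at hr
  simp only [op_apply, sigma_op, r_mul_self, sigma_one, coefAt, diagAt,
    SignedPerm.mul_apply, SignedPerm.one_apply, e1, e2, e3, e4, e5, e6, extend_pos, hr]
  have h1 : S.x ⟨b, by omega⟩ - S.x ⟨b + 1, by omega⟩ ≠ 0 := S.sub_ne _ _ (by simp)
  have h2 : S.x ⟨b, by omega⟩ - S.x ⟨b + 2, hb⟩ ≠ 0 := S.sub_ne _ _ (by simp)
  have h3 : S.x ⟨b + 1, by omega⟩ - S.x ⟨b + 2, hb⟩ ≠ 0 := S.sub_ne _ _ (by simp)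
  apply braid3_identity <;> assumption

open scoped Classical in
theorem op_braid4 (hgam : ∀ i, Θ.vert i ≠ i → gam i = 0)
    (hstrong : ∀ i, gam i = 0 → Θ.vert i ≠ i ∨ lam i + lam (Θ.vert i) = 0)
    (h : 1 < n) (f : β → F) (k : β) {p q : I} (hp : k.1 ⟨0, by omega⟩ = p)
    (hq : k.1 ⟨1, h⟩ = q) {u v : F} (hu : S.x ⟨0, by omega⟩ = u) (hv : S.x ⟨1, h⟩ = v) :
    op S lam gam hβ ⟨0, by omega⟩ (op S lam gam hβ ⟨1, h⟩ (op S lam gam hβ ⟨0, by omega⟩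
        (op S lam gam hβ ⟨1, h⟩ f))) k -
      op S lam gam hβ ⟨1, h⟩ (op S lam gam hβ ⟨0, by omega⟩ (op S lam gam hβ ⟨1, h⟩
        (op S lam gam hβ ⟨0, by omega⟩ f))) k =
    if gam p = 0 then
      if Θ.vert p = q then
        (-1) ^ lam p * (((-u) ^ (lam q + lam p) - v ^ (lam q + lam p)) / (u + v)) *
          op S lam gam hβ ⟨1, h⟩ f k
      else
        algebraMap R F (gam q) *
          ((qVal Γ q (Θ.vert p) u (-v) - qVal Γ q (Θ.vert p) u v) / v *
            op S lam gam hβ ⟨0, by omega⟩ f k)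
    else
      algebraMap R F (gam q) * ((qVal Γ q p u (-v) - qVal Γ q p u v) / (u * v)) *
        (u * op S lam gam hβ ⟨0, by omega⟩ f k - algebraMap R F (gam p) * f k) := by
  have e1 := r_succ_apply_left (n := n) 0 h
  have e2 := r_succ_apply_right (n := n) 0 h
  have e3 := r_zero_apply_zero (n := n) (by omega)
  have e4 := r_zero_apply_other (n := n) (by omega) (c := ⟨1, h⟩) (by simp)
  have hr := r_braid4 h
  rw [← mul_assoc, ← mul_assoc] at hr
  simp only [zero_add] at e1 e2
  have ha : ∀ i, algebraMap R F (gam i) = 0 ↔ gam i = 0 := fun i =>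
    map_eq_zero_iff _ S.inj
  -- After expansion by `sigma_op`, only the eight values of the σ_v f at k remain; they are
  -- substituted for the unknowns of the identity.
  have key := braid4_identity (F := F) (Γ := Γ) Θ.vert_involutive lam
    (fun i => algebraMap R F (gam i)) (arrows_theta Θ) (fun i hi => by simp [hgam i hi])
    (fun i hi => hstrong i ((ha i).1 hi)) p q u v (f k) (sigma S hβ (r ⟨0, by omega⟩) f k)
    (sigma S hβ (r ⟨1, h⟩) f k) (sigma S hβ (r ⟨0, by omega⟩ * r ⟨1, h⟩) f k)
    (sigma S hβ (r ⟨1, h⟩ * r ⟨0, by omega⟩) f k)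
    (sigma S hβ (r ⟨0, by omega⟩ * r ⟨1, h⟩ * r ⟨0, by omega⟩) f k)
    (sigma S hβ (r ⟨1, h⟩ * r ⟨0, by omega⟩ * r ⟨1, h⟩) f k)
    (sigma S hβ (r ⟨1, h⟩ * r ⟨0, by omega⟩ * r ⟨1, h⟩ * r ⟨0, by omega⟩) f k)
    (hu ▸ S.x_ne _) (hv ▸ S.x_ne _) (hu ▸ hv ▸ S.sub_ne _ _ (by simp))
    (hu ▸ hv ▸ S.add_ne _ _)
  simp only [op_apply, sigma_op, mul_r_mul_r_cancel, r_mul_self, sigma_one, coefAt, diagAt,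
    SignedPerm.mul_apply, SignedPerm.one_apply, e1, e2, e3, e4, extend_pos, extend_neg, hr, hp, hq, hu, hv]
  simp only [ha] at key
  refine Eq.trans ?_ (key.trans ?_)
  · congr
  · split_ifs <;> ring

end Relations

end InterpolatingKLR

namespace InterpolatingKLR

open MvPolynomial

/-! ### Verification of all defining relations in the polynomial representation. -/

section Relations

variable {I A R F : Type*} [CommRing R] [Field F] [Algebra R F] {n : ℕ} (S : SignedField R F n)
  {Γ : LoopFreeQuiver I A} {Θ : Γ.Involution} (lam : I → ℕ) (gam : I → R)
  {β : Finset (Fin n → I)} (hβ : IsOrbit Θ.vert β)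

theorem sigma_mul (w : SignedPerm n) (a : Fin n) (f : β → F) (j : β) :
    sigma S hβ w (fun j => S.x a * f j) j = extend Neg.neg S.x (w.1 (a, 1)) * sigma S hβ w f j := by
  rw [sigma, map_mul, S.s_x]; rfl

/-- The reflection terms cancel in the twisted commutator. Only the diagonal term contributes, and
it does so only if r_b moves x_a. -/
theorem op_mul (b a : Fin n) (f : β → F) (j : β) :
    op S lam gam hβ b (fun j => S.x a * f j) j - extend Neg.neg S.x ((r b).1 (a, 1)) *
      op S lam gam hβ b f j =
    coefAt S Θ lam gam 1 j.1 b * diagAt Θ gam 1 j.1 b *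
      (extend Neg.neg S.x ((r b).1 (a, 1)) - S.x a) * f j := by
  rw [op_apply, op_apply, sigma_mul]
  ring

theorem op_op_succ (b : ℕ) (hb : b + 1 < n) (f : β → F) (j : β) :
    op S lam gam hβ ⟨b + 1, hb⟩ (op S lam gam hβ ⟨b + 1, hb⟩ f) j =
      qVal Γ (j.1 ⟨b, by omega⟩) (j.1 ⟨b + 1, hb⟩) (S.x ⟨b, by omega⟩) (S.x ⟨b + 1, hb⟩) * f j := by
  have e1 := r_succ_apply_left (n := n) b (by omega)
  have e2 := r_succ_apply_right (n := n) b (by omega)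
  have hne : S.x ⟨b, by omega⟩ - S.x ⟨b + 1, hb⟩ ≠ 0 := S.sub_ne _ _ (by simp)
  have hne' : S.x ⟨b + 1, hb⟩ - S.x ⟨b, by omega⟩ ≠ 0 := S.sub_ne _ _ (by simp)
  simp only [op_apply, sigma_op, r_mul_self, sigma_one, coefAt, diagAt,
    SignedPerm.one_apply, e1, e2, extend_pos]
  by_cases h : j.1 ⟨b, by omega⟩ = j.1 ⟨b + 1, hb⟩
  · simp only [alphaA, deltaA, qVal, h, if_true]
    field_simp
    ring
  · simp only [alphaA, deltaA, qVal, h, Ne.symm h, if_false, LoopFreeQuiver.dot, pow_add]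
    rw [sub_pow_comm (S.x ⟨b, by omega⟩) (S.x ⟨b + 1, hb⟩)]
    ring

open scoped Classical in
theorem op_op_zero (hgam : ∀ i, Θ.vert i ≠ i → gam i = 0) (h : 0 < n) (f : β → F) (j : β) :
    op S lam gam hβ ⟨0, h⟩ (op S lam gam hβ ⟨0, h⟩ f) j =
      (if gam (j.1 ⟨0, h⟩) = 0 then (-1) ^ lam (Θ.vert (j.1 ⟨0, h⟩)) *
        S.x ⟨0, h⟩ ^ (lam (j.1 ⟨0, h⟩) + lam (Θ.vert (j.1 ⟨0, h⟩))) else 0) * f j := by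
  have e := r_zero_apply_zero (n := n) h
  have hx := S.x_ne ⟨0, h⟩
  have ha : ∀ i, algebraMap R F (gam i) = 0 ↔ gam i = 0 := fun i =>
    map_eq_zero_iff _ S.inj
  simp only [op_apply, sigma_op, r_mul_self, sigma_one, coefAt, diagAt,
    SignedPerm.one_apply, e, extend_pos, extend_neg, alphaB, deltaB, ha]
  generalize j.1 ⟨0, h⟩ = p
  by_cases hp : gam p = 0
  · have hp' : gam (Θ.vert p) = 0 := by
      by_cases h' : Θ.vert p = p
      · rwa [h']
      · exact hgam _ fun h'' => h' (by rwa [Θ.vert_involutive, eq_comm] at h'')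
    simp only [hp, hp', if_true, neg_pow (S.x _), pow_add]
    ring
  · have hp' : Θ.vert p = p := by_contra fun h' => hp (hgam p h')
    simp only [hp, hp', if_false]
    field_simp
    ring

theorem op_comm {a b : Fin n} (hab : a.1 + 1 < b.1) (f : β → F) (j : β) :
    op S lam gam hβ a (op S lam gam hβ b f) j = op S lam gam hβ b (op S lam gam hβ a f) j := by
  obtain ⟨_ | b, hb⟩ := b
  · simp at hab
  have e1 := r_succ_apply_other (n := n) b (by omega) (c := a) (by simp only at hab; omega)
    (by simp only at hab; omega)
  have hc := r_comm hab
  obtain ⟨_ | a, ha⟩ := a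
  · have e2 := r_zero_apply_other ha (c := ⟨b, by omega⟩) (by simp only at hab ⊢; omega)
    have e3 := r_zero_apply_other ha (c := ⟨b + 1, hb⟩) (by simp only at hab ⊢; omega)
    simp only [op_apply, sigma_op, coefAt, diagAt, SignedPerm.one_apply, e1, e2, e3, hc]
    ring
  · have e1' := r_succ_apply_other (n := n) b (by omega) (c := ⟨a, by omega⟩)
      (by simp only at hab ⊢; omega) (by simp only at hab ⊢; omega)
    have e2 := r_succ_apply_other a ha (c := ⟨b, by omega⟩) (by simp only at hab ⊢; omega)
      (by simp only at hab ⊢; omega)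
    have e3 := r_succ_apply_other a ha (c := ⟨b + 1, hb⟩) (by simp only at hab ⊢; omega)
      (by simp only at hab ⊢; omega)
    simp only [op_apply, sigma_op, coefAt, diagAt, SignedPerm.one_apply, e1, e1', e2, e3, hc]
    ring

theorem neg_one_pow_end_apply (m : ℕ) (f : β → F) (j : β) :
    (((-1) ^ m : Module.End R (β → F))) f j = (-1) ^ m * f j := by
  induction m with
  | zero => rw [pow_zero, pow_zero, Module.End.one_apply, one_mul]
  | succ m ih =>
    rw [pow_succ', Module.End.mul_apply, LinearMap.neg_apply, Module.End.one_apply, Pi.neg_apply,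
      ih, pow_succ', neg_one_mul, neg_mul]

theorem polyRep_y_apply (a : Fin n) (f : β → F) :
    polyRep S lam gam hβ (fy R β a) f = fun j => S.x a * f j :=
  funext fun j => polyRep_y S lam gam hβ a f j

variable {gam}

theorem gam_vert (hgam : ∀ i, Θ.vert i ≠ i → gam i = 0) {p : I} (hp : gam p = 0) :
    gam (Θ.vert p) = 0 := by
  by_cases h' : Θ.vert p = p
  · rwa [h']
  · exact hgam _ fun h'' => h' (by rwa [Θ.vert_involutive, eq_comm] at h'')

theorem orbitAct_braid4_apply (h : 1 < n) (i : β) (c : Fin n) :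
    (orbitAct Θ hβ (r ⟨0, by omega⟩ * r ⟨1, h⟩ * r ⟨0, by omega⟩ * r ⟨1, h⟩) i).1 c =
      if c.1 ≤ 1 then Θ.vert (i.1 c) else i.1 c := by
  have e1 := r_succ_apply_left (n := n) 0 h
  have e2 := r_succ_apply_right (n := n) 0 h
  have e3 := r_zero_apply_zero (n := n) (by omega)
  have e4 := r_zero_apply_other (n := n) (by omega) (c := ⟨1, h⟩) (by simp)
  simp only [zero_add] at e1 e2
  change extend Θ.vert i.1 _ = _
  simp only [mul_inv_rev, r_inv, SignedPerm.mul_apply]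
  obtain ⟨_ | _ | c, hc⟩ := c
  · simp [e1, e2, e3, e4, extend]
  · simp [e1, e2, e3, e4, extend]
  · have e5 := r_zero_apply_other (n := n) (by omega) (c := ⟨c + 2, hc⟩) (by simp)
    have e6 := r_succ_apply_other 0 h (c := ⟨c + 2, hc⟩) (by simp) (by simp)
    simp only [zero_add] at e6
    simp [e5, e6, extend]

-- Both products of length four send the component i to its image under the longest element of the
-- dihedral group, whose first two labels are θ(i_1) and θ(i_2). There `op_braid4` applies, with f
-- in place of its projection.
open scoped Classical in
theorem op_braid4_proj (hgam : ∀ i, Θ.vert i ≠ i → gam i = 0)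
    (hstrong : ∀ i, gam i = 0 → Θ.vert i ≠ i ∨ lam i + lam (Θ.vert i) = 0)
    (h : 1 < n) (f : β → F) (i j : β) :
    op S lam gam hβ ⟨0, by omega⟩ (op S lam gam hβ ⟨1, h⟩ (op S lam gam hβ ⟨0, by omega⟩
        (op S lam gam hβ ⟨1, h⟩ ((proj i : _ →ₗ[R] _) f)))) j -
      op S lam gam hβ ⟨1, h⟩ (op S lam gam hβ ⟨0, by omega⟩ (op S lam gam hβ ⟨1, h⟩
        (op S lam gam hβ ⟨0, by omega⟩ ((proj i : _ →ₗ[R] _) f)))) j =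
    if j = orbitAct Θ hβ (r ⟨0, by omega⟩ * r ⟨1, h⟩ * r ⟨0, by omega⟩ * r ⟨1, h⟩) i then
    if gam (Θ.vert (i.1 ⟨0, by omega⟩)) = 0 then
      if i.1 ⟨0, by omega⟩ = Θ.vert (i.1 ⟨1, h⟩) then
        (-1) ^ lam (Θ.vert (i.1 ⟨0, by omega⟩)) *
          (((-S.x ⟨0, by omega⟩) ^ (lam (Θ.vert (i.1 ⟨1, h⟩)) + lam (Θ.vert (i.1 ⟨0, by omega⟩))) -
            S.x ⟨1, h⟩ ^ (lam (Θ.vert (i.1 ⟨1, h⟩)) + lam (Θ.vert (i.1 ⟨0, by omega⟩)))) /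
              (S.x ⟨0, by omega⟩ + S.x ⟨1, h⟩)) *
          op S lam gam hβ ⟨1, h⟩ f j
      else
        algebraMap R F (gam (Θ.vert (i.1 ⟨1, h⟩))) *
          ((qVal Γ (Θ.vert (i.1 ⟨1, h⟩)) (i.1 ⟨0, by omega⟩) (S.x ⟨0, by omega⟩) (-S.x ⟨1, h⟩) -
            qVal Γ (Θ.vert (i.1 ⟨1, h⟩)) (i.1 ⟨0, by omega⟩) (S.x ⟨0, by omega⟩) (S.x ⟨1, h⟩)) /
              S.x ⟨1, h⟩ * op S lam gam hβ ⟨0, by omega⟩ f j)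
    else
      algebraMap R F (gam (Θ.vert (i.1 ⟨1, h⟩))) *
        ((qVal Γ (Θ.vert (i.1 ⟨1, h⟩)) (Θ.vert (i.1 ⟨0, by omega⟩)) (S.x ⟨0, by omega⟩)
            (-S.x ⟨1, h⟩) -
          qVal Γ (Θ.vert (i.1 ⟨1, h⟩)) (Θ.vert (i.1 ⟨0, by omega⟩)) (S.x ⟨0, by omega⟩)
            (S.x ⟨1, h⟩)) / (S.x ⟨0, by omega⟩ * S.x ⟨1, h⟩)) *
        (S.x ⟨0, by omega⟩ * op S lam gam hβ ⟨0, by omega⟩ f j -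
          algebraMap R F (gam (Θ.vert (i.1 ⟨0, by omega⟩))) * f j)
    else 0 := by
  have hr := r_braid4 h
  rw [← mul_assoc, ← mul_assoc] at hr
  simp only [op_proj S lam hβ hgam, ← orbitAct_mul, ← mul_assoc, ← hr]
  simp only [proj_apply]
  by_cases hj : j = orbitAct Θ hβ (r ⟨0, by omega⟩ * r ⟨1, h⟩ * r ⟨0, by omega⟩ * r ⟨1, h⟩) i
  · rw [if_pos hj, if_pos hj, if_pos hj]
    rw [op_braid4 S lam gam hβ hgam hstrong h f j (p := Θ.vert (i.1 ⟨0, by omega⟩))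
      (q := Θ.vert (i.1 ⟨1, h⟩)) (by rw [hj, orbitAct_braid4_apply]; simp)
      (by rw [hj, orbitAct_braid4_apply]; simp) rfl rfl, Θ.vert_involutive]
    simp only [mul_assoc]
  · simp only [hj, if_false, sub_zero]

theorem isModel_polyRep (hgam : ∀ i, Θ.vert i ≠ i → gam i = 0)
    (hstrong : ∀ i, gam i = 0 → Θ.vert i ≠ i ∨ lam i + lam (Θ.vert i) = 0) :
    IsModel Θ lam gam (polyRep S lam gam hβ) := by
  classical
  have ha : ∀ i, algebraMap R F (gam i) = 0 ↔ gam i = 0 := fun i =>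
    map_eq_zero_iff _ S.inj
  intro x y hxy
  refine LinearMap.ext fun f => funext fun j => ?_
  cases hxy with
  | sum_e =>
    simp only [map_sum, polyRep_e, LinearMap.sum_apply, Finset.sum_apply, proj_apply, map_one]
    simp
  | e_mul_self i =>
    simp only [map_mul, polyRep_e, Module.End.mul_apply, proj_apply]
    split_ifs <;> rfl
  | e_mul_of_ne i k hik =>
    simp only [map_mul, polyRep_e, Module.End.mul_apply, proj_apply, map_zero]
    split_ifs with h1 h2
    · exact absurd (h1.symm.trans h2) hik
    all_goals rfl
  | y_comm a b => simp only [map_mul, Module.End.mul_apply, polyRep_y, mul_left_comm]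
  | y_e a i =>
    simp only [map_mul, Module.End.mul_apply, polyRep_y, polyRep_e, proj_apply]
    split_ifs <;> simp
  | psi_e b i k hk =>
    have : k = orbitAct Θ hβ (r b) i := Subtype.ext hk
    simp only [map_mul, polyRep_e, polyRep_psi, Module.End.mul_apply, op_proj S lam hβ hgam, this]
  | psi_y_left a ha i hi =>
    have h := op_mul S lam gam hβ ⟨a + 1, ha⟩ ⟨a, by omega⟩ ((proj i : _ →ₗ[R] _) f) j
    have hne : S.x ⟨a, by omega⟩ - S.x ⟨a + 1, ha⟩ ≠ 0 := S.sub_ne _ _ (by simp)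
    simp only [r_succ_apply_left a ha, extend_pos] at h
    simp only [map_mul, map_sub, map_neg, polyRep_psi, polyRep_y_apply, polyRep_e,
      Module.End.mul_apply, LinearMap.sub_apply, Pi.sub_apply, LinearMap.neg_apply, Pi.neg_apply]
    rw [h, proj_apply]
    split_ifs with hj
    · subst hj
      simp only [coefAt, diagAt, SignedPerm.one_apply, extend_pos, alphaA, deltaA, hi, if_true]
      field_simp
      ring
    · simp
  | psi_y_right a ha i hi =>
    have h := op_mul S lam gam hβ ⟨a + 1, ha⟩ ⟨a + 1, ha⟩ ((proj i : _ →ₗ[R] _) f) j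
    have hne : S.x ⟨a, by omega⟩ - S.x ⟨a + 1, ha⟩ ≠ 0 := S.sub_ne _ _ (by simp)
    simp only [r_succ_apply_right a ha, extend_pos] at h
    simp only [map_mul, map_sub, polyRep_psi, polyRep_y_apply, polyRep_e,
      Module.End.mul_apply, LinearMap.sub_apply, Pi.sub_apply]
    rw [h, proj_apply]
    split_ifs with hj
    · subst hj
      simp only [coefAt, diagAt, SignedPerm.one_apply, extend_pos, alphaA, deltaA, hi, if_true]
      field_simp
    · simp
  | psi_y_other a ha b i hb =>
    have h := op_mul S lam gam hβ ⟨a + 1, ha⟩ b ((proj i : _ →ₗ[R] _) f) j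
    simp only [r_succ_apply a ha, extend_pos] at h
    simp only [map_mul, map_sub, polyRep_psi, polyRep_y_apply, polyRep_e, map_zero,
      Module.End.mul_apply, LinearMap.sub_apply, Pi.sub_apply, LinearMap.zero_apply, Pi.zero_apply]
    rw [h, proj_apply]
    split_ifs with hj
    · subst hj
      rw [not_and_or] at hb
      rcases hb with hb | hb
      · rw [not_or] at hb
        rw [Equiv.swap_apply_of_ne_of_ne hb.1 hb.2]
        simp
      · simp [diagAt, extend_pos, deltaA, hb]
    · simp
  | psi_comm a b hab =>
    simp only [map_mul, polyRep_psi, Module.End.mul_apply, op_comm S lam gam hβ hab]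
  | psi_sq a ha i =>
    simp only [map_mul, polyRep_psi, polyRep_e, Module.End.mul_apply, op_op_succ, pow_two,
      polyRep_fpoly, aeval_Qval, proj_apply, aeval_X]
    split_ifs with h
    · rw [h]
    · simp
  | braid3_eq b hb i hi p hp =>
    have hne : S.x ⟨b, by omega⟩ - S.x ⟨b + 2, hb⟩ ≠ 0 := S.sub_ne _ _ (by simp)
    -- The polynomial p is given only through its defining equation; in F the value of p is
    -- recovered by division.
    apply_fun aeval S.x at hp
    simp only [map_mul, map_sub, aeval_Qval, aeval_X] at hp
    simp only [map_mul, map_sub, polyRep_psi, polyRep_e, polyRep_fpoly,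
      Module.End.mul_apply, LinearMap.sub_apply, Pi.sub_apply]
    rw [op_braid3, proj_apply]
    split_ifs with h1 h2
    · subst h2
      rw [← hp, mul_div_cancel_left₀ _ hne]
    · simp
    · subst_vars
      exact absurd hi h1
    · simp
  | braid3_ne b hb i hi =>
    simp only [map_mul, map_sub, map_zero, polyRep_psi, polyRep_e, LinearMap.zero_apply,
      Pi.zero_apply, Module.End.mul_apply, LinearMap.sub_apply, Pi.sub_apply]
    rw [op_braid3, proj_apply]
    split_ifs with h1 h2
    · exact absurd (h2 ▸ h1) hi
    all_goals simp
  | psi0_y1 h i =>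
    have h1 := op_mul S lam gam hβ ⟨0, h⟩ ⟨0, h⟩ ((proj i : _ →ₗ[R] _) f) j
    have hne := S.x_ne ⟨0, h⟩
    simp only [r_zero_apply_zero, extend_neg, neg_mul, sub_neg_eq_add] at h1
    simp only [map_mul, map_add, map_smul, polyRep_psi, polyRep_y_apply, polyRep_e,
      Module.End.mul_apply, LinearMap.add_apply, Pi.add_apply, LinearMap.smul_apply,
      Pi.smul_apply]
    rw [h1, proj_apply, Algebra.smul_def]
    split_ifs with hj
    · subst hj
      simp only [coefAt, diagAt, SignedPerm.one_apply, extend_pos, alphaB, deltaB, ha]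
      split_ifs with h2
      · simp [h2]
      · simp only [map_mul, map_ofNat]
        field_simp
        ring
    · simp
  | psi0_y h a ha =>
    have h1 := op_mul S lam gam hβ ⟨0, h⟩ a f j
    simp only [r_zero_apply_other h (c := a) (by omega), extend_pos, sub_self, mul_zero,
      zero_mul, sub_eq_zero] at h1
    simp only [map_mul, polyRep_psi, polyRep_y_apply, Module.End.mul_apply]
    exact h1
  | psi0_sq_zero h i hi =>
    have hy : ∀ (m : ℕ) (f : β → F) (j : β),
        ((polyRep S lam gam hβ (fy R β ⟨0, h⟩)) ^ m) f j = S.x ⟨0, h⟩ ^ m * f j := by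
      intro m
      induction m with
      | zero => simp
      | succ m ih =>
        intro f j
        rw [pow_succ, Module.End.mul_apply, ih, polyRep_y, pow_succ, mul_assoc]
    rw [pow_two]
    simp only [map_mul, map_pow, map_neg, map_one, polyRep_psi, polyRep_e, Module.End.mul_apply,
      op_op_zero S lam gam hβ hgam, hy, neg_one_pow_end_apply, proj_apply]
    split_ifs with h1 h2
    · subst h2
      ring
    · simp
    · subst_vars
      exact absurd hi h1
    · simp
  | psi0_sq_ne h i hi =>
    simp only [map_mul, polyRep_psi, polyRep_e, Module.End.mul_apply, op_op_zero S lam gam hβ hgam,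
      pow_two, proj_apply, map_zero, LinearMap.zero_apply, Pi.zero_apply]
    split_ifs with h1 h2
    · exact absurd (h2 ▸ h1) hi
    all_goals simp
  | braid4_theta h i hi hi' p hp =>
    have hne : S.x ⟨0, by omega⟩ + S.x ⟨1, h⟩ ≠ 0 := S.add_ne _ _
    apply_fun aeval S.x at hp
    simp only [map_mul, map_sub, map_add, map_pow, map_neg, aeval_X] at hp
    simp only [pow_two (_ * _)]
    simp only [map_mul, map_sub, map_pow, map_neg, map_one, polyRep_psi, polyRep_e, polyRep_fpoly,
      neg_one_pow_end_apply, Module.End.mul_apply, LinearMap.sub_apply, Pi.sub_apply]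
    rw [op_braid4_proj S lam hβ hgam hstrong, op_proj S lam hβ hgam, proj_apply]
    have h2 : Θ.vert (i.1 ⟨1, h⟩) = i.1 ⟨0, by omega⟩ := by rw [← hi', Θ.vert_involutive]
    -- As θ exchanges i_1 and i_2, the term ψ_1 e(i) lands in the same component as the two products
    -- of length four.
    have h1 : orbitAct Θ hβ (r ⟨1, h⟩) i =
        orbitAct Θ hβ (r ⟨0, by omega⟩ * r ⟨1, h⟩ * r ⟨0, by omega⟩ * r ⟨1, h⟩) i := by
      refine Subtype.ext (funext fun c => ?_)
      rw [orbitAct_braid4_apply]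
      refine (congrFun (act_r_succ Θ.vert (a := 0) h i.1) c).trans ?_
      obtain ⟨_ | _ | c, hc⟩ := c
      · simp [hi']
      · simp [h2]
      · rw [Function.comp_apply, Equiv.swap_apply_of_ne_of_ne (by simp) (by simp)]
        simp
    have h3 : gam (Θ.vert (i.1 ⟨0, by omega⟩)) = 0 := gam_vert hgam hi
    rw [h1]
    by_cases hj : j = orbitAct Θ hβ (r ⟨0, by omega⟩ * r ⟨1, h⟩ * r ⟨0, by omega⟩ * r ⟨1, h⟩) i
    · rw [if_pos hj, if_pos hj, if_pos h3, if_pos h2.symm, h2, ← hp, mul_div_cancel_left₀ _ hne]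
      ring
    · rw [if_neg hj, if_neg hj, mul_zero, mul_zero]
  | braid4_zero h i hi hi' p hp =>
    have hne := S.x_ne ⟨1, h⟩
    apply_fun aeval S.x at hp
    simp only [map_mul, map_sub, map_neg, aeval_Qval, aeval_C, aeval_X] at hp
    simp only [pow_two (_ * _)]
    simp only [map_mul, map_sub, polyRep_psi, polyRep_e, polyRep_fpoly,
      Module.End.mul_apply, LinearMap.sub_apply, Pi.sub_apply]
    rw [op_braid4_proj S lam hβ hgam hstrong, op_proj S lam hβ hgam, proj_apply]
    have h3 : gam (Θ.vert (i.1 ⟨0, by omega⟩)) = 0 := gam_vert hgam hi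
    have h5 : i.1 ⟨0, by omega⟩ ≠ Θ.vert (i.1 ⟨1, h⟩) := fun h' => hi' (by
      rw [h', Θ.vert_involutive])
    rw [if_pos h3, if_neg h5]
    -- If γ_{i_2} = 0, both sides vanish. Otherwise θ fixes i_2, and ψ_0 e(i) lands in the same
    -- component as the products of length four.
    by_cases h4 : gam (i.1 ⟨1, h⟩) = 0
    · have hp0 : aeval S.x p = 0 := by simpa [h4, hne] using hp
      simp [hp0, gam_vert hgam h4]
    · have h2 : Θ.vert (i.1 ⟨1, h⟩) = i.1 ⟨1, h⟩ := by_contra fun h' => h4 (hgam _ h')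
      have h1 : orbitAct Θ hβ (r ⟨0, by omega⟩) i =
          orbitAct Θ hβ (r ⟨0, by omega⟩ * r ⟨1, h⟩ * r ⟨0, by omega⟩ * r ⟨1, h⟩) i := by
        refine Subtype.ext (funext fun c => ?_)
        rw [orbitAct_braid4_apply]
        refine (congrFun (act_r_zero Θ.vert (by omega) i.1) c).trans ?_
        obtain ⟨_ | _ | c, hc⟩ := c
        · simp
        · simp [h2]
        · simp
      rw [h1, h2, ← mul_assoc, ← mul_div_assoc, ← hp,
        mul_div_cancel_left₀ _ hne]
      split_ifs <;> simp
  | braid4_ne h i hi p hp =>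
    have hne := S.x_ne ⟨1, h⟩
    have hne' := S.x_ne ⟨0, by omega⟩
    apply_fun aeval S.x at hp
    simp only [map_mul, map_sub, map_neg, aeval_Qval, aeval_C, aeval_X] at hp
    have hs : ∀ (c : R) (f : β → F) (j : β),
        (algebraMap R (Module.End R (β → F)) c) f j = algebraMap R F c * f j := by
      intro c f j
      rw [Module.algebraMap_end_apply, Pi.smul_apply, Algebra.smul_def]
    simp only [pow_two (_ * _)]
    simp only [map_mul, map_sub, polyRep_psi, polyRep_e, polyRep_y, polyRep_fpoly, AlgHom.commutes,
      Module.End.mul_apply, LinearMap.sub_apply, Pi.sub_apply, hs]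
    rw [op_braid4_proj S lam hβ hgam hstrong, op_proj S lam hβ hgam, proj_apply, proj_apply]
    have h3 : Θ.vert (i.1 ⟨0, by omega⟩) = i.1 ⟨0, by omega⟩ := by_contra fun h' => hi (hgam _ h')
    rw [h3, if_neg hi]
    by_cases h4 : gam (i.1 ⟨1, h⟩) = 0
    · have hp0 : aeval S.x p = 0 := by simpa [h4, hne, hne'] using hp
      simp [hp0, gam_vert hgam h4]
    · have h2 : Θ.vert (i.1 ⟨1, h⟩) = i.1 ⟨1, h⟩ := by_contra fun h' => h4 (hgam _ h')
      have h1 : orbitAct Θ hβ (r ⟨0, by omega⟩ * r ⟨1, h⟩ * r ⟨0, by omega⟩ * r ⟨1, h⟩) i = i := by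
        refine Subtype.ext (funext fun c => ?_)
        rw [orbitAct_braid4_apply]
        obtain ⟨_ | _ | c, hc⟩ := c
        · simp [h3]
        · simp [h2]
        · simp
      have h5 : orbitAct Θ hβ (r ⟨0, by omega⟩) i = i := by
        refine Subtype.ext ((act_r_zero Θ.vert (by omega) i.1).trans ?_)
        rw [h3, Function.update_eq_self]
      rw [h1, h2, h5, ← mul_div_assoc, ← hp, mul_div_cancel_left₀ _ (mul_ne_zero hne' hne)]
      split_ifs <;> simp

end Relations

end InterpolatingKLR

namespace InterpolatingKLR

open MvPolynomial

/-! ### Triangularity and independence in the polynomial representation. -/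

section Leading

variable {I A R F : Type*} [CommRing R] [Field F] [Algebra R F] {n : ℕ} (S : SignedField R F n)
  {Γ : LoopFreeQuiver I A} {Θ : Γ.Involution} (lam : I → ℕ) (gam : I → R)
  {β : Finset (Fin n → I)} (hβ : IsOrbit Θ.vert β)

theorem alphaA_ne_zero (p q : I) {u v : F} (h : u - v ≠ 0) : alphaA Γ p q u v ≠ 0 := by
  have h' : v - u ≠ 0 := by rwa [← neg_sub, neg_ne_zero]
  unfold alphaA
  split_ifs
  · exact inv_ne_zero h
  · exact pow_ne_zero _ h'

theorem alphaB_ne_zero (g : I → F) (p : I) {u : F} (h : u ≠ 0) : alphaB lam g p u ≠ 0 := by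
  unfold alphaB
  split_ifs with hp
  · exact pow_ne_zero _ h
  · exact neg_ne_zero.2 (div_ne_zero hp h)

theorem coefAt_ne_zero (j : Fin n → I) (b : Fin n) : coefAt S Θ lam gam 1 j b ≠ 0 := by
  obtain ⟨_ | b, hb⟩ := b
  · simp only [coefAt, SignedPerm.one_apply, extend_pos]
    exact alphaB_ne_zero _ _ _ (S.x_ne _)
  · simp only [coefAt, SignedPerm.one_apply, extend_pos]
    exact alphaA_ne_zero _ _ (S.sub_ne _ _ (by simp))

open scoped Classical in
/-- The coefficients of the product of the operators representing the letters of a word, as a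
combination of the operators `sigma v`. -/
noncomputable def wordCoef : List (Fin n) → SignedPerm n → β → F
  | [], v, _ => if v = 1 then 1 else 0
  | b :: l, v, j => coefAt S Θ lam gam 1 j.1 b *
      (sigma S hβ (r b) (wordCoef l (r b * v)) j - diagAt Θ gam 1 j.1 b * wordCoef l v j)

theorem polyRep_psiWord_apply [Fintype (SignedPerm n)] (l : List (Fin n)) (f : β → F) (j : β) :
    Model.psiWord (polyRep S lam gam hβ) l f j =
      ∑ v, wordCoef S lam gam hβ l v j * sigma S hβ v f j := by
  induction l generalizing j with
  | nil => simp [Model.psiWord, wordCoef, sigma_one]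
  | cons b l ih =>
    have hw : Model.psiWord (polyRep S lam gam hβ) (b :: l) =
        op S lam gam hβ b * Model.psiWord (polyRep S lam gam hβ) l := by
      rw [Model.psiWord, Model.psiWord, List.map_cons, List.prod_cons, Model.psi, polyRep_psi]
    rw [hw, Module.End.mul_apply, op_apply, ih, sigma, ih, map_sum]
    simp only [wordCoef, mul_sub, sub_mul, Finset.sum_sub_distrib, Finset.mul_sum]
    congr 1
    -- Reindexing by v ↦ r_b v turns σ_{r_b} σ_{r_b v} into σ_v.
    · rw [← Equiv.sum_comp (Equiv.mulLeft (r b))]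
      refine Finset.sum_congr rfl fun v _ => ?_
      have h1 : S.s (r b) (sigma S hβ (r b * v) f (orbitAct Θ hβ (r b)⁻¹ j)) =
          sigma S hβ v f j :=
        (sigma_sigma S hβ (r b) (r b * v) f j).trans (by rw [r_mul_cancel_left])
      rw [Equiv.coe_mulLeft, map_mul, h1, mul_assoc]
      rfl
    · exact Finset.sum_congr rfl fun v _ => by ring

/-- On expanding the product, each letter contributes either its reflection or its diagonal term.
Thus v is represented by a subword, which is shorter than l unless no letter is dropped. -/
theorem wordCoef_ne_zero_imp {l : List (Fin n)} {v : SignedPerm n} {j : β}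
    (h : wordCoef S lam gam hβ l v j ≠ 0) :
    v = wordProd l ∨ ∃ l' : List (Fin n), wordProd l' = v ∧ l'.length < l.length := by
  induction l generalizing v j with
  | nil =>
    left
    by_contra h'
    exact h (if_neg h')
  | cons b l ih =>
    by_cases h1 : wordCoef S lam gam hβ l v j = 0
    · have h2 : wordCoef S lam gam hβ l (r b * v) (orbitAct Θ hβ (r b)⁻¹ j) ≠ 0 := by
        intro h2
        exact h (by simp [wordCoef, h1, sigma, h2])
      rcases ih h2 with h3 | ⟨l', h3, h4⟩
      · left; rw [wordProd_cons, ← h3, r_mul_cancel_left]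
      · right
        exact ⟨b :: l', by rw [wordProd_cons, h3, r_mul_cancel_left], by simpa using h4⟩
    · right
      rcases ih h1 with h3 | ⟨l', h3, h4⟩
      · exact ⟨l, h3.symm, by simp⟩
      · exact ⟨l', h3, by simp only [List.length_cons]; omega⟩

/-- For a reduced word b :: l, the operator of l has no term at the product of b :: l, so the
diagonal part cannot cancel the leading coefficient. The latter is a product of transforms of
nonzero coefficients. -/
theorem wordCoef_wordProd_ne_zero {l : List (Fin n)} (hl : Reduced l) (j : β) :
    wordCoef S lam gam hβ l (wordProd l) j ≠ 0 := by
  induction l generalizing j with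
  | nil => simp [wordCoef]
  | cons b l ih =>
    have h1 : wordCoef S lam gam hβ l (wordProd (b :: l)) j = 0 := by
      by_contra h
      rcases wordCoef_ne_zero_imp S lam gam hβ h with h | ⟨l', h, h'⟩
      · have := hl l h.symm
        simp at this
      · have := hl l' h
        simp only [List.length_cons] at this
        omega
    rw [wordCoef, h1, mul_zero, sub_zero, wordProd_cons, r_mul_cancel_left]
    exact mul_ne_zero (coefAt_ne_zero S lam gam j.1 b)
      ((map_ne_zero_iff _ (S.s (r b)).injective).2 (ih hl.tail _))

theorem SignedField.extend_injective : Function.Injective (extend Neg.neg S.x) := by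
  rintro ⟨a, s⟩ ⟨b, t⟩ h
  by_cases hab : a = b
  · subst hab
    have := S.add_ne a a
    rcases Int.units_eq_one_or s with rfl | rfl <;> rcases Int.units_eq_one_or t with rfl | rfl
    · rfl
    · rw [extend_pos, extend_neg] at h
      exact absurd (by linear_combination h) this
    · rw [extend_pos, extend_neg] at h
      exact absurd (by linear_combination -h) this
    · rfl
  · have h1 := S.add_ne a b
    have h2 := S.sub_ne a b hab
    exfalso
    rcases Int.units_eq_one_or s with rfl | rfl <;> rcases Int.units_eq_one_or t with rfl | rfl <;>
      simp only [extend_pos, extend_neg] at h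
    · exact h2 (by linear_combination h)
    · exact h1 (by linear_combination h)
    · exact h1 (by linear_combination -h)
    · exact h2 (by linear_combination -h)

/-- Dedekind's theorem; the automorphisms are distinct because the 2n elements ±x_a are. -/
theorem SignedField.linearIndependent_s :
    LinearIndependent F fun (v : SignedPerm n) (c : F) => S.s v c := by
  refine (linearIndependent_monoidHom F F).comp (fun v : SignedPerm n => (S.s v : F →* F))
    fun v w h => ?_
  have h1 : ∀ a, v.1 (a, 1) = w.1 (a, 1) := fun a => by
    apply S.extend_injective
    rw [← S.s_x, ← S.s_x]
    exact DFunLike.congr_fun h (S.x a)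
  refine Subtype.ext (Equiv.ext ?_)
  rintro ⟨a, s⟩
  rcases Int.units_eq_one_or s with rfl | rfl
  · exact h1 a
  · have h2 := apply_negPt v (a, 1)
    rw [h1 a, ← apply_negPt w] at h2
    exact h2

variable {gam}

/-- Independence over the polynomial ring. The combination is tested on functions supported at one
component i and evaluated at j; Dedekind's theorem isolates the coefficient of each σ_v, and
triangularity excludes a nonzero p(w, i) with w of maximal length. -/
theorem polyRep_sum_eq_zero [Fintype (SignedPerm n)]
    (hS : Function.Injective (aeval S.x : MvPolynomial (Fin n) R →ₐ[R] F))
    (hπ : IsModel Θ lam gam (polyRep S lam gam hβ)) {red : SignedPerm n → List (Fin n)}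
    (hred : ∀ w, wordProd (red w) = w) (hred' : ∀ w, Reduced (red w))
    (p : SignedPerm n × β → MvPolynomial (Fin n) R)
    (h : ∑ x, Model.poly hπ (p x) * (Model.psiWord (polyRep S lam gam hβ) (red x.1) *
      Model.e (polyRep S lam gam hβ) x.2) = 0) : p = 0 := by
  classical
  have h1 : ∀ (i j : β) (v : SignedPerm n), orbitAct Θ hβ v⁻¹ j = i →
      ∑ w, aeval S.x (p (w, i)) * wordCoef S lam gam hβ (red w) v j = 0 := by
    intro i j v hv
    have h2 := Fintype.linearIndependent_iff.1 S.linearIndependent_s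
      -- Only those v that carry i to j contribute to the value at j; the others receive coefficient
      -- 0.
      (fun v => if orbitAct Θ hβ v⁻¹ j = i then
        ∑ w, aeval S.x (p (w, i)) * wordCoef S lam gam hβ (red w) v j else 0) ?_ v
    · simpa only [if_pos hv] using h2
    funext c
    have h3 := congrFun (LinearMap.congr_fun h (Pi.single i c)) j
    simp only [LinearMap.sum_apply, Finset.sum_apply, Module.End.mul_apply,
      ← Model.mk_fpoly hπ, polyRep_fpoly, Model.e, polyRep_e, polyRep_psiWord_apply,
      LinearMap.zero_apply, Pi.zero_apply] at h3
    have h4 : ∀ (v : SignedPerm n) (k : β), sigma S hβ v ((proj k : _ →ₗ[R] _) (Pi.single i c)) j =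
        if k = i then if orbitAct Θ hβ v⁻¹ j = i then S.s v c else 0 else 0 := by
      intro v k
      rw [sigma, proj_apply, Pi.single_apply]
      split_ifs with h5 h6 h7 h8
      all_goals first
        | rfl
        | exact map_zero _
        | exact absurd (h5.symm.trans h6) h7
        | exact absurd (h6.trans h5) h7
        | simp_all
    simp only [h4] at h3
    rw [Fintype.sum_prod_type] at h3
    rw [Finset.sum_apply, Pi.zero_apply]
    refine Eq.trans ?_ h3
    simp only [Pi.smul_apply, smul_eq_mul]
    have h5 : ∀ w, ∑ k : β, aeval S.x (p (w, k)) * ∑ v, wordCoef S lam gam hβ (red w) v j *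
        (if k = i then if orbitAct Θ hβ v⁻¹ j = i then S.s v c else 0 else 0) =
        ∑ v, aeval S.x (p (w, i)) * (wordCoef S lam gam hβ (red w) v j *
          if orbitAct Θ hβ v⁻¹ j = i then S.s v c else 0) := by
      intro w
      rw [Finset.sum_eq_single i]
      · simp [Finset.mul_sum]
      · intro k _ hk
        simp [hk]
      · simp
    simp only [h5]
    refine Eq.trans ?_ Finset.sum_comm
    refine Finset.sum_congr rfl fun v _ => ?_
    split_ifs
    · rw [Finset.sum_mul]
      exact Finset.sum_congr rfl fun w _ => by ring
    · simp
  by_contra hp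
  obtain ⟨⟨w₀, i⟩, hw₀⟩ := Function.ne_iff.1 hp
  obtain ⟨w, hw, hmax⟩ := Finset.exists_max_image (Finset.univ.filter fun w => p (w, i) ≠ 0)
    (fun w => (red w).length) ⟨w₀, by simpa using hw₀⟩
  simp only [Finset.mem_filter, Finset.mem_univ, true_and] at hw hmax
  -- In the coefficient of σ_w at the component w · i, any other v with p(v, i) ≠ 0 would need a
  -- reduced word longer than that of w.
  have h2 := h1 i (orbitAct Θ hβ w i) w ((orbitAct_eq_iff hβ w i _).2 rfl)
  rw [Finset.sum_eq_single w] at h2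
  · have h3 := wordCoef_wordProd_ne_zero S lam gam hβ (hred' w) (orbitAct Θ hβ w i)
    rw [hred] at h3
    exact mul_ne_zero ((map_ne_zero_iff _ hS).2 hw) h3 h2
  · intro v _ hvw
    by_cases hv : p (v, i) = 0
    · simp [hv]
    · rw [mul_eq_zero]
      right
      by_contra h3
      rcases wordCoef_ne_zero_imp S lam gam hβ h3 with h4 | ⟨l', h4, h5⟩
      · rw [hred] at h4
        exact hvw h4.symm
      · have h6 := hred' w l' (by rw [h4, hred])
        have h7 := hmax v hv
        omega
  · simp

end Leading

/-! ### From polynomial coefficients to monomials. -/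

section Independence

variable {I A K : Type*} [CommRing K] {Γ : LoopFreeQuiver I A} {Θ : Γ.Involution}
    {lam : I → ℕ} {gam : I → K} {n : ℕ} {β : Finset (Fin n → I)}
    {B : Type*} [Ring B] [Algebra K B] {π : FreeAlgebra K (Gen β) →ₐ[K] B}

/-- The hypothesis says that a linear map from a finite power of the polynomial ring is injective;
the family is the image of the monomial basis under this map. -/
theorem Model.linearIndependent [Fintype (SignedPerm n)] (hπ : IsModel Θ lam gam π)
    (red : SignedPerm n → List (Fin n))
    (h : ∀ p : SignedPerm n × β → MvPolynomial (Fin n) K,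
      ∑ x, Model.poly hπ (p x) * (Model.psiWord π (red x.1) * Model.e π x.2) = 0 → p = 0) :
    LinearIndependent K fun x : (Fin n → ℕ) × SignedPerm n × β =>
      (List.ofFn fun a => Model.y π a ^ x.1 a).prod * Model.psiWord π (red x.2.1) *
        Model.e π x.2.2 := by
  classical
  let Φ : (SignedPerm n × β → MvPolynomial (Fin n) K) →ₗ[K] B :=
    ∑ x, (LinearMap.mulRight K (Model.psiWord π (red x.1) * Model.e π x.2) ∘ₗ
      (Model.poly hπ).toLinearMap) ∘ₗ LinearMap.proj x
  have hΦ : LinearMap.ker Φ = ⊥ := by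
    refine LinearMap.ker_eq_bot'.2 fun p hp => h p ?_
    simpa [Φ, mul_assoc] using hp
  have h1 := ((Pi.basis fun _ : SignedPerm n × β =>
    basisMonomials (Fin n) K).linearIndependent.map' Φ hΦ).comp
      (fun x : (Fin n → ℕ) × SignedPerm n × β => ⟨x.2, Finsupp.equivFunOnFinite.symm x.1⟩) ?_
  · suffices hf : (fun x : (Fin n → ℕ) × SignedPerm n × β =>
        (List.ofFn fun a => Model.y π a ^ x.1 a).prod * Model.psiWord π (red x.2.1) *
          Model.e π x.2.2) = _ from hf ▸ h1
    funext x
    rw [Model.list_prod_eq_poly hπ, mul_assoc]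
    simp only [Function.comp_apply, Pi.basis_apply, coe_basisMonomials]
    simp only [Φ, LinearMap.sum_apply, LinearMap.comp_apply, LinearMap.proj_apply,
      LinearMap.mulRight_apply, AlgHom.toLinearMap_apply]
    rw [Finset.sum_eq_single x.2]
    · rw [Pi.single_eq_same]
    · intro y _ hy
      rw [Pi.single_eq_of_ne hy, map_zero, zero_mul]
    · simp
  · intro x y hxy
    simp only [Sigma.mk.injEq, heq_eq_eq, EmbeddingLike.apply_eq_iff_eq] at hxy
    exact Prod.ext hxy.2 hxy.1

end Independence

end InterpolatingKLR

namespace InterpolatingKLR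

open MvPolynomial

/-! ### Rational functions with the action of signed permutations. -/

section Rational

variable (R : Type*) [CommRing R] (n : ℕ)

/-- The action of `B_n` on polynomials by signed permutations of the variables. -/
noncomputable def signedAct : SignedPerm n →*
    (MvPolynomial (Fin n) R →ₐ[R] MvPolynomial (Fin n) R) :=
  have h : ∀ (w : SignedPerm n) (x : Fin n × ℤˣ),
      aeval (fun a => extend Neg.neg (X : Fin n → MvPolynomial (Fin n) R) (w.1 (a, 1)))
        (extend Neg.neg (X : Fin n → MvPolynomial (Fin n) R) x) =
      extend Neg.neg (X : Fin n → MvPolynomial (Fin n) R) (w.1 x) := by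
    rintro w ⟨a, s⟩
    rcases Int.units_eq_one_or s with rfl | rfl
    · rw [extend_pos, aeval_X]
    · rw [extend_neg, map_neg, aeval_X]
      have h2 : w.1 (a, -1) = negPt (w.1 (a, 1)) := apply_negPt w (a, 1)
      rw [h2]
      rcases w.1 (a, 1) with ⟨b, t⟩
      rcases Int.units_eq_one_or t with rfl | rfl <;> simp [extend, negPt]
  { toFun := fun w => aeval fun a => extend Neg.neg X (w.1 (a, 1))
    map_one' := by
      ext a
      simp [extend]
    map_mul' := fun v w => by
      ext1 a
      rw [aeval_X, AlgHom.mul_apply, aeval_X, h]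
      rfl }

theorem signedAct_X (w : SignedPerm n) (a : Fin n) :
    signedAct R n w (X a) = extend Neg.neg X (w.1 (a, 1)) := aeval_X _ _

variable [IsDomain R]

/-- The field of rational functions in `n` variables, with signed permutations of the variables. -/
noncomputable def rationalField (h2 : (2 : R) ≠ 0) :
    SignedField R (FractionRing (MvPolynomial (Fin n) R)) n where
  s :=
    -- A homomorphism from a group to the monoid of endomorphisms has invertible values, and the
    -- resulting automorphisms extend to the fraction field.
    { toFun := fun w => IsFractionRing.algEquivOfAlgEquiv
        (AlgEquiv.algHomUnitsEquiv R _ ((signedAct R n).toHomUnits w))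
      map_one' := by
        ext x
        obtain ⟨x, y, -, rfl⟩ := IsFractionRing.div_surjective (MvPolynomial (Fin n) R) x
        simp [AlgEquiv.algHomUnitsEquiv]
      map_mul' := fun v w => by
        ext x
        obtain ⟨x, y, -, rfl⟩ := IsFractionRing.div_surjective (MvPolynomial (Fin n) R) x
        simp }
  x a := algebraMap (MvPolynomial (Fin n) R) _ (X a)
  s_x w a := by
    change IsFractionRing.algEquivOfAlgEquiv
        (AlgEquiv.algHomUnitsEquiv R _ ((signedAct R n).toHomUnits w)) _ = _
    rw [IsFractionRing.algEquivOfAlgEquiv_algebraMap]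
    change algebraMap _ _ (signedAct R n w (X a)) = _
    rw [signedAct_X]
    unfold extend
    split_ifs
    · rfl
    · exact map_neg _ _
  x_ne a := by
    rw [Ne, FaithfulSMul.algebraMap_eq_zero_iff]
    exact X_ne_zero a
  sub_ne a b hab := by
    rw [← map_sub, Ne, FaithfulSMul.algebraMap_eq_zero_iff, sub_eq_zero]
    exact fun h => hab (X_injective h)
  add_ne a b := by
    rw [← map_add, Ne, FaithfulSMul.algebraMap_eq_zero_iff]
    intro h
    -- Setting all variables to 1 gives 2 = 0. This also covers a = b, where the claim is 2 x_a ≠ 0.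
    have h1 := congrArg (aeval fun _ => (1 : R)) h
    simp only [map_add, aeval_X, map_zero, one_add_one_eq_two] at h1
    exact h2 h1
  inj := FaithfulSMul.algebraMap_injective R _

theorem rationalField_injective (h2 : (2 : R) ≠ 0) :
    Function.Injective (aeval (rationalField R n h2).x :
      MvPolynomial (Fin n) R →ₐ[R] FractionRing (MvPolynomial (Fin n) R)) := by
  have : (aeval (rationalField R n h2).x :
      MvPolynomial (Fin n) R →ₐ[R] FractionRing (MvPolynomial (Fin n) R)) =
      IsScalarTower.toAlgHom R _ _ := by
    ext a
    rw [aeval_X]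
    rfl
  rw [this]
  exact FaithfulSMul.algebraMap_injective _ _

end Rational

/-! ### Cancellation of linear forms over an arbitrary ring. -/

section Cancel

variable {K : Type*} [CommRing K] {n : ℕ}

/-- The substitution X_a ↦ X_a − c X_b is an automorphism taking the linear form to a variable,
which can be cancelled even if K has zero divisors. This makes the quotients in the relations
unique. -/
theorem X_add_mul_cancel {a b : Fin n} (hab : a ≠ b) (c : K) {p q : MvPolynomial (Fin n) K}
    (h : (X a + C c * X b) * p = (X a + C c * X b) * q) : p = q := by
  let g (c : K) : MvPolynomial (Fin n) K →ₐ[K] MvPolynomial (Fin n) K :=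
    aeval (Function.update X a (X a + C c * X b))
  have hga : ∀ c, g c (X a) = X a + C c * X b := fun c => by simp [g]
  have hgb : ∀ c d, d ≠ a → g c (X d) = X d := fun c d hd => by simp [g, hd]
  have hC : ∀ c d, g c (C d) = C d := fun c d => (g c).commutes d
  have hg : ∀ p, g c (g (-c) p) = p := by
    intro p
    suffices (g c).comp (g (-c)) = AlgHom.id K _ from DFunLike.congr_fun this p
    ext1 d
    by_cases hd : d = a
    · subst hd
      rw [AlgHom.comp_apply, hga, map_add, hga, map_mul, hC, hgb _ _ (Ne.symm hab), C_neg]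
      simp
    · rw [AlgHom.comp_apply, hgb _ _ hd, hgb _ _ hd]
      rfl
  have h1 := congrArg (g (-c)) h
  simp only [map_mul, map_add, hga, hC, hgb _ _ (Ne.symm hab), C_neg] at h1
  rw [show X a + -C c * X b + C c * X b = (X a : MvPolynomial (Fin n) K) by ring] at h1
  rw [← hg p, X_mul_cancel_left_iff.1 h1, hg]

end Cancel

/-! ### Base change of the relations. -/

section BaseChange

open scoped TensorProduct

variable {I A R K : Type*} [CommRing R] [CommRing K] [Algebra R K] {Γ : LoopFreeQuiver I A}
  {Θ : Γ.Involution} {lam : I → ℕ} {gam : I → R} {gam' : I → K} {n : ℕ} {β : Finset (Fin n → I)}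
  {B : Type*} [Ring B] [Algebra R B] (π : FreeAlgebra R (Gen β) →ₐ[R] B)

variable (K) in
/-- The base change of a homomorphism from the free algebra. -/
noncomputable def Model.baseChange : FreeAlgebra K (Gen β) →ₐ[K] K ⊗[R] B :=
  FreeAlgebra.lift K fun g => 1 ⊗ₜ π (FreeAlgebra.ι R g)

theorem Model.baseChange_fy (a : Fin n) : Model.baseChange K π (fy K β a) =
    (Algebra.TensorProduct.includeRight : B →ₐ[R] K ⊗[R] B) (Model.y π a) := by
  simp [Model.baseChange, fy, Model.y]

theorem Model.baseChange_fpsi (a : Fin n) : Model.baseChange K π (fpsi K β a) =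
    (Algebra.TensorProduct.includeRight : B →ₐ[R] K ⊗[R] B) (Model.psi π a) := by
  simp [Model.baseChange, fpsi, Model.psi]

theorem Model.baseChange_fe (i : β) : Model.baseChange K π (fe K β i) =
    (Algebra.TensorProduct.includeRight : B →ₐ[R] K ⊗[R] B) (Model.e π i) := by
  simp [Model.baseChange, fe, Model.e]

theorem map_Qval (i j : I) (p q : MvPolynomial (Fin n) R) :
    map (algebraMap R K) (Qval Γ i j p q) =
      Qval Γ i j (map (algebraMap R K) p) (map (algebraMap R K) q) := by
  by_cases h : i = j
  · subst h; simp [Qval_self]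
  · simp [Qval_eq Γ h]

variable {π}

theorem Model.baseChange_fpoly (hπ : IsModel Θ lam gam π) (p : MvPolynomial (Fin n) R) :
    Model.baseChange K π (fpoly K β (map (algebraMap R K) p)) =
      (Algebra.TensorProduct.includeRight : B →ₐ[R] K ⊗[R] B) (Model.poly hπ p) := by
  have hc : ∀ a b : Fin n,
      (Algebra.TensorProduct.includeRight : B →ₐ[R] K ⊗[R] B) (Model.y π a) *
        (Algebra.TensorProduct.includeRight : B →ₐ[R] K ⊗[R] B) (Model.y π b) =
      (Algebra.TensorProduct.includeRight : B →ₐ[R] K ⊗[R] B) (Model.y π b) *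
        (Algebra.TensorProduct.includeRight : B →ₐ[R] K ⊗[R] B) (Model.y π a) := fun a b => by
    rw [← map_mul, Model.y_comm hπ, map_mul]
  rw [map_fpoly (Model.baseChange K π) (commEval (K := K) _ hc)
    fun a => by rw [commEval_X, Model.baseChange_fy]]
  induction p using MvPolynomial.induction_on with
  | C c =>
    rw [map_C, Model.poly_C, AlgHom.commutes]
    refine ((commEval (K := K) _ hc).commutes _).trans ?_
    rw [Algebra.TensorProduct.algebraMap_apply, Algebra.TensorProduct.algebraMap_apply]
    rfl
  | add p q hp hq => rw [map_add, map_add, map_add, map_add, hp, hq]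
  | mul_X p a hp => rw [map_mul, map_mul, map_mul, map_mul, hp, map_X, commEval_X, Model.poly_X]

/-- Each relation over K is the image of a relation over R. By `hzero` both parameters select the
same case of the relations, and by uniqueness of the quotient the polynomial p over K is the image
of the one over R. -/
theorem Model.isModel_baseChange (hπ : IsModel Θ lam gam π)
    (hgam : ∀ i, Θ.vert i ≠ i → gam i = 0) (hmap : ∀ i, algebraMap R K (gam i) = gam' i)
    (hzero : ∀ i, gam' i = 0 ↔ gam i = 0) : IsModel Θ lam gam' (Model.baseChange K π) := by
  let ι : B →ₐ[R] K ⊗[R] B := Algebra.TensorProduct.includeRight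
  have hy : ∀ a, Model.baseChange K π (fy K β a) = ι (π (fy R β a)) := Model.baseChange_fy π
  have hpsi : ∀ a, Model.baseChange K π (fpsi K β a) = ι (π (fpsi R β a)) := Model.baseChange_fpsi π
  have he : ∀ a, Model.baseChange K π (fe K β a) = ι (π (fe R β a)) := Model.baseChange_fe π
  have hp : ∀ p, Model.baseChange K π (fpoly K β (map (algebraMap R K) p)) = ι (Model.poly hπ p) :=
    Model.baseChange_fpoly hπ
  have hal : ∀ c, algebraMap K (K ⊗[R] B) (algebraMap R K c) = ι (algebraMap R B c) := fun c => by
    rw [AlgHom.commutes, ← IsScalarTower.algebraMap_apply]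
  have hι : ∀ x y, Rel Γ Θ.vert lam gam β x y → ι (π x) = ι (π y) := fun x y h => by rw [hπ x y h]
  intro x y hxy
  cases hxy with
  | sum_e =>
    have := hι _ _ Rel.sum_e
    simpa only [map_sum, map_one, he] using this
  | e_mul_self i => simpa only [map_mul, he] using hι _ _ (Rel.e_mul_self i)
  | e_mul_of_ne i k hik =>
    simpa only [map_mul, map_zero, he] using hι _ _ (Rel.e_mul_of_ne i k hik)
  | y_comm a b => simpa only [map_mul, hy] using hι _ _ (Rel.y_comm a b)
  | y_e a i => simpa only [map_mul, hy, he] using hι _ _ (Rel.y_e a i)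
  | psi_e b i k hk => simpa only [map_mul, hpsi, he] using hι _ _ (Rel.psi_e b i k hk)
  | psi_y_left a ha i hi =>
    simpa only [map_mul, map_sub, map_neg, hpsi, hy, he] using hι _ _ (Rel.psi_y_left a ha i hi)
  | psi_y_right a ha i hi =>
    simpa only [map_mul, map_sub, hpsi, hy, he] using hι _ _ (Rel.psi_y_right a ha i hi)
  | psi_y_other a ha b i hb =>
    simpa only [map_mul, map_sub, map_zero, hpsi, hy, he] using
      hι _ _ (Rel.psi_y_other a ha b i hb)
  | psi_comm a b hab => simpa only [map_mul, hpsi] using hι _ _ (Rel.psi_comm a b hab)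
  | psi_sq a ha i =>
    have h := hι _ _ (Rel.psi_sq a ha i)
    simp only [map_mul, map_pow, Model.mk_fpoly hπ, ← hp, map_Qval, map_X] at h
    simpa only [map_mul, map_pow, hpsi, he] using h
  | braid3_eq b hb i hi p hq =>
    obtain ⟨q, hq'⟩ := dvd_braid3 Γ (i.1 ⟨b, by omega⟩) (i.1 ⟨b + 1, by omega⟩)
      (X ⟨b, by omega⟩) (X ⟨b + 1, by omega⟩) (X ⟨b + 2, hb⟩ : MvPolynomial (Fin n) R)
    have h1 := congrArg (map (algebraMap R K)) hq'
    simp only [map_mul, map_sub, map_Qval, map_X] at h1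
    have h2 : p = map (algebraMap R K) q := by
      apply X_add_mul_cancel (a := ⟨b, by omega⟩) (b := ⟨b + 2, hb⟩) (by simp) (-1)
      rw [C_neg, C_1, neg_one_mul, ← sub_eq_add_neg, hq, h1]
    have h := hι _ _ (Rel.braid3_eq b hb i hi q hq'.symm)
    simp only [map_mul, map_sub, Model.mk_fpoly hπ, ← hp] at h
    simpa only [map_mul, map_sub, hpsi, he, h2] using h
  | braid3_ne b hb i hi =>
    simpa only [map_mul, map_sub, map_zero, hpsi, he] using hι _ _ (Rel.braid3_ne b hb i hi)
  | psi0_y1 h i =>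
    have h1 := hι _ _ (Rel.psi0_y1 h i)
    simp only [Algebra.smul_def, map_mul, ← hal, AlgHom.commutes] at h1 ⊢
    simpa only [map_mul, map_add, map_ofNat, hmap, hpsi, hy, he] using h1
  | psi0_y h a ha => simpa only [map_mul, hpsi, hy] using hι _ _ (Rel.psi0_y h a ha)
  | psi0_sq_zero h i hi =>
    have h1 := hι _ _ (Rel.psi0_sq_zero h i ((hzero _).1 hi))
    simpa only [map_mul, map_pow, map_neg, map_one, hpsi, hy, he] using h1
  | psi0_sq_ne h i hi =>
    have h1 := hι _ _ (Rel.psi0_sq_ne h i (mt (hzero _).2 hi))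
    simpa only [map_mul, map_pow, map_zero, hpsi, he] using h1
  | braid4_theta h i hi hi' p hq =>
    obtain ⟨q, hq'⟩ := dvd_braid4_theta (X ⟨0, by omega⟩) (X ⟨1, h⟩ : MvPolynomial (Fin n) R)
      (lam (i.1 ⟨0, by omega⟩) + lam (Θ.vert (i.1 ⟨0, by omega⟩)))
    have h1 := congrArg (map (algebraMap R K)) hq'
    simp only [map_mul, map_sub, map_add, map_neg, map_pow, map_X] at h1
    have h2 : p = map (algebraMap R K) q := by
      apply X_add_mul_cancel (a := ⟨0, by omega⟩) (b := ⟨1, h⟩) (by simp) 1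
      rw [C_1, one_mul, hq, h1]
    have h := hι _ _ (Rel.braid4_theta h i ((hzero _).1 hi) hi' q hq'.symm)
    simp only [map_mul, map_sub, map_pow, Model.mk_fpoly hπ, ← hp] at h
    simpa only [map_mul, map_sub, map_pow, map_neg, map_one, hpsi, he, h2] using h
  | braid4_zero h i hi hi' p hq =>
    obtain ⟨q, hq'⟩ := (dvd_braid4_zero Γ (i.1 ⟨1, h⟩) (i.1 ⟨0, by omega⟩)
      (X ⟨0, by omega⟩) (X ⟨1, h⟩ : MvPolynomial (Fin n) R)).mul_left (C (gam (i.1 ⟨1, h⟩)))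
    have h1 := congrArg (map (algebraMap R K)) hq'
    simp only [map_mul, map_sub, map_neg, map_Qval, map_X, map_C, hmap] at h1
    have h2 : p = map (algebraMap R K) q := X_mul_cancel_left_iff.1 (hq.trans h1)
    have h := hι _ _ (Rel.braid4_zero h i ((hzero _).1 hi) hi' q hq'.symm)
    simp only [map_mul, map_sub, map_pow, Model.mk_fpoly hπ, ← hp] at h
    simpa only [map_mul, map_sub, map_pow, hpsi, he, h2] using h
  | braid4_ne h i hi p hq =>
    obtain ⟨q, hq'⟩ := dvd_braid4_ne Θ gam hgam (i.1 ⟨1, h⟩) (i.1 ⟨0, by omega⟩)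
      (mt (hzero _).2 hi) (X ⟨0, by omega⟩) (X ⟨1, h⟩ : MvPolynomial (Fin n) R)
    have h1 := congrArg (map (algebraMap R K)) hq'
    simp only [map_mul, map_sub, map_neg, map_Qval, map_X, map_C, hmap] at h1
    have h2 : p = map (algebraMap R K) q := by
      have h3 := hq.trans h1
      rw [mul_assoc, mul_assoc] at h3
      exact X_mul_cancel_left_iff.1 (X_mul_cancel_left_iff.1 h3)
    have h := hι _ _ (Rel.braid4_ne h i (mt (hzero _).2 hi) q hq'.symm)
    simp only [map_mul, map_sub, map_pow, Model.mk_fpoly hπ, ← hp] at h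
    rw [AlgHom.commutes, ← hal, hmap] at h
    simpa only [map_mul, map_sub, map_pow, AlgHom.commutes, hpsi, hy, he, h2] using h

end BaseChange

end InterpolatingKLR

namespace InterpolatingKLR

open MvPolynomial

/-! ### The basis theorem, first for generic parameters and then over K. -/

section Basis

variable {I A K : Type*} [CommRing K] {Γ : LoopFreeQuiver I A} {Θ : Γ.Involution}
  {lam : I → ℕ} {gam : I → K} {n : ℕ} {β : Finset (Fin n → I)}
  {B : Type*} [Ring B] [Algebra K B] (π : FreeAlgebra K (Gen β) →ₐ[K] B)

/-- The image of `y_1^{a_1} ⋯ y_n^{a_n} ψ_{red w} e(i)` under a homomorphism from the free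
algebra. -/
def Model.family (red : SignedPerm n → List (Fin n)) (x : (Fin n → ℕ) × SignedPerm n × β) : B :=
  (List.ofFn fun a => Model.y π a ^ x.1 a).prod * Model.psiWord π (red x.2.1) * Model.e π x.2.2

theorem Model.family_comp {C : Type*} [Ring C] [Algebra K C] (g : B →ₐ[K] C)
    (red : SignedPerm n → List (Fin n)) (x : (Fin n → ℕ) × SignedPerm n × β) :
    Model.family (g.comp π) red x = g (Model.family π red x) := by
  simp only [Model.family, Model.psiWord, map_mul, map_list_prod, List.map_ofFn, List.map_map]
  congr 3
  congr 1
  funext a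
  exact (map_pow g _ _).symm

theorem Model.family_baseChange {R : Type*} [CommRing R] [Algebra R K] {B : Type*} [Ring B]
    [Algebra R B] (π : FreeAlgebra R (Gen β) →ₐ[R] B) (red : SignedPerm n → List (Fin n))
    (x : (Fin n → ℕ) × SignedPerm n × β) :
    Model.family (Model.baseChange K π) red x =
      (Algebra.TensorProduct.includeRight : B →ₐ[R] TensorProduct R K B) (Model.family π red x) := by
  simp only [Model.family, Model.psiWord, map_mul, map_list_prod, List.map_ofFn, List.map_map]
  have h1 : Model.y (Model.baseChange K π) = fun a =>
    (Algebra.TensorProduct.includeRight : B →ₐ[R] TensorProduct R K B) (Model.y π a) :=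
    funext (Model.baseChange_fy π)
  have h2 : Model.psi (Model.baseChange K π) = fun a =>
    (Algebra.TensorProduct.includeRight : B →ₐ[R] TensorProduct R K B) (Model.psi π a) :=
    funext (Model.baseChange_fpsi π)
  have h3 : Model.e (Model.baseChange K π) = fun a =>
    (Algebra.TensorProduct.includeRight : B →ₐ[R] TensorProduct R K B) (Model.e π a) :=
    funext (Model.baseChange_fe π)
  rw [h1, h2, h3]
  congr 3
  congr 1
  funext a
  exact (map_pow _ _ _).symm

variable {π}

theorem Model.exists_basis_of_linearIndependent (hπ : IsModel Θ lam gam π)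
    (hgam : ∀ i, Θ.vert i ≠ i → gam i = 0) (hβ : IsOrbit Θ.vert β)
    {red : SignedPerm n → List (Fin n)} (hred : ∀ w, IsReducedExpression w (red w))
    (hsurj : Function.Surjective π) (hli : LinearIndependent K (Model.family π red)) :
    ∃ b : Module.Basis ((Fin n → ℕ) × SignedPerm n × β) K B, ∀ x, b x = Model.family π red x :=
  ⟨Module.Basis.mk hli (Model.span_eq_top hπ hβ hsurj hgam red hred).ge,
    fun x => Module.Basis.mk_apply _ _ x⟩

/-- The image of a homomorphism from the free algebra for which the family is linearly
independent is free on this family. -/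
theorem Model.exists_basis_range (hπ : IsModel Θ lam gam π)
    (hgam : ∀ i, Θ.vert i ≠ i → gam i = 0) (hβ : IsOrbit Θ.vert β)
    {red : SignedPerm n → List (Fin n)} (hred : ∀ w, IsReducedExpression w (red w))
    (hli : LinearIndependent K (Model.family π red)) :
    ∃ π' : FreeAlgebra K (Gen β) →ₐ[K] π.range, IsModel (B := π.range) Θ lam gam π' ∧
      ∃ b : Module.Basis ((Fin n → ℕ) × SignedPerm n × β) K π.range,
        ∀ x, b x = Model.family (B := π.range) π' red x := by
  have hπ' : IsModel (B := π.range) Θ lam gam π.rangeRestrict :=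
    fun x y h => Subtype.ext (hπ x y h)
  refine ⟨π.rangeRestrict, hπ', Model.exists_basis_of_linearIndependent (B := π.range) hπ' hgam hβ
    hred π.rangeRestrict_surjective ?_⟩
  refine LinearIndependent.of_comp π.range.val.toLinearMap ?_
  suffices hf : π.range.val.toLinearMap ∘ Model.family (B := π.range) π.rangeRestrict red =
      Model.family π red from hf ▸ hli
  funext x
  exact (Model.family_comp (B := π.range) π.rangeRestrict π.range.val red x).symm

theorem IsReducedExpression.wordProd_eq {w : SignedPerm n} {l : List (Fin n)}
    (h : IsReducedExpression w l) : wordProd l = w := h.1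

theorem IsReducedExpression.reduced {w : SignedPerm n} {l : List (Fin n)}
    (h : IsReducedExpression w l) : Reduced l := fun l' hl' => h.2 l' (hl'.trans h.1)

theorem linearIndependent_family_polyRep {R : Type*} [CommRing R] [IsDomain R] (h2 : (2 : R) ≠ 0)
    {gam : I → R} (hgam : ∀ i, Θ.vert i ≠ i → gam i = 0)
    (hstrong : ∀ i, gam i = 0 → Θ.vert i ≠ i ∨ lam i + lam (Θ.vert i) = 0)
    (hβ : IsOrbit Θ.vert β) {red : SignedPerm n → List (Fin n)}
    (hred : ∀ w, IsReducedExpression w (red w)) :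
    LinearIndependent R (Model.family (polyRep (rationalField R n h2) lam gam hβ) red) := by
  have := Fintype.ofFinite (SignedPerm n)
  have hπ := isModel_polyRep (rationalField R n h2) lam hβ hgam hstrong
  exact Model.linearIndependent hπ red (polyRep_sum_eq_zero (rationalField R n h2) lam hβ
    (rationalField_injective R n h2) hπ (fun w => (hred w).wordProd_eq) fun w => (hred w).reduced)

/-- The universal property gives a map from the presented algebra to K ⊗ B which sends the family to
the base change of the basis b. -/
theorem Model.linearIndependent_mkAlgHom {R : Type*} [CommRing R]
    [Algebra R K] {B : Type*} [Ring B] [Algebra R B] {π : FreeAlgebra R (Gen β) →ₐ[R] B}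
    {gamR : I → R} (hπ : IsModel Θ lam gamR π) (hgam : ∀ i, Θ.vert i ≠ i → gamR i = 0)
    (hmap : ∀ i, algebraMap R K (gamR i) = gam i) (hzero : ∀ i, gam i = 0 ↔ gamR i = 0)
    {red : SignedPerm n → List (Fin n)} (b : Module.Basis ((Fin n → ℕ) × SignedPerm n × β) R B)
    (hb : ∀ x, b x = Model.family π red x) :
    LinearIndependent K (Model.family (RingQuot.mkAlgHom K (Rel Γ Θ.vert lam gam β)) red) := by
  have hπK := Model.isModel_baseChange (K := K) hπ hgam hmap hzero
  let g := RingQuot.liftAlgHom K (s := Rel Γ Θ.vert lam gam β) ⟨Model.baseChange K π, hπK⟩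
  have hg : g.comp (RingQuot.mkAlgHom K (Rel Γ Θ.vert lam gam β)) = Model.baseChange K π :=
    AlgHom.ext fun x => RingQuot.liftAlgHom_mkAlgHom_apply ..
  refine LinearIndependent.of_comp g.toLinearMap ?_
  suffices hf : g.toLinearMap ∘ Model.family (RingQuot.mkAlgHom K (Rel Γ Θ.vert lam gam β)) red =
      Algebra.TensorProduct.basis K b from hf ▸ (Algebra.TensorProduct.basis K b).linearIndependent
  funext x
  rw [Function.comp_apply, AlgHom.toLinearMap_apply, ← Model.family_comp, hg,
    Model.family_baseChange, Algebra.TensorProduct.basis_apply, hb]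
  rfl

theorem linearIndependent_family_mkAlgHom (hgam : ∀ i, Θ.vert i ≠ i → gam i = 0)
    (hstrong : ∀ i, gam i = 0 → Θ.vert i ≠ i ∨ lam i + lam (Θ.vert i) = 0)
    (hβ : IsOrbit Θ.vert β) {red : SignedPerm n → List (Fin n)}
    (hred : ∀ w, IsReducedExpression w (red w)) :
    LinearIndependent K (Model.family (RingQuot.mkAlgHom K (Rel Γ Θ.vert lam gam β)) red) := by
  classical
  let R := MvPolynomial I ℤ
  let _ : Algebra R K := (aeval gam : MvPolynomial I ℤ →ₐ[ℤ] K).toRingHom.toAlgebra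
  -- Zeros of γ are kept, because the relations and the two hypotheses depend on where γ vanishes.
  let gamR : I → R := fun i => if gam i = 0 then 0 else X i
  have hzero : ∀ i, gam i = 0 ↔ gamR i = 0 := fun i => by
    by_cases h : gam i = 0
    · simp [gamR, h]
    · simp only [gamR, h, if_false, false_iff]
      exact X_ne_zero i
  have hmap : ∀ i, algebraMap R K (gamR i) = gam i := fun i => by
    by_cases h : gam i = 0
    · simp [gamR, h]
    · simp only [gamR, h, if_false]
      exact aeval_X _ _
  have hgamR : ∀ i, Θ.vert i ≠ i → gamR i = 0 := fun i hi => (hzero i).1 (hgam i hi)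
  have hstrongR : ∀ i, gamR i = 0 → Θ.vert i ≠ i ∨ lam i + lam (Θ.vert i) = 0 :=
    fun i hi => hstrong i ((hzero i).2 hi)
  have h2 : (2 : R) ≠ 0 := two_ne_zero
  -- Independence in the full endomorphism algebra need not survive base change to K. On the range
  -- the family is a basis, and a basis does survive.
  obtain ⟨π, hπ, b, hb⟩ := Model.exists_basis_range
    (isModel_polyRep (rationalField R n h2) lam hβ hgamR hstrongR) hgamR hβ hred
    (linearIndependent_family_polyRep h2 hgamR hstrongR hβ hred)
  exact Model.linearIndependent_mkAlgHom (B := AlgHom.range _) hπ hgamR hmap hzero b hb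

end Basis

end InterpolatingKLR

theorem theorem3p2 {I A K : Type*} [CommRing K]
    (Γ : InterpolatingKLR.LoopFreeQuiver I A) (Θ : Γ.Involution)
    (lam : I → ℕ) (gam : I → K)
    (hgam : ∀ i, Θ.vert i ≠ i → gam i = 0)
    (hstrong : ∀ i, gam i = 0 → Θ.vert i ≠ i ∨ lam i + lam (Θ.vert i) = 0)
    {n : ℕ} (β : Finset (Fin n → I)) (hβ : InterpolatingKLR.IsOrbit Θ.vert β)
    (red : InterpolatingKLR.SignedPerm n → List (Fin n))
    (hred : ∀ w, InterpolatingKLR.IsReducedExpression w (red w)) :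
    Module.Free K (InterpolatingKLR.V Γ Θ lam gam β) ∧
    ∃ B : Module.Basis ((Fin n → ℕ) × InterpolatingKLR.SignedPerm n × β) K
        (InterpolatingKLR.V Γ Θ lam gam β),
      ∀ (a : Fin n → ℕ) (w : InterpolatingKLR.SignedPerm n) (i : β),
        B (a, w, i) =
          InterpolatingKLR.V.yMonomial Γ Θ lam gam β a *
            InterpolatingKLR.V.psiWord Γ Θ lam gam β (red w) *
            InterpolatingKLR.V.e Γ Θ lam gam β i := by
  obtain ⟨b, hb⟩ := InterpolatingKLR.Model.exists_basis_of_linearIndependent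
    (π := RingQuot.mkAlgHom K (InterpolatingKLR.Rel Γ Θ.vert lam gam β))
    (fun x y h => RingQuot.mkAlgHom_rel K h) hgam hβ hred (RingQuot.mkAlgHom_surjective K _)
    (InterpolatingKLR.linearIndependent_family_mkAlgHom hgam hstrong hβ hred)
  exact ⟨Module.Free.of_basis b, b, fun a w i => hb (a, w, i)⟩
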